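/- **Setting.** Let $\mathcal C$ be an additive category with a symmetric monoidal structure $(\otimes,\mathbb 1)$ whose tensor product is bi-additive, and let $\mathcal C$ carry an exact category structure, that is, a class of kernel–cokernel pairs $I\rightarrowtail E\twoheadrightarrow Q$ (conflations), closed under isomorphism, such that: the identity of the zero object is a deflation; composites of deflations are deflations; pull-backs of deflations along arbitrary maps exist and are deflations; push-outs of inflations along arbitrary maps exist and are inflations. (Inflations and deflations are the first and second maps in conflations.) A conflation is *pure* if $I\otimes V\to E\otimes V\to Q\otimes V$ is a conflation for every object $V$. A chain complex $(C_n,d_n)$ is *exact* if for every $n$ the map $d_n$ has a kernel and $d_{n+1}$ induces a deflation $C_{n+1}\twoheadrightarrow\ker d_n$; it is *pure exact* if $C_\bullet\otimes V$ is exact for every $V$. A chain map is a *quasi-isomorphism* if its mapping cone is exact, and a *pure quasi-isomorphism* if it is a quasi-isomorphism after tensoring with any object $V$. Chain maps $A\xrightarrow{f}B\xrightarrow{g}C$ form a *pure cofibre sequence* if $g f=0$ and the induced map $\operatorname{cone}(f)\to C$ is a pure quasi-isomorphism. An *algebra* $A$ in $\mathcal C$ is an object with an associative multiplication $A\otimes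 A\to A$, possibly without unit. It is *homologically unital* if the complex $(A^{\otimes n},b')_{n\ge1}$ is pure exact, where $b'(x_0\otimes\dots\otimes x_n)=\sum_{j=0}^{n-1}(-1)^j x_0\otimes\dots\otimes x_jx_{j+1}\otimes\dots\otimes x_n$. Let $A^+=A\oplus\mathbb 1$ be the algebra obtained by adjoining a unit. Let $\mathbb{HH}(A)$ be the chain complex with $A$ in degree $0$ and $A^+\otimes A^{\otimes n}$ in degree $n\ge1$, with the Hochschild boundary map $$b(x_0\otimes\dots\otimes x_n)=b'(x_0\otimes\dots\otimes x_n)+(-1)^n x_nx_0\otimes x_1\otimes\dots\otimes x_{n-1};$$ equivalently, it is the kernel of the augmentation $(A^+\otimes A^{\otimes n},b)_{n\ge0}\to\mathbb 1$. For $n\ge0$ let $\mathrm{HH}_n(A)$ be the $n$th homology of the chain complex of abelian groups $\operatorname{Hom}(\mathbb 1,\mathbb{HH}(A))$, and $\mathrm{HH}^n(A)$ the $n$th cohomology of the cochain complex $\operatorname{Hom}(\mathbb{HH}(A),\mathbb 1)$; for $n<0$ both are $0$. $\mathrm{HH}_n$ is covariant and $\mathrm{HH}^n$ is contravariant. **Theorem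 (Excision).** Let $I\xrightarrow{i}E\xrightarrow{p}Q$ be algebra homomorphisms in $\mathcal C$ that form a pure conflation, and assume that $I$ is homologically unital. Then $\mathbb{HH}(I)\to\mathbb{HH}(E)\to\mathbb{HH}(Q)$ is a pure cofibre sequence. If $\mathbb 1$ is projective (maps from $\mathbb 1$ lift along all deflations), this yields a long exact sequence $$\dots\to\mathrm{HH}_n(I)\to\mathrm{HH}_n(E)\to\mathrm{HH}_n(Q)\to\mathrm{HH}_{n-1}(I)\to\mathrm{HH}_{n-1}(E)\to\cdots.$$ If $\mathbb 1$ is injective (maps to $\mathbb 1$ extend along all inflations), there is a long exact sequence $$\dots\to\mathrm{HH}^n(Q)\to\mathrm{HH}^n(E)\to\mathrm{HH}^n(I)\to\mathrm{HH}^{n+1}(Q)\to\mathrm{HH}^{n+1}(E)\to\cdots.$$ Both sequences are natural for morphisms between such conflations of algebras (commuting diagrams of algebra homomorphisms). The maps other than the connecting maps are induced by $i$ and $p$. The connecting maps $\delta$ are the usual ones: in homology, $\delta[z]=[x]$ if $x$ and $z$ are cycles and there is $y$ with $i_*x=dy$ and $p_*y=z$; in cohomology, $\delta[x]=[z]$ if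 $x$ and $z$ are cocycles and there is $y$ with $p^*z=dy$ and $i^*y=x$. -/

import Mathlib

open CategoryTheory MonoidalCategory Limits

universe v u

noncomputable section

namespace HochschildExcision

/-! ## Exact categories -/

section Exact

variable (C : Type u) [Category.{v} C] [Preadditive C]

variable {C} in
/-- `p` is the second map of a pair in the class `E`. -/
def IsDeflationOf (E : ShortComplex C → Prop) {X Y : C} (p : X ⟶ Y) : Prop :=
  ∃ (K : C) (i : K ⟶ X) (w : i ≫ p = 0), E (ShortComplex.mk i p w)

variable {C} in
/-- `i` is the first map of a pair in the class `E`. -/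
def IsInflationOf (E : ShortComplex C → Prop) {X Y : C} (i : X ⟶ Y) : Prop :=
  ∃ (Q : C) (p : Y ⟶ Q) (w : i ≫ p = 0), E (ShortComplex.mk i p w)

/-- An exact category structure (Quillen's axioms in Keller's form) on an additive category:
a class of kernel-cokernel pairs, the conflations, closed under isomorphism. A deflation is the
second map of a conflation and an inflation is the first map of a conflation. -/
structure ExactStructure where
  /-- the class of conflations -/
  IsConflation : ShortComplex C → Prop
  isKernel : ∀ S : ShortComplex C, IsConflation S →
    Nonempty (IsLimit (KernelFork.ofι S.f S.zero))
  isCokernel : ∀ S : ShortComplex C, IsConflation S →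
    Nonempty (IsColimit (CokernelCofork.ofπ S.g S.zero))
  of_iso : ∀ S T : ShortComplex C, Nonempty (S ≅ T) → IsConflation S → IsConflation T
  /-- the identity map on a zero object is a deflation -/
  id_zero : ∀ Z : C, IsZero Z → IsDeflationOf IsConflation (𝟙 Z)
  /-- a composite of deflations is a deflation -/
  comp_deflation : ∀ {X Y Z : C} (p : X ⟶ Y) (q : Y ⟶ Z),
    IsDeflationOf IsConflation p → IsDeflationOf IsConflation q →
      IsDeflationOf IsConflation (p ≫ q)
  /-- pull-backs of deflations along arbitrary maps exist and are deflations -/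
  pullback_deflation : ∀ {X Y Z : C} (p : X ⟶ Z) (g : Y ⟶ Z), IsDeflationOf IsConflation p →
    ∃ (P : C) (g' : P ⟶ X) (p' : P ⟶ Y), IsPullback g' p' p g ∧ IsDeflationOf IsConflation p'
  /-- push-outs of inflations along arbitrary maps exist and are inflations -/
  pushout_inflation : ∀ {X Y Z : C} (i : X ⟶ Y) (g : X ⟶ Z), IsInflationOf IsConflation i →
    ∃ (P : C) (g' : Y ⟶ P) (i' : Z ⟶ P), IsPushout i g g' i' ∧ IsInflationOf IsConflation i'

variable {C}

namespace ExactStructure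

variable (ℰ : ExactStructure C)

/-- Deflations: second maps of conflations. -/
def IsDeflation {X Y : C} (p : X ⟶ Y) : Prop := IsDeflationOf ℰ.IsConflation p

/-- Inflations: first maps of conflations. -/
def IsInflation {X Y : C} (i : X ⟶ Y) : Prop := IsInflationOf ℰ.IsConflation i

/-- An object `P` is projective if maps from `P` lift along all deflations. -/
def IsProjective (P : C) : Prop :=
  ∀ ⦃X Y : C⦄ (p : X ⟶ Y), ℰ.IsDeflation p → ∀ f : P ⟶ Y, ∃ g : P ⟶ X, g ≫ p = f

/-- An object `J` is injective if maps to `J` extend along all inflations. -/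
def IsInjective (J : C) : Prop :=
  ∀ ⦃X Y : C⦄ (i : X ⟶ Y), ℰ.IsInflation i → ∀ f : X ⟶ J, ∃ g : Y ⟶ J, i ≫ g = f

/-- A chain complex `K` (zero in negative degrees) is exact if, for every `n`, the differential
`d_n` starting at `K_n` has a kernel `Z` and `d_{n+1} : K_{n+1} ⟶ K_n` induces a
deflation `K_{n+1} ⟶ Z`. For `n = 0` the map `d_0 = K.d 0 0` is zero. -/
def IsExact (K : ChainComplex C ℕ) : Prop :=
  ∀ n : ℕ, ∃ (Z : C) (ι : Z ⟶ K.X n) (w : ι ≫ K.d n (n - 1) = 0),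
    Nonempty (IsLimit (KernelFork.ofι ι w)) ∧
      ∃ π : K.X (n + 1) ⟶ Z, π ≫ ι = K.d (n + 1) n ∧ ℰ.IsDeflation π

/-- A quasi-isomorphism is a chain map whose mapping cone is exact. -/
def IsQuasiIso [HasBinaryBiproducts C] {K L : ChainComplex C ℕ} (f : K ⟶ L) : Prop :=
  ℰ.IsExact (HomologicalComplex.homotopyCofiber f)

variable [MonoidalCategory C] [MonoidalPreadditive C]

/-- A conflation is pure if it remains a conflation after tensoring with any object. -/
def IsPure (S : ShortComplex C) : Prop :=
  ℰ.IsConflation S ∧ ∀ V : C, ℰ.IsConflation (S.map (tensorRight V))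

/-- A complex `K` is pure exact if `K ⊗ V` is exact for all objects `V`. -/
def IsPureExact (K : ChainComplex C ℕ) : Prop :=
  ∀ V : C, ℰ.IsExact (((tensorRight V).mapHomologicalComplex _).obj K)

/-- A chain map `f` is a pure quasi-isomorphism if `f ⊗ id_V` is a quasi-isomorphism
for all objects `V`. -/
def IsPureQuasiIso [HasBinaryBiproducts C] {K L : ChainComplex C ℕ} (f : K ⟶ L) : Prop :=
  ∀ V : C, ℰ.IsQuasiIso (((tensorRight V).mapHomologicalComplex _).map f)

/-- `K ⟶ L ⟶ M` is a pure cofibre sequence if the composite is zero and the induced map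
from the mapping cone of `f` to `M` is a pure quasi-isomorphism. -/
def IsPureCofibreSequence [HasBinaryBiproducts C] {K L M : ChainComplex C ℕ}
    (f : K ⟶ L) (g : L ⟶ M) : Prop :=
  ∃ w : f ≫ g = 0,
    ℰ.IsPureQuasiIso (HomologicalComplex.homotopyCofiber.desc f g (Homotopy.ofEq w))

end ExactStructure

end Exact

/-! ## Algebras and bimodules in a monoidal category -/

section Algebras

variable (C : Type u) [Category.{v} C] [MonoidalCategory C]

/-- An algebra, possibly without unit. -/
structure Alg where
  X : C
  mul : X ⊗ X ⟶ X
  assoc : mul ▷ X ≫ mul = (α_ X X X).hom ≫ X ◁ mul ≫ mul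

variable {C}

/-- Algebra homomorphisms. -/
structure AlgHom (A B : Alg C) where
  hom : A.X ⟶ B.X
  map_mul : A.mul ≫ hom = (hom ⊗ₘ hom) ≫ B.mul

/-- A bimodule over an algebra `A`. -/
structure Bimodule (A : Alg C) where
  X : C
  left : A.X ⊗ X ⟶ X
  right : X ⊗ A.X ⟶ X
  left_assoc : A.mul ▷ X ≫ left = (α_ A.X A.X X).hom ≫ A.X ◁ left ≫ left
  right_assoc : right ▷ A.X ≫ right = (α_ X A.X A.X).hom ≫ X ◁ A.mul ≫ right
  middle_assoc : left ▷ A.X ≫ right = (α_ A.X X A.X).hom ≫ A.X ◁ right ≫ left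

/-- A map of bimodules over an algebra homomorphism `f`. -/
structure BimoduleHom {A B : Alg C} (f : AlgHom A B) (M : Bimodule A) (N : Bimodule B) where
  hom : M.X ⟶ N.X
  map_left : M.left ≫ hom = (f.hom ⊗ₘ hom) ≫ N.left
  map_right : M.right ≫ hom = (hom ⊗ₘ f.hom) ≫ N.right

/-- `A` as a bimodule over itself. -/
def regular (A : Alg C) : Bimodule A where
  X := A.X
  left := A.mul
  right := A.mul
  left_assoc := A.assoc
  right_assoc := A.assoc
  middle_assoc := A.assoc

namespace Bimodule

variable {A B : Alg C}

/-- The bimodule `M ⊗ A`, where `A` acts on the left on the factor `M` and on the right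
on the factor `A`. -/
def tensorAlg (M : Bimodule A) : Bimodule A where
  X := M.X ⊗ A.X
  left := (α_ A.X M.X A.X).inv ≫ M.left ▷ A.X
  right := (α_ M.X A.X A.X).hom ≫ M.X ◁ A.mul
  left_assoc := by
    have h := congrArg (fun t => (α_ (A.X ⊗ A.X) M.X A.X).inv ≫ t ▷ A.X) M.left_assoc
    simp only [comp_whiskerRight] at h
    have h' : A.mul ▷ (M.X ⊗ A.X) ≫ (α_ A.X M.X A.X).inv ≫ M.left ▷ A.X =
        (α_ (A.X ⊗ A.X) M.X A.X).inv ≫ A.mul ▷ M.X ▷ A.X ≫ M.left ▷ A.X := by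
      simp
    rw [h', h]
    monoidal
  right_assoc := by
    have h := congrArg (fun t => (α_ (M.X ⊗ A.X) A.X A.X).hom ≫ (α_ M.X A.X (A.X ⊗ A.X)).hom ≫
      M.X ◁ ((α_ A.X A.X A.X).inv ≫ t)) A.assoc
    simp only [Iso.inv_hom_id_assoc, MonoidalCategory.whiskerLeft_comp] at h
    have h' : ((α_ M.X A.X A.X).hom ≫ M.X ◁ A.mul) ▷ A.X ≫ (α_ M.X A.X A.X).hom ≫ M.X ◁ A.mul =
        (α_ (M.X ⊗ A.X) A.X A.X).hom ≫ (α_ M.X A.X (A.X ⊗ A.X)).hom ≫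
          M.X ◁ (α_ A.X A.X A.X).inv ≫ M.X ◁ A.mul ▷ A.X ≫ M.X ◁ A.mul := by
      simp
    rw [h', h]
    simp
  middle_assoc := by
    have h := congrArg (fun t => (α_ (A.X ⊗ M.X) A.X A.X).hom ≫ t)
      (whisker_exchange M.left A.mul)
    simp only [whisker_exchange, comp_whiskerRight, Category.assoc] at h ⊢
    simp only [associator_naturality_left_assoc, ← whisker_exchange]
    simp

/-- The bimodule `M ⊗ A ⊗ ⋯ ⊗ A` with `n` factors `A`, bracketed to the left. -/
def tensorPow (M : Bimodule A) : ℕ → Bimodule A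
  | 0 => M
  | n + 1 => (tensorPow M n).tensorAlg

/-- The map `M ⊗ A^{⊗n} ⊗ A ⊗ A ⟶ M ⊗ A^{⊗n} ⊗ A` that multiplies the last two factors. -/
def mulLast (M : Bimodule A) (n : ℕ) :
    ((M.tensorPow n).X ⊗ A.X) ⊗ A.X ⟶ (M.tensorPow n).X ⊗ A.X :=
  (α_ (M.tensorPow n).X A.X A.X).hom ≫ (M.tensorPow n).X ◁ A.mul

end Bimodule

/-- The map `M ⊗ A ⟶ N ⊗ B` induced by a map of bimodules over `f : A ⟶ B`. -/
def BimoduleHom.tensorAlg {A B : Alg C} {f : AlgHom A B} {M : Bimodule A} {N : Bimodule B}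
    (φ : BimoduleHom f M N) : BimoduleHom f M.tensorAlg N.tensorAlg where
  hom := φ.hom ⊗ₘ f.hom
  map_left := by
    have h : M.left ▷ A.X ≫ (φ.hom ⊗ₘ f.hom) =
        ((f.hom ⊗ₘ φ.hom) ⊗ₘ f.hom) ≫ N.left ▷ B.X := by
      rw [← tensorHom_id, ← tensorHom_id, tensorHom_comp_tensorHom, tensorHom_comp_tensorHom,
        φ.map_left, Category.id_comp, Category.comp_id]
    simp only [Bimodule.tensorAlg, Category.assoc, h, associator_inv_naturality_assoc]
  map_right := by
    have h : M.X ◁ A.mul ≫ (φ.hom ⊗ₘ f.hom) =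
        (φ.hom ⊗ₘ (f.hom ⊗ₘ f.hom)) ≫ N.X ◁ B.mul := by
      rw [← id_tensorHom, ← id_tensorHom, tensorHom_comp_tensorHom, tensorHom_comp_tensorHom,
        f.map_mul, Category.id_comp, Category.comp_id]
    simp only [Bimodule.tensorAlg, Category.assoc, h, associator_naturality_assoc]

/-- The map `φ ⊗ f ⊗ ⋯ ⊗ f` with `n` factors `f`. -/
def BimoduleHom.tensorPow {A B : Alg C} {f : AlgHom A B} {M : Bimodule A} {N : Bimodule B}
    (φ : BimoduleHom f M N) : (n : ℕ) → BimoduleHom f (M.tensorPow n) (N.tensorPow n)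
  | 0 => φ
  | n + 1 => (φ.tensorPow n).tensorAlg

end Algebras

/-! ## The Hochschild complex -/

lemma comp_square_aux {C : Type u} [Category.{v} C] {W W' X X' Y Y' : C} {t : W ⟶ W'} {b : W ⟶ X} {b' : W' ⟶ X'} {m : X ⟶ X'}
    {q : X ⟶ Y} {q' : X' ⟶ Y'} {f : Y ⟶ Y'} (h : t ≫ b' = b ≫ m) (h' : m ≫ q' = q ≫ f) :
    t ≫ b' ≫ q' = (b ≫ q) ≫ f := by
  rw [reassoc_of% h, h', Category.assoc]

section Hochschild

set_option linter.unusedSectionVars false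
set_option linter.unnecessarySimpa false

variable {C : Type u} [Category.{v} C] [Preadditive C] [MonoidalCategory C]
  [MonoidalPreadditive C]

/-- The map `b' : M ⊗ A^{⊗(n+1)} ⟶ M ⊗ A^{⊗n}`,
`b' (x₀ ⊗ ⋯ ⊗ x_{n+1}) = ∑_{j=0}^{n} (-1)^j x₀ ⊗ ⋯ ⊗ x_j x_{j+1} ⊗ ⋯ ⊗ x_{n+1}`.
The summands with `j < n` do not involve the last tensor factor, and the summand `j = n`
multiplies the last two tensor factors. -/
def bPrime {A : Alg C} (M : Bimodule A) :
    (n : ℕ) → ((M.tensorPow n).X ⊗ A.X ⟶ (M.tensorPow n).X)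
  | 0 => M.right
  | n + 1 => bPrime M n ▷ A.X + (-1 : ℤ) ^ (n + 1) • M.mulLast n

/-- The last summand of `b` without its sign: the map `M ⊗ A^{⊗(n+1)} ⟶ M ⊗ A^{⊗n}`,
`x₀ ⊗ ⋯ ⊗ x_{n+1} ↦ x_{n+1} x₀ ⊗ x₁ ⊗ ⋯ ⊗ x_n`. -/
def bLast [BraidedCategory C] {A : Alg C} (M : Bimodule A) (n : ℕ) :
    (M.tensorPow n).X ⊗ A.X ⟶ (M.tensorPow n).X :=
  (β_ (M.tensorPow n).X A.X).hom ≫ (M.tensorPow n).left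

/-- The Hochschild boundary map `b : M ⊗ A^{⊗(n+1)} ⟶ M ⊗ A^{⊗n}`. -/
def hochschildB [BraidedCategory C] {A : Alg C} (M : Bimodule A) (n : ℕ) :
    (M.tensorPow n).X ⊗ A.X ⟶ (M.tensorPow n).X :=
  bPrime M n + (-1 : ℤ) ^ (n + 1) • bLast M n

lemma zsmul_whiskerRight (X : C) {Y Z : C} (e : ℤ) (f : Y ⟶ Z) :
    (e • f) ▷ X = e • (f ▷ X) :=
  (tensorRight X).map_zsmul

lemma whiskerLeft_zsmul (X : C) {Y Z : C} (e : ℤ) (f : Y ⟶ Z) :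
    X ◁ (e • f) = e • (X ◁ f) :=
  (tensorLeft X).map_zsmul

lemma bPrime_sq_step {A : Alg C} (X : C) (g : X ⊗ A.X ⟶ X) (e : ℤ)
    (h : (g ▷ A.X + e • ((α_ X A.X A.X).hom ≫ X ◁ A.mul)) ≫ g = 0) :
    ((g ▷ A.X + e • ((α_ X A.X A.X).hom ≫ X ◁ A.mul)) ▷ A.X +
      (-e) • ((α_ (X ⊗ A.X) A.X A.X).hom ≫ (X ⊗ A.X) ◁ A.mul)) ≫
      (g ▷ A.X + e • ((α_ X A.X A.X).hom ≫ X ◁ A.mul)) = 0 := by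
  set r₁ := (α_ X A.X A.X).hom ≫ X ◁ A.mul with hr₁
  set r₂ := (α_ (X ⊗ A.X) A.X A.X).hom ≫ (X ⊗ A.X) ◁ A.mul with hr₂
  have h₁ : g ▷ A.X ▷ A.X ≫ r₁ = r₂ ≫ g ▷ A.X := by
    rw [hr₁, hr₂, associator_naturality_left_assoc, Category.assoc, whisker_exchange]
  have h₂ : r₁ ▷ A.X ≫ r₁ = r₂ ≫ r₁ := by
    have h := congrArg (fun t => (α_ (X ⊗ A.X) A.X A.X).hom ≫ (α_ X A.X (A.X ⊗ A.X)).hom ≫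
      X ◁ ((α_ A.X A.X A.X).inv ≫ t)) A.assoc
    simp only [Iso.inv_hom_id_assoc, MonoidalCategory.whiskerLeft_comp] at h
    have h' : r₁ ▷ A.X ≫ r₁ =
        (α_ (X ⊗ A.X) A.X A.X).hom ≫ (α_ X A.X (A.X ⊗ A.X)).hom ≫
          X ◁ (α_ A.X A.X A.X).inv ≫ X ◁ A.mul ▷ A.X ≫ X ◁ A.mul := by
      simp [hr₁]
    rw [h', h]
    simp [hr₁, hr₂]
  have h₃ : (g ▷ A.X + e • r₁) ▷ A.X ≫ g ▷ A.X = 0 := by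
    rw [← comp_whiskerRight, h, MonoidalPreadditive.zero_whiskerRight]
  rw [Preadditive.add_comp, Preadditive.comp_add, h₃, zero_add,
    MonoidalPreadditive.add_whiskerRight, zsmul_whiskerRight]
  simp only [Preadditive.add_comp, Preadditive.comp_add, Preadditive.zsmul_comp,
    Preadditive.comp_zsmul, h₁, h₂, neg_smul, smul_add, Preadditive.neg_comp, smul_neg]
  abel

lemma bPrime_sq {A : Alg C} (M : Bimodule A) (n : ℕ) :
    (bPrime M (n + 1) : ((M.tensorPow n).X ⊗ A.X) ⊗ A.X ⟶ (M.tensorPow n).X ⊗ A.X) ≫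
      bPrime M n = 0 := by
  induction n with
  | zero =>
    have := M.right_assoc
    change (M.right ▷ A.X + (-1 : ℤ) ^ (0 + 1) • ((α_ M.X A.X A.X).hom ≫ M.X ◁ A.mul)) ≫
      M.right = 0
    rw [Preadditive.add_comp, this]
    simp
  | succ n ih =>
    have := bPrime_sq_step _ _ _ ih
    rw [bPrime, pow_succ, mul_neg_one]
    exact this

lemma bPrime_left_step {A : Alg C} (N : Bimodule A) (g : N.X ⊗ A.X ⟶ N.X) (e : ℤ)
    (hl : ((α_ A.X N.X A.X).inv ≫ N.left ▷ A.X) ≫ g = A.X ◁ g ≫ N.left) :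
    ((α_ A.X (N.X ⊗ A.X) A.X).inv ≫ ((α_ A.X N.X A.X).inv ≫ N.left ▷ A.X) ▷ A.X) ≫
      (g ▷ A.X + e • ((α_ N.X A.X A.X).hom ≫ N.X ◁ A.mul)) =
    A.X ◁ (g ▷ A.X + e • ((α_ N.X A.X A.X).hom ≫ N.X ◁ A.mul)) ≫
      ((α_ A.X N.X A.X).inv ≫ N.left ▷ A.X) := by
  have h₂ := congrArg (fun t => (α_ A.X (N.X ⊗ A.X) A.X).inv ≫ t) N.tensorAlg.middle_assoc
  simp only [Bimodule.tensorAlg, Iso.inv_hom_id_assoc] at h₂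
  have h₁ : (α_ A.X (N.X ⊗ A.X) A.X).inv ≫
      ((α_ A.X N.X A.X).inv ≫ N.left ▷ A.X) ▷ A.X ≫ g ▷ A.X =
      A.X ◁ g ▷ A.X ≫ (α_ A.X N.X A.X).inv ≫ N.left ▷ A.X := by
    rw [← comp_whiskerRight, hl]
    simp
  rw [Preadditive.comp_add, MonoidalPreadditive.whiskerLeft_add, Preadditive.add_comp,
    whiskerLeft_zsmul, Preadditive.comp_zsmul, Preadditive.zsmul_comp, Category.assoc,
    Category.assoc, h₂, h₁]

lemma bPrime_left {A : Alg C} (M : Bimodule A) (n : ℕ) :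
    ((α_ A.X (M.tensorPow n).X A.X).inv ≫ (M.tensorPow n).left ▷ A.X) ≫ bPrime M n =
      A.X ◁ bPrime M n ≫ (M.tensorPow n).left := by
  induction n with
  | zero => simpa [bPrime, Bimodule.tensorPow] using
      congrArg (fun t => (α_ A.X M.X A.X).inv ≫ t) M.middle_assoc
  | succ n ih =>
    exact bPrime_left_step (M.tensorPow n) _ _ ih

lemma hochschildB_sq_step [SymmetricCategory C] {A : Alg C} (N : Bimodule A)
    (g : N.X ⊗ A.X ⟶ N.X) (e : ℤ)
    (h : (g ▷ A.X + e • ((α_ N.X A.X A.X).hom ≫ N.X ◁ A.mul)) ≫ g = 0)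
    (hl : ((α_ A.X N.X A.X).inv ≫ N.left ▷ A.X) ≫ g = A.X ◁ g ≫ N.left) :
    ((g ▷ A.X + e • ((α_ N.X A.X A.X).hom ≫ N.X ◁ A.mul)) +
      (-e) • ((β_ (N.X ⊗ A.X) A.X).hom ≫ (α_ A.X N.X A.X).inv ≫ N.left ▷ A.X)) ≫
      (g + e • ((β_ N.X A.X).hom ≫ N.left)) = 0 := by
  have h₁ : g ▷ A.X ≫ (β_ N.X A.X).hom ≫ N.left =
      ((β_ (N.X ⊗ A.X) A.X).hom ≫ (α_ A.X N.X A.X).inv ≫ N.left ▷ A.X) ≫ g := by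
    simp only [Category.assoc] at hl ⊢
    rw [hl, BraidedCategory.braiding_naturality_left_assoc]
  have h₃ : (α_ N.X A.X A.X).hom ≫ (β_ N.X (A.X ⊗ A.X)).hom ≫ (α_ A.X A.X N.X).hom =
      (β_ (N.X ⊗ A.X) A.X).hom ≫ (α_ A.X N.X A.X).inv ≫ (β_ (A.X ⊗ N.X) A.X).hom := by
    have e₁ : (β_ (N.X ⊗ A.X) A.X).hom ≫ (α_ A.X N.X A.X).inv =
        (α_ N.X A.X A.X).hom ≫ N.X ◁ (β_ A.X A.X).hom ≫ (α_ N.X A.X A.X).inv ≫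
          (β_ N.X A.X).hom ▷ A.X := by
      rw [← BraidedCategory.hexagon_reverse, Iso.hom_inv_id_assoc]
    have e₂ : (β_ (A.X ⊗ N.X) A.X).hom =
        (α_ A.X N.X A.X).hom ≫ A.X ◁ (β_ N.X A.X).hom ≫ (α_ A.X A.X N.X).inv ≫
          (β_ A.X A.X).hom ▷ N.X ≫ (α_ A.X A.X N.X).hom := by
      have := BraidedCategory.hexagon_reverse A.X N.X A.X
      rw [← cancel_epi (α_ A.X N.X A.X).inv, ← cancel_mono (α_ A.X A.X N.X).inv]
      simpa using this
    have e₃ : (β_ N.X A.X).hom ▷ A.X ≫ (α_ A.X N.X A.X).hom ≫ A.X ◁ (β_ N.X A.X).hom =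
        (α_ N.X A.X A.X).hom ≫ (β_ N.X (A.X ⊗ A.X)).hom ≫ (α_ A.X A.X N.X).hom :=
      (BraidedCategory.hexagon_forward _ _ _).symm
    rw [reassoc_of% e₁, e₂, reassoc_of% e₃]
    simp only [Iso.hom_inv_id_assoc, Iso.inv_hom_id_assoc,
      ← BraidedCategory.braiding_naturality_right_assoc]
    rw [← MonoidalCategory.whiskerLeft_comp_assoc, SymmetricCategory.symmetry,
      MonoidalCategory.whiskerLeft_id, Category.id_comp]
  have h₂ : ((α_ N.X A.X A.X).hom ≫ N.X ◁ A.mul) ≫ (β_ N.X A.X).hom ≫ N.left =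
      ((β_ (N.X ⊗ A.X) A.X).hom ≫ (α_ A.X N.X A.X).inv ≫ N.left ▷ A.X) ≫
        (β_ N.X A.X).hom ≫ N.left := by
    simp only [Category.assoc, BraidedCategory.braiding_naturality_right_assoc,
      BraidedCategory.braiding_naturality_left_assoc, N.left_assoc]
    rw [reassoc_of% h₃]
  set t₂ := (β_ (N.X ⊗ A.X) A.X).hom ≫ (α_ A.X N.X A.X).inv ≫ N.left ▷ A.X
  set t₁ := (β_ N.X A.X).hom ≫ N.left
  rw [Preadditive.add_comp, Preadditive.comp_add, h, zero_add]
  simp only [Preadditive.add_comp, Preadditive.comp_add, Preadditive.zsmul_comp,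
    Preadditive.comp_zsmul, h₁, h₂, neg_smul, smul_add, Preadditive.neg_comp, smul_neg]
  abel

lemma hochschildB_sq [SymmetricCategory C] {A : Alg C} (M : Bimodule A) (n : ℕ) :
    (hochschildB M (n + 1) : ((M.tensorPow n).X ⊗ A.X) ⊗ A.X ⟶ (M.tensorPow n).X ⊗ A.X) ≫
      hochschildB M n = 0 := by
  have := hochschildB_sq_step (M.tensorPow n) (bPrime M n) ((-1) ^ (n + 1)) (bPrime_sq M n)
    (bPrime_left M n)
  rw [hochschildB, pow_succ, mul_neg_one]
  exact this

lemma bPrime_naturality {A B : Alg C} {f : AlgHom A B} {M : Bimodule A} {N : Bimodule B}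
    (φ : BimoduleHom f M N) (n : ℕ) :
    ((φ.tensorPow n).hom ⊗ₘ f.hom) ≫ bPrime N n = bPrime M n ≫ (φ.tensorPow n).hom := by
  induction n with
  | zero => exact φ.map_right.symm
  | succ n ih =>
    have h₁ : (((φ.tensorPow n).hom ⊗ₘ f.hom) ⊗ₘ f.hom) ≫ (bPrime N n ▷ B.X) =
        (bPrime M n ▷ A.X) ≫ ((φ.tensorPow n).hom ⊗ₘ f.hom) := by
      rw [← tensorHom_id, ← tensorHom_id, tensorHom_comp_tensorHom, tensorHom_comp_tensorHom,
        ih, Category.id_comp, Category.comp_id]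
    have h₂ : (((φ.tensorPow n).hom ⊗ₘ f.hom) ⊗ₘ f.hom) ≫ N.mulLast n =
        M.mulLast n ≫ ((φ.tensorPow n).hom ⊗ₘ f.hom) :=
      (φ.tensorPow n).tensorAlg.map_right.symm
    change (((φ.tensorPow n).hom ⊗ₘ f.hom) ⊗ₘ f.hom) ≫
        (bPrime N n ▷ B.X + (-1 : ℤ) ^ (n + 1) • N.mulLast n) =
      (bPrime M n ▷ A.X + (-1 : ℤ) ^ (n + 1) • M.mulLast n) ≫
        ((φ.tensorPow n).hom ⊗ₘ f.hom)
    rw [Preadditive.comp_add, Preadditive.add_comp, Preadditive.comp_zsmul,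
      Preadditive.zsmul_comp, h₁, h₂]

lemma hochschildB_naturality [BraidedCategory C] {A B : Alg C} {f : AlgHom A B}
    {M : Bimodule A} {N : Bimodule B} (φ : BimoduleHom f M N) (n : ℕ) :
    ((φ.tensorPow n).hom ⊗ₘ f.hom) ≫ hochschildB N n =
      hochschildB M n ≫ (φ.tensorPow n).hom := by
  have h : ((φ.tensorPow n).hom ⊗ₘ f.hom) ≫ bLast N n = bLast M n ≫ (φ.tensorPow n).hom := by
    rw [bLast, bLast, BraidedCategory.braiding_naturality_assoc, Category.assoc,
      (φ.tensorPow n).map_left]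
  rw [hochschildB, hochschildB, Preadditive.comp_add, Preadditive.add_comp,
    Preadditive.comp_zsmul, Preadditive.zsmul_comp, bPrime_naturality, h]

/-- The chain complex `(A^{⊗n}, b')_{n ≥ 1}`, with `A^{⊗(n+1)}` in degree `n`. -/
def barComplex (A : Alg C) : ChainComplex C ℕ :=
  ChainComplex.of (fun n => ((regular A).tensorPow n).X) (fun n => bPrime (regular A) n)
    (fun n => bPrime_sq (regular A) n)

/-- An algebra `A` is homologically unital if `(A^{⊗n}, b')_{n ≥ 1}` is pure exact. -/
def ExactStructure.IsHUnital (ℰ : ExactStructure C) (A : Alg C) : Prop :=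
  ℰ.IsPureExact (barComplex A)

variable [HasBinaryBiproducts C]

/-- The underlying `A`-bimodule of the algebra `A⁺ = A ⊕ 𝟙` obtained by adjoining a unit to `A`:
`(x + s) a = x a + s a` and `a (x + s) = a x + a s` for `s` in the summand `𝟙`. -/
def adjoinUnit (A : Alg C) : Bimodule A where
  X := A.X ⊞ 𝟙_ C
  left := (A.X ◁ biprod.fst ≫ A.mul + A.X ◁ biprod.snd ≫ (ρ_ A.X).hom) ≫ biprod.inl
  right := (biprod.fst ▷ A.X ≫ A.mul + biprod.snd ▷ A.X ≫ (λ_ A.X).hom) ≫ biprod.inl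
  left_assoc := by
    simp only [MonoidalCategory.whiskerLeft_comp, Preadditive.comp_add, Preadditive.add_comp,
      MonoidalPreadditive.whiskerLeft_add, Category.assoc, Preadditive.comp_add,
      ← MonoidalCategory.whiskerLeft_comp_assoc (A.X) biprod.inl, biprod.inl_fst, biprod.inl_snd,
      MonoidalCategory.whiskerLeft_id, MonoidalPreadditive.whiskerLeft_zero, zero_comp, comp_zero,
      add_zero, Category.id_comp]
    congr 1
    · rw [← whisker_exchange_assoc, reassoc_of% A.assoc]
      simp
    · rw [← whisker_exchange_assoc]
      simp
  right_assoc := by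
    simp only [comp_whiskerRight, Preadditive.comp_add, Preadditive.add_comp,
      MonoidalPreadditive.add_whiskerRight, Category.assoc, Preadditive.comp_add,
      ← comp_whiskerRight_assoc biprod.inl, biprod.inl_fst, biprod.inl_snd,
      id_whiskerRight, MonoidalPreadditive.zero_whiskerRight, zero_comp, comp_zero,
      add_zero, Category.id_comp]
    congr 1
    · rw [reassoc_of% A.assoc, whisker_exchange_assoc]
      simp
    · rw [whisker_exchange_assoc]
      simp
  middle_assoc := by
    simp only [comp_whiskerRight, MonoidalCategory.whiskerLeft_comp, Preadditive.comp_add,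
      Preadditive.add_comp, MonoidalPreadditive.whiskerLeft_add,
      MonoidalPreadditive.add_whiskerRight, Category.assoc, Preadditive.comp_add,
      ← comp_whiskerRight_assoc biprod.inl, biprod.inl_fst, biprod.inl_snd,
      ← MonoidalCategory.whiskerLeft_comp_assoc (A.X) biprod.inl,
      MonoidalCategory.whiskerLeft_id, MonoidalPreadditive.whiskerLeft_zero,
      id_whiskerRight, MonoidalPreadditive.zero_whiskerRight, zero_comp, comp_zero,
      add_zero, Category.id_comp]
    congr 1
    · rw [reassoc_of% A.assoc]
      simp
    · simp

/-- The map `A⁺ ⟶ B⁺` induced by an algebra homomorphism `f : A ⟶ B`. -/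
def adjoinUnitMap {A B : Alg C} (f : AlgHom A B) :
    BimoduleHom f (adjoinUnit A) (adjoinUnit B) where
  hom := biprod.map f.hom (𝟙 _)
  map_left := by
    simp only [adjoinUnit, Category.assoc, biprod.inl_map, Preadditive.comp_add,
      Preadditive.add_comp, reassoc_of% f.map_mul]
    simp only [← Category.assoc, ← id_tensorHom, tensorHom_comp_tensorHom, biprod.map_fst,
      biprod.map_snd, Category.id_comp, Category.comp_id]
    congr 2
    rw [Category.assoc, ← rightUnitor_naturality, ← tensorHom_id, tensorHom_comp_tensorHom_assoc,
      Category.id_comp, Category.comp_id]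
  map_right := by
    simp only [adjoinUnit, Category.assoc, biprod.inl_map, Preadditive.comp_add,
      Preadditive.add_comp, reassoc_of% f.map_mul]
    simp only [← Category.assoc, ← tensorHom_id, tensorHom_comp_tensorHom, biprod.map_fst,
      biprod.map_snd, Category.id_comp, Category.comp_id]
    congr 2
    rw [Category.assoc, ← leftUnitor_naturality, ← id_tensorHom, tensorHom_comp_tensorHom_assoc,
      Category.id_comp, Category.comp_id]

variable [SymmetricCategory C]

/-- The boundary map of `(A⁺ ⊗ A^{⊗n}, b)` takes values in the kernel of the
augmentation `A⁺ ⟶ 𝟙` in degree `0`. -/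
lemma hochschildB_adjoinUnit_snd (A : Alg C) :
    hochschildB (adjoinUnit A) 0 ≫ (biprod.snd : A.X ⊞ 𝟙_ C ⟶ 𝟙_ C) = 0 := by
  have h : ∀ {X : C} (f g : X ⟶ A.X) (e : ℤ),
      (f ≫ biprod.inl + e • (g ≫ biprod.inl)) ≫ (biprod.snd : A.X ⊞ 𝟙_ C ⟶ 𝟙_ C) = 0 := by
    intro X f g e
    simp
  refine Eq.trans ?_ (h (biprod.fst ▷ A.X ≫ A.mul + biprod.snd ▷ A.X ≫ (λ_ A.X).hom)
    ((β_ (A.X ⊞ 𝟙_ C) A.X).hom ≫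
      (A.X ◁ biprod.fst ≫ A.mul + A.X ◁ biprod.snd ≫ (ρ_ A.X).hom)) ((-1) ^ (0 + 1)))
  rw [Category.assoc (β_ (A.X ⊞ 𝟙_ C) A.X).hom]
  rfl

/-- The objects of the chain complex `HH(A)`: `A` in degree `0` and `A⁺ ⊗ A^{⊗n}` in
degree `n ≥ 1`. -/
def hochschildX (A : Alg C) : ℕ → C
  | 0 => A.X
  | n + 1 => ((adjoinUnit A).tensorPow (n + 1)).X

/-- The boundary map `b` of `HH(A)`. -/
def hochschildD (A : Alg C) : (n : ℕ) → (hochschildX A (n + 1) ⟶ hochschildX A n)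
  | 0 => hochschildB (adjoinUnit A) 0 ≫ biprod.fst
  | n + 1 => hochschildB (adjoinUnit A) (n + 1)

lemma hochschildD_sq (A : Alg C) (n : ℕ) : hochschildD A (n + 1) ≫ hochschildD A n = 0 := by
  cases n with
  | zero =>
    have h := hochschildB_sq (adjoinUnit A) 0
    exact (Category.assoc _ _ _).symm.trans ((congrArg (fun t => t ≫ _) h).trans zero_comp)
  | succ n => exact hochschildB_sq (adjoinUnit A) (n + 1)

/-- The Hochschild chain complex `HH(A)` of an algebra `A`, possibly without unit: the kernel of
the augmentation map from `(A⁺ ⊗ A^{⊗n}, b)` to `𝟙`. -/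
def hochschild (A : Alg C) : ChainComplex C ℕ :=
  ChainComplex.of (hochschildX A) (hochschildD A) (hochschildD_sq A)

/-- The components of the chain map `HH(A) ⟶ HH(B)`. -/
def hochschildMapX {A B : Alg C} (f : AlgHom A B) : (n : ℕ) → (hochschildX A n ⟶ hochschildX B n)
  | 0 => f.hom
  | n + 1 => ((adjoinUnitMap f).tensorPow (n + 1)).hom

lemma hochschildMapX_comm {A B : Alg C} (f : AlgHom A B) (n : ℕ) :
    hochschildMapX f (n + 1) ≫ hochschildD B n = hochschildD A n ≫ hochschildMapX f n := by
  cases n with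
  | zero =>
    have h := hochschildB_naturality (adjoinUnitMap f) 0
    have h' : (adjoinUnitMap f).hom ≫ (biprod.fst : B.X ⊞ 𝟙_ C ⟶ B.X) = biprod.fst ≫ f.hom :=
      biprod.map_fst _ _
    change ((adjoinUnitMap f).hom ⊗ₘ f.hom) ≫ hochschildB (adjoinUnit B) 0 ≫ biprod.fst =
      (hochschildB (adjoinUnit A) 0 ≫ biprod.fst) ≫ f.hom
    exact comp_square_aux h h'
  | succ n => exact hochschildB_naturality (adjoinUnitMap f) (n + 1)

/-- The chain map `HH(A) ⟶ HH(B)` induced by an algebra homomorphism `f : A ⟶ B`. -/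
def hochschildMap {A B : Alg C} (f : AlgHom A B) : hochschild A ⟶ hochschild B :=
  ChainComplex.ofHom (hochschildMapX f) (fun n => by
    simpa only [hochschild, ChainComplex.of_d] using hochschildMapX_comm f n)

end Hochschild

/-! ## Homology and cohomology -/

section Homology

variable {C : Type u} [Category.{v} C] [Preadditive C] [MonoidalCategory C]

/-- The functor `K ↦ Hom(𝟙, K)` from chain complexes in `C` to chain complexes of abelian
groups. -/
def forgetComplex : ChainComplex C ℕ ⥤ ChainComplex AddCommGrpCat.{v} ℕ :=
  (preadditiveCoyoneda.obj (Opposite.op (𝟙_ C))).mapHomologicalComplex _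

/-- The functor `K ↦ Hom(K, 𝟙)` from chain complexes in `C` to cochain complexes of abelian
groups. -/
def dualComplex : (ChainComplex C ℕ)ᵒᵖ ⥤ CochainComplex AddCommGrpCat.{v} ℕ :=
  HomologicalComplex.opFunctor C (ComplexShape.down ℕ) ⋙
    (preadditiveYoneda.obj (𝟙_ C)).mapHomologicalComplex _

/-- A map `δ : H_i(M) ⟶ H_j(K)` is the connecting map for `K ⟶ L ⟶ M` if it sends the class
of `z` to the class of `x` whenever there is `y` in `L_i` with `f x = d y` and `g y = z`. -/
def IsConnectingMap {ι : Type*} {c : ComplexShape ι}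
    {K L M : HomologicalComplex AddCommGrpCat.{v} c} (f : K ⟶ L) (g : L ⟶ M) (i j : ι)
    (δ : M.homology i ⟶ K.homology j) : Prop :=
  ∀ (x : K.cycles j) (y : L.X i) (z : M.cycles i),
    f.f j (K.iCycles j x) = L.d i j y → g.f i y = M.iCycles i z →
      δ (M.homologyπ i z) = K.homologyπ j x

variable [MonoidalPreadditive C] [HasBinaryBiproducts C] [SymmetricCategory C]

/-- Hochschild homology `HH_n(A)`: the homology of `Hom(𝟙, HH(A))`. -/
def HHHomology (A : Alg C) (n : ℕ) : AddCommGrpCat.{v} :=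
  (forgetComplex.obj (hochschild A)).homology n

/-- The map `HH_n(A) ⟶ HH_n(B)` induced by `f : A ⟶ B`. -/
def HHHomologyMap {A B : Alg C} (f : AlgHom A B) (n : ℕ) : HHHomology A n ⟶ HHHomology B n :=
  HomologicalComplex.homologyMap (forgetComplex.map (hochschildMap f)) n

/-- Hochschild cohomology `HH^n(A)`: the cohomology of `Hom(HH(A), 𝟙)`. -/
def HHCohomology (A : Alg C) (n : ℕ) : AddCommGrpCat.{v} :=
  (dualComplex.obj (Opposite.op (hochschild A))).homology n

/-- The map `HH^n(B) ⟶ HH^n(A)` induced by `f : A ⟶ B`. -/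
def HHCohomologyMap {A B : Alg C} (f : AlgHom A B) (n : ℕ) :
    HHCohomology B n ⟶ HHCohomology A n :=
  HomologicalComplex.homologyMap (dualComplex.map (hochschildMap f).op) n

end Homology

/-! ## Conflations of algebras -/

section Conflations

variable {C : Type u} [Category.{v} C] [Preadditive C] [MonoidalCategory C]

/-- A conflation of algebras: algebra homomorphisms `I ⟶ E ⟶ Q` whose underlying maps form a
conflation. -/
structure AlgConflation (ℰ : ExactStructure C) where
  I : Alg C
  E : Alg C
  Q : Alg C
  i : AlgHom I E
  p : AlgHom E Q
  zero : i.hom ≫ p.hom = 0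
  conflation : ℰ.IsConflation (ShortComplex.mk i.hom p.hom zero)

/-- A conflation of algebras is pure if the underlying conflation is pure. -/
def AlgConflation.IsPure [MonoidalPreadditive C] {ℰ : ExactStructure C}
    (S : AlgConflation ℰ) : Prop :=
  ℰ.IsPure (ShortComplex.mk S.i.hom S.p.hom S.zero)

/-- Morphisms of conflations of algebras: commuting diagrams of algebra homomorphisms. -/
structure AlgConflationHom {ℰ : ExactStructure C} (S T : AlgConflation ℰ) where
  onI : AlgHom S.I T.I
  onE : AlgHom S.E T.E
  onQ : AlgHom S.Q T.Q
  comm_i : S.i.hom ≫ onE.hom = onI.hom ≫ T.i.hom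
  comm_p : S.p.hom ≫ onQ.hom = onE.hom ≫ T.p.hom

end Conflations

end HochschildExcision
end

open HochschildExcision

/-!
Why excision holds. The argument takes place entirely in the exact category, which need not be
weakly idempotent complete: the only tool is that, in an extension of complexes, the middle one is
exact if the outer ones are (`ExactBelow.extension`, an iteration of the `3 × 3` lemma). Its
consequences are closure properties of quasi-isomorphisms under composition with degreewise
deflations with exact kernel and degreewise inflations with exact cokernel, applied after
tensoring with an arbitrary object. Complexes are filtered by the range of degrees in which they
are exact, which permits induction on the degree.

Let `I` be the kernel of `E ⟶ Q`, with `I` homologically unital.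

* If `M` is an `E`-bimodule for which `(M ⊗ I^{⊗n}, b')` is pure exact, then `(M ⊗ I^{⊗n}, b) ⟶ (M
  ⊗ E^{⊗n}, b)` is a quasi-isomorphism (`PureQuasiIsoBelow.comp_restrictHom`). Subcomplexes
  interpolate between the two: the one that is `M ⊗ E^{⊗n}` for `n ≤ k` and `M ⊗ I^{⊗(n-k)} ⊗
  E^{⊗k}` for `n ≥ k` has quotient `M ⊗ I^{⊗m} ⊗ Q ⊗ E^{⊗k}` in the next one, with boundary `b' ⊗
  Q ⊗ E^{⊗k}`, since the other terms of `b` land in the smaller subcomplex; so this quotient is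
  exact. The structure `Stage` records what such a subcomplex needs.
* If `M` is a `Q`-bimodule, then `(M ⊗ E^{⊗n}, b) ⟶ (M ⊗ Q^{⊗n}, b)` is a quasi-isomorphism
  (`pureQuasiIsoBelow_restrictHom`). In positive degrees these are the Hochschild complexes with
  coefficients in the bimodules of forms `M ⊗ E` and `M ⊗ Q`. The kernel `M ⊗ I` of the map
  between these has exact Hochschild complex by the first point, because `I` acts by zero on its
  left. So the range of degrees in which the map is known to be a quasi-isomorphism grows by one.

Now replace `HH(I)` by the complex with coefficients in `I` rather than `I⁺`; the quotient is the
shifted bar complex of `I`. Replace `HH(Q)` by the complex of `E` with coefficients in `Q⁺`, using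
the second point. The kernel of `HH(E)` mapping to it is the complex of `E` with coefficients in
`I`, to which the first point applies (`pureQuasiIsoBelow_coneDesc`).

For the long exact sequences, exactness of the total mapping cone `T` passes to `Hom(𝟙, T)` if `𝟙`
is projective and to `Hom(T, 𝟙)` if `𝟙` is injective. The maps `HH(E) ⟶ HH(Q)` are degreewise
composites of deflations, and `HH(I) ⟶ HH(E)` of inflations. Hence `Hom(𝟙, HH(I))` is quasi-
isomorphic to the kernel of `Hom(𝟙, HH(E)) ⟶ Hom(𝟙, HH(Q))`, and dually. This is what
`CofibreSequence` says, stated so that the connecting map and its exactness follow by the usual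
diagram chase.
-/

noncomputable section

namespace HochschildExcision

/-! ### Conflations in an exact category -/

section Conflations

set_option linter.unusedSectionVars false

variable {C : Type u} [Category.{v} C] [Preadditive C]

namespace ExactStructure

/-- The composable maps `i` and `p` form a conflation. -/
def Conflation (ℰ : ExactStructure C) {X Y Z : C} (i : X ⟶ Y) (p : Y ⟶ Z) : Prop :=
  ∃ w : i ≫ p = 0, ℰ.IsConflation (ShortComplex.mk i p w)

variable {ℰ : ExactStructure C}

namespace Conflation

variable {X Y Z : C} {i : X ⟶ Y} {p : Y ⟶ Z}

lemma w (h : ℰ.Conflation i p) : i ≫ p = 0 := h.1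

lemma isDeflation (h : ℰ.Conflation i p) : ℰ.IsDeflation p := ⟨_, _, h.1, h.2⟩

lemma isInflation (h : ℰ.Conflation i p) : ℰ.IsInflation i := ⟨_, _, h.1, h.2⟩

lemma isLimit (h : ℰ.Conflation i p) : Nonempty (IsLimit (KernelFork.ofι i h.w)) :=
  ℰ.isKernel _ h.2

lemma mono (h : ℰ.Conflation i p) : Mono i :=
  ⟨fun _ _ e => Fork.IsLimit.hom_ext h.isLimit.some e⟩

lemma epi (h : ℰ.Conflation i p) : Epi p :=
  ⟨fun _ _ e => Cofork.IsColimit.hom_ext (ℰ.isCokernel _ h.2).some e⟩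

lemma lift (h : ℰ.Conflation i p) {T : C} (x : T ⟶ Y) (hx : x ≫ p = 0) : ∃ l, l ≫ i = x :=
  ⟨_, (KernelFork.IsLimit.lift' h.isLimit.some x hx).2⟩

lemma desc (h : ℰ.Conflation i p) {T : C} (x : Y ⟶ T) (hx : i ≫ x = 0) : ∃ l, p ≫ l = x :=
  ⟨_, (CokernelCofork.IsColimit.desc' (ℰ.isCokernel _ h.2).some x hx).2⟩

lemma of_iso (h : ℰ.Conflation i p) {X' Y' Z' : C} {i' : X' ⟶ Y'} {p' : Y' ⟶ Z'}
    (a : X ≅ X') (b : Y ≅ Y') (c : Z ≅ Z') (h₁ : i ≫ b.hom = a.hom ≫ i')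
    (h₂ : p ≫ c.hom = b.hom ≫ p') : ℰ.Conflation i' p' := by
  have w' : i' ≫ p' = 0 := by
    rw [← cancel_epi a.hom, ← reassoc_of% h₁, ← h₂, reassoc_of% h.w, zero_comp, comp_zero]
  exact ⟨w', ℰ.of_iso _ _ ⟨ShortComplex.isoMk a b c h₁.symm h₂.symm⟩ h.2⟩

end Conflation

/-- `k` is a kernel of `p`. -/
structure IsKer {X Y Z : C} (k : X ⟶ Y) (p : Y ⟶ Z) : Prop where
  w : k ≫ p = 0
  mono : Mono k
  lift : ∀ {T : C} (x : T ⟶ Y), x ≫ p = 0 → ∃ l, l ≫ k = x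

lemma Conflation.isKer {X Y Z : C} {i : X ⟶ Y} {p : Y ⟶ Z} (h : ℰ.Conflation i p) : IsKer i p :=
  ⟨h.w, h.mono, h.lift⟩

lemma IsKer.of_isLimit {X Y Z : C} {i : X ⟶ Y} {p : Y ⟶ Z} {w : i ≫ p = 0}
    (h : IsLimit (KernelFork.ofι i w)) : IsKer i p :=
  ⟨w, ⟨fun _ _ e => Fork.IsLimit.hom_ext h e⟩, fun x hx => ⟨_, (KernelFork.IsLimit.lift' h x hx).2⟩⟩

lemma IsKer.isLimit {X Y Z : C} {i : X ⟶ Y} {p : Y ⟶ Z} (h : IsKer i p) :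
    Nonempty (IsLimit (KernelFork.ofι i h.w)) :=
  have := h.mono
  ⟨KernelFork.IsLimit.ofι' i h.w fun x hx => ⟨(h.lift x hx).choose, (h.lift x hx).choose_spec⟩⟩

lemma IsKer.exists_iso {X X' Y Z : C} {k : X ⟶ Y} {k' : X' ⟶ Y} {p : Y ⟶ Z} (h : IsKer k p)
    (h' : IsKer k' p) : ∃ e : X ≅ X', e.hom ≫ k' = k := by
  obtain ⟨a, ha⟩ := h'.lift k h.w
  obtain ⟨b, hb⟩ := h.lift k' h'.w
  have := h.mono
  have := h'.mono
  exact ⟨⟨a, b, by rw [← cancel_mono k, Category.assoc, hb, ha, Category.id_comp],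
    by rw [← cancel_mono k', Category.assoc, ha, hb, Category.id_comp]⟩, ha⟩

lemma IsKer.conflation {X Y Z : C} {k : X ⟶ Y} {p : Y ⟶ Z} (h : IsKer k p)
    (hp : ℰ.IsDeflation p) : ℰ.Conflation k p := by
  obtain ⟨K, k', w, hc⟩ := hp
  have hc : ℰ.Conflation k' p := ⟨w, hc⟩
  obtain ⟨e, he⟩ := hc.isKer.exists_iso h
  exact hc.of_iso e (Iso.refl _) (Iso.refl _) (by simp [he]) (by simp)

lemma Conflation.of_isPullback {X Y Z W P : C} {k : X ⟶ Y} {p : Y ⟶ Z} (h : ℰ.Conflation k p)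
    {g : W ⟶ Z} {g' : P ⟶ Y} {p' : P ⟶ W} (hP : IsPullback g' p' p g) :
    ∃ k', k' ≫ g' = k ∧ ℰ.Conflation k' p' := by
  obtain ⟨P₁, g₁, p₁, hP₁, hd⟩ := ℰ.pullback_deflation p g h.isDeflation
  obtain ⟨K, k₁, w, hc⟩ := hd
  have hc : ℰ.Conflation k₁ p₁ := ⟨w, hc⟩
  let e : P₁ ≅ P := IsLimit.conePointUniqueUpToIso hP₁.isLimit hP.isLimit
  have hd : ℰ.Conflation (k₁ ≫ e.hom) p' :=
    hc.of_iso (Iso.refl _) e (Iso.refl _) (by simp)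
      ((Category.comp_id _).trans (IsLimit.conePointUniqueUpToIso_hom_comp hP₁.isLimit hP.isLimit
            WalkingCospan.right).symm)
  refine ⟨hP.lift k 0 (by simp [h.w]), by simp, IsKer.conflation ⟨by simp, ?_, ?_⟩
    hd.isDeflation⟩
  · have := h.mono
    have : Mono (hP.lift k 0 (by simp [h.w]) ≫ g') := by simpa
    exact mono_of_mono _ g'
  · intro T x hx
    obtain ⟨l, hl⟩ := h.lift (x ≫ g') (by rw [Category.assoc, hP.w, reassoc_of% hx, zero_comp])
    exact ⟨l, hP.hom_ext (by simp [hl]) (by simp [hx])⟩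

lemma Conflation.of_isPushout {X Y Z W P : C} {i : X ⟶ Y} {p : Y ⟶ Z} (h : ℰ.Conflation i p)
    {g : X ⟶ W} {g' : Y ⟶ P} {i' : W ⟶ P} (hP : IsPushout i g g' i') :
    ∃ p', g' ≫ p' = p ∧ ℰ.Conflation i' p' := by
  obtain ⟨P₁, g₁, i₁, hP₁, hd⟩ := ℰ.pushout_inflation i g h.isInflation
  obtain ⟨K, p₁, w, hc⟩ := hd
  have hc : ℰ.Conflation i₁ p₁ := ⟨w, hc⟩
  let e : P₁ ≅ P := IsColimit.coconePointUniqueUpToIso hP₁.isColimit hP.isColimit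
  have he : i₁ ≫ e.hom = i' := IsColimit.comp_coconePointUniqueUpToIso_hom hP₁.isColimit
    hP.isColimit WalkingSpan.right
  have hd : ℰ.Conflation i' (e.inv ≫ p₁) :=
    hc.of_iso (Iso.refl _) e (Iso.refl _) (by simp [he]) (by simp)
  -- both `Z` and the cokernel of `i'` represent the maps out of `P` that vanish on `W`
  let q := hP.desc p 0 (by simp [h.w])
  have hq : i' ≫ q = 0 := by simp [q]
  obtain ⟨a, ha⟩ := hd.desc q hq
  obtain ⟨b, hb⟩ := h.desc (g' ≫ e.inv ≫ p₁) (by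
    rw [reassoc_of% hP.w, hd.w, comp_zero])
  have := hd.epi
  have := h.epi
  have hgq : g' ≫ q = p := by simp [q]
  have hqb : q ≫ b = e.inv ≫ p₁ := hP.hom_ext (by rw [reassoc_of% hgq, hb])
    (by rw [reassoc_of% hq, hd.w, zero_comp])
  refine ⟨q, hgq, hd.of_iso (Iso.refl _) (Iso.refl _) ⟨a, b, ?_, ?_⟩ (by simp) (by simpa using ha)⟩
  · rw [← cancel_epi (e.inv ≫ p₁), ← Category.assoc, ha, hqb, Category.comp_id]
  · rw [← cancel_epi p, ← Category.assoc, hb, Category.assoc, ha, hgq, Category.comp_id]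

section Basic

variable [HasZeroObject C]

open ZeroObject

/-- `0 ⟶ Y ≅ Z` is a conflation. -/
lemma conflation_zero_iso (ℰ : ExactStructure C) {X Y Z : C} (hX : IsZero X) (p : Y ⟶ Z) [IsIso p]
    (i : X ⟶ Y) : ℰ.Conflation i p := by
  obtain ⟨K, k, w, hc⟩ := ℰ.id_zero 0 (isZero_zero C)
  have hc : ℰ.Conflation k (𝟙 (0 : C)) := ⟨w, hc⟩
  obtain ⟨k', -, hk'⟩ := hc.of_isPullback (g := (0 : Z ⟶ 0)) (g' := 0) (p' := 𝟙 Z)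
    (IsPullback.of_vert_isIso ⟨by simp⟩)
  have hd : ℰ.IsDeflation p := by
    refine (hk'.of_iso (Iso.refl _) (asIso p).symm (Iso.refl _) (i' := k' ≫ inv p) ?_ ?_).isDeflation
    · simp
    · simp
  refine IsKer.conflation ⟨hX.eq_of_src _ _, ⟨fun _ _ _ => hX.eq_of_tgt _ _⟩, fun x hx => ⟨0, ?_⟩⟩ hd
  rw [← cancel_mono p, hx, zero_comp, zero_comp]

/-- `X ≅ Y ⟶ 0` is a conflation. -/
lemma conflation_iso_zero (ℰ : ExactStructure C) {X Y Z : C} (hZ : IsZero Z) (i : X ⟶ Y) [IsIso i]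
    (p : Y ⟶ Z) : ℰ.Conflation i p := by
  have h₀ : ℰ.Conflation (𝟙 (0 : C)) (𝟙 (0 : C)) := conflation_zero_iso ℰ (isZero_zero C) _ _
  obtain ⟨q, -, hq⟩ := h₀.of_isPushout (g := (0 : (0 : C) ⟶ X)) (g' := 0) (i' := 𝟙 X)
    (IsPushout.of_horiz_isIso ⟨by simp⟩)
  exact hq.of_iso (Iso.refl _) (asIso i) ((isZero_zero C).iso hZ) (by simp) (hZ.eq_of_tgt _ _)

lemma isDeflation_of_isIso (ℰ : ExactStructure C) {Y Z : C} (p : Y ⟶ Z) [IsIso p] :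
    ℰ.IsDeflation p :=
  (conflation_zero_iso ℰ (isZero_zero C) p 0).isDeflation

lemma isDeflation_iso_hom (ℰ : ExactStructure C) {Y Z : C} (e : Y ≅ Z) : ℰ.IsDeflation e.hom :=
  isDeflation_of_isIso ℰ e.hom

lemma IsDeflation.comp {X Y Z : C} {p : X ⟶ Y} {q : Y ⟶ Z} (hp : ℰ.IsDeflation p)
    (hq : ℰ.IsDeflation q) : ℰ.IsDeflation (p ≫ q) := ℰ.comp_deflation p q hp hq

lemma IsDeflation.of_isPullback {Y Z W P : C} {p : Y ⟶ Z} (h : ℰ.IsDeflation p)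
    {g : W ⟶ Z} {g' : P ⟶ Y} {p' : P ⟶ W} (hP : IsPullback g' p' p g) : ℰ.IsDeflation p' := by
  obtain ⟨K, k, w, hc⟩ := h
  obtain ⟨k', -, hk'⟩ := Conflation.of_isPullback ⟨w, hc⟩ hP
  exact hk'.isDeflation

variable [HasBinaryBiproducts C]

lemma isDeflation_biprod_snd (ℰ : ExactStructure C) (X Y : C) :
    ℰ.IsDeflation (biprod.snd : X ⊞ Y ⟶ Y) := by
  have h : ℰ.IsDeflation (0 : X ⟶ (0 : C)) :=
    (conflation_iso_zero ℰ (isZero_zero C) (𝟙 X) 0).isDeflation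
  refine h.of_isPullback (g := (0 : Y ⟶ (0 : C))) (g' := biprod.fst) ⟨⟨by simp⟩, ⟨?_⟩⟩
  exact PullbackCone.IsLimit.mk _ (fun s => biprod.lift s.fst s.snd) (by simp) (by simp)
    (fun s m h₁ h₂ => by ext <;> simp [h₁, h₂])

lemma isDeflation_biprod_map {X Y Z : C} {p : Y ⟶ Z} (h : ℰ.IsDeflation p) :
    ℰ.IsDeflation (biprod.map (𝟙 X) p) := by
  refine h.of_isPullback (g := biprod.snd) (g' := biprod.snd) ⟨⟨by simp⟩, ⟨?_⟩⟩
  exact PullbackCone.IsLimit.mk _ (fun s => biprod.lift (s.snd ≫ biprod.fst) s.fst) (by simp)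
    (fun s => by ext <;> simp [s.condition])
    (fun s m h₁ h₂ => by ext <;> simp [← h₁, ← h₂])

/-- If `h` is a deflation, so is `(g, h) : Y ⊞ X ⟶ Z`: up to an automorphism of `Y ⊞ Z` it is
`1 ⊞ h` followed by the projection to `Z`. -/
lemma isDeflation_biprod_desc {X Y Z : C} (g : Y ⟶ Z) {h : X ⟶ Z} (hh : ℰ.IsDeflation h) :
    ℰ.IsDeflation (biprod.desc g h) := by
  let e : Y ⊞ Z ≅ Y ⊞ Z :=
    ⟨biprod.lift biprod.fst (biprod.fst ≫ g + biprod.snd),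
      biprod.lift biprod.fst (-(biprod.fst ≫ g) + biprod.snd), by ext <;> simp, by ext <;> simp⟩
  have : biprod.desc g h = (biprod.map (𝟙 Y) h ≫ e.hom) ≫ biprod.snd := by
    ext <;> simp [e]
  rw [this]
  exact ((isDeflation_biprod_map hh).comp (isDeflation_iso_hom ℰ e)).comp
    (isDeflation_biprod_snd ℰ _ _)

/-- A map with a kernel is a deflation if it becomes one after adding a summand on which
it vanishes. -/
lemma IsKer.conflation_of_biprod_desc {K X Y Z : C} {k : K ⟶ Y} {g : Y ⟶ Z} (hk : IsKer k g)
    (h : ℰ.IsDeflation (biprod.desc g (0 : X ⟶ Z))) : ℰ.Conflation k g := by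
  have hk' : IsKer (biprod.map k (𝟙 X)) (biprod.desc g (0 : X ⟶ Z)) := by
    have := hk.mono
    refine ⟨by ext <;> simp [hk.w], ⟨fun a b hab => ?_⟩, fun x hx => ?_⟩
    · have h₁ := congrArg (· ≫ biprod.fst) hab
      have h₂ := congrArg (· ≫ biprod.snd) hab
      simp only [Category.assoc, biprod.map_fst, biprod.map_snd, Category.comp_id] at h₁ h₂
      ext
      · rw [← cancel_mono k, Category.assoc, Category.assoc, h₁]
      · exact h₂
    · obtain ⟨l, hl⟩ := hk.lift (x ≫ biprod.fst) (by
        rw [← hx, Category.assoc]; congr 1; ext <;> simp)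
      exact ⟨biprod.lift l (x ≫ biprod.snd), by ext <;> simp [hl]⟩
  have hP : IsPushout (biprod.map k (𝟙 X)) biprod.fst biprod.fst k := by
    refine ⟨⟨by simp⟩, ⟨PushoutCocone.IsColimit.mk _ (fun s => biprod.inl ≫ s.inl) ?_ ?_ ?_⟩⟩
    · intro s
      have hs : biprod.inr ≫ s.inl = 0 := by
        have := congrArg (biprod.inr ≫ ·) s.condition
        simpa using this
      ext <;> simp [hs]
    · intro s
      have := congrArg (biprod.inl ≫ ·) s.condition
      simpa using this
    · intro s m h₁ _
      rw [← h₁]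
      simp
  obtain ⟨p', hp', hc⟩ := (hk'.conflation h).of_isPushout hP
  have : p' = g := by simpa using congrArg (biprod.inl ≫ ·) hp'
  rwa [← this]

lemma Conflation.biprod_inl {X Y Z W : C} {i : X ⟶ Y} {p : Y ⟶ Z} (h : ℰ.Conflation i p) :
    ℰ.Conflation (i ≫ biprod.inl) (biprod.map p (𝟙 W)) := by
  have hd : ℰ.IsDeflation (biprod.map p (𝟙 W)) := by
    have : biprod.map p (𝟙 W) = ((biprod.braiding Y W).hom ≫ biprod.map (𝟙 W) p) ≫
      (biprod.braiding W Z).hom := by ext <;> simp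
    rw [this]
    exact ((isDeflation_of_isIso ℰ _).comp (isDeflation_biprod_map h.isDeflation)).comp
      (isDeflation_of_isIso ℰ _)
  have := h.mono
  refine IsKer.conflation ⟨by simp [reassoc_of% h.w], mono_comp _ _, fun x hx => ?_⟩ hd
  obtain ⟨l, hl⟩ := h.lift (x ≫ biprod.fst) (by simpa using congrArg (· ≫ biprod.fst) hx)
  have h₂ := congrArg (· ≫ biprod.snd) hx
  simp only [Category.assoc, biprod.map_snd, Category.comp_id, zero_comp] at h₂
  exact ⟨l, by ext <;> simp [hl, h₂]⟩

lemma Conflation.biprod_map_id {X Y Z W : C} {i : X ⟶ Y} {p : Y ⟶ Z} (h : ℰ.Conflation i p) :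
    ℰ.Conflation (biprod.map (𝟙 W) i) (biprod.snd ≫ p) := by
  have := h.mono
  refine IsKer.conflation ⟨by simp [h.w], ⟨fun a b hab => ?_⟩, fun x hx => ?_⟩
    ((isDeflation_biprod_snd ℰ _ _).comp h.isDeflation)
  · have h₁ := congrArg (· ≫ biprod.fst) hab
    have h₂ := congrArg (· ≫ biprod.snd) hab
    simp only [Category.assoc, biprod.map_fst, biprod.map_snd, Category.comp_id] at h₁ h₂
    ext
    · exact h₁
    · rw [← cancel_mono i, Category.assoc, Category.assoc, h₂]
  · obtain ⟨l, hl⟩ := h.lift (x ≫ biprod.snd) (by simpa using hx)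
    exact ⟨biprod.lift (x ≫ biprod.fst) l, by ext <;> simp [hl]⟩

lemma Conflation.biprod_id_map {X Y Z W : C} {i : X ⟶ Y} {p : Y ⟶ Z} (h : ℰ.Conflation i p) :
    ℰ.Conflation (biprod.map i (𝟙 W)) (biprod.fst ≫ p) :=
  (h.biprod_map_id (W := W)).of_iso (biprod.braiding _ _) (biprod.braiding _ _) (Iso.refl _)
    (by ext <;> simp) (by simp)

/-- Given a map of conflations whose outer components are deflations with kernels `kK` and `kM`,
the middle component is a deflation, and the kernels form a conflation. -/
lemma Conflation.three_by_three {K₁ L₁ M₁ K₀ L₀ M₀ KK KM : C}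
    {i₁ : K₁ ⟶ L₁} {p₁ : L₁ ⟶ M₁} {i₀ : K₀ ⟶ L₀} {p₀ : L₀ ⟶ M₀}
    {a : K₁ ⟶ K₀} {b : L₁ ⟶ L₀} {c : M₁ ⟶ M₀} {kK : KK ⟶ K₁} {kM : KM ⟶ M₁}
    (h₁ : ℰ.Conflation i₁ p₁) (h₀ : ℰ.Conflation i₀ p₀)
    (hab : a ≫ i₀ = i₁ ≫ b) (hbc : b ≫ p₀ = p₁ ≫ c)
    (hK : ℰ.Conflation kK a) (hM : ℰ.Conflation kM c) :
    ∃ (KL : C) (kL : KL ⟶ L₁) (i' : KK ⟶ KL) (p' : KL ⟶ KM),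
      ℰ.Conflation kL b ∧ ℰ.Conflation i' p' ∧ i' ≫ kL = kK ≫ i₁ ∧ p' ≫ kM = kL ≫ p₁ := by
  have := h₁.mono
  have := hK.mono
  have := hM.mono
  -- `L` is the pull-back of `L₀` along `c`, an extension of `M₁` by `K₀`
  obtain ⟨L, c', q, hL, hq⟩ := ℰ.pullback_deflation p₀ c h₀.isDeflation
  have hc' : ∃ m, m ≫ q = kM ∧ ℰ.Conflation m c' := hM.of_isPullback hL.flip
  obtain ⟨m, hmq, hm⟩ := hc'
  obtain ⟨j, hj, hjq⟩ := h₀.of_isPullback hL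
  obtain ⟨u, hu⟩ : ∃ u : L₁ ⟶ L, u ≫ c' = b ∧ u ≫ q = p₁ :=
    ⟨hL.lift b p₁ hbc, by simp, by simp⟩
  have hiu : i₁ ≫ u = a ≫ j := hL.hom_ext
    (by rw [Category.assoc, hu.1, Category.assoc, hj, hab])
    (by rw [Category.assoc, hu.2, Category.assoc, hjq.w, h₁.w, comp_zero])
  -- `L₁ ⊞ K₀ ⟶ L` is a deflation because it is a pull-back of `p₁ : L₁ ⟶ M₁`
  have hd₁ : ℰ.IsDeflation (biprod.desc u j) := by
    refine h₁.isDeflation.of_isPullback (g := q) (g' := biprod.fst)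
      ⟨⟨by ext <;> simp [hu.2, hjq.w]⟩, ⟨?_⟩⟩
    have hs : ∀ s : PullbackCone p₁ q, ∃ l, l ≫ j = s.snd - s.fst ≫ u := fun s =>
      hjq.lift _ (by simp [hu.2, s.condition])
    choose l hl using hs
    refine PullbackCone.IsLimit.mk _ (fun s => biprod.lift s.fst (l s)) (by simp)
      (fun s => by simp [hl, biprod.lift_desc]) (fun s m h₁ h₂ => ?_)
    have := hjq.mono
    ext
    · simp [h₁]
    · rw [← cancel_mono j, biprod.lift_snd, hl, ← h₂, ← h₁]
      have : biprod.desc u j = biprod.fst ≫ u + biprod.snd ≫ j := by ext <;> simp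
      rw [this]
      simp
  have hd₂ : ℰ.IsDeflation (biprod.desc u (a ≫ j)) := by
    have : biprod.desc u (a ≫ j) = biprod.map (𝟙 _) a ≫ biprod.desc u j := by ext <;> simp
    rw [this]
    exact (isDeflation_biprod_map hK.isDeflation).comp hd₁
  have hd₃ : ℰ.IsDeflation (biprod.desc u (0 : K₁ ⟶ L)) := by
    let e : L₁ ⊞ K₁ ≅ L₁ ⊞ K₁ :=
      ⟨biprod.lift (biprod.fst - biprod.snd ≫ i₁) biprod.snd,
        biprod.lift (biprod.fst + biprod.snd ≫ i₁) biprod.snd, by ext <;> simp, by ext <;> simp⟩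
    have : biprod.desc u (0 : K₁ ⟶ L) = e.hom ≫ biprod.desc u (a ≫ j) := by
      rw [← hiu]
      ext <;> simp [e, biprod.lift_desc]
    rw [this]
    exact (isDeflation_iso_hom ℰ e).comp hd₂
  have hku : IsKer (kK ≫ i₁) u := by
    refine ⟨by rw [Category.assoc, hiu, reassoc_of% hK.w, zero_comp], mono_comp _ _,
      fun x hx => ?_⟩
    obtain ⟨y, rfl⟩ := h₁.lift x (by rw [← hu.2, reassoc_of% hx, zero_comp])
    have := hjq.mono
    obtain ⟨z, rfl⟩ := hK.lift y (by
      rw [← cancel_mono j, Category.assoc, ← hiu, ← Category.assoc, hx, zero_comp])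
    exact ⟨z, by simp⟩
  have hcu := hku.conflation_of_biprod_desc hd₃
  -- the kernel of `b` is the preimage under `u` of the kernel of `c'`
  obtain ⟨KL, kL, p', hPB, -⟩ := ℰ.pullback_deflation u m hcu.isDeflation
  obtain ⟨i', hi', hc⟩ := hcu.of_isPullback hPB
  have := hm.mono
  refine ⟨KL, kL, i', p', IsKer.conflation ⟨?_, ⟨fun x y hxy => ?_⟩, fun x hx => ?_⟩ ?_, hc, hi',
    ?_⟩
  · rw [← hu.1, reassoc_of% hPB.w, hm.w, comp_zero]
  · refine hPB.hom_ext hxy ?_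
    rw [← cancel_mono m, Category.assoc, Category.assoc, ← hPB.w, reassoc_of% hxy]
  · obtain ⟨y, hy⟩ := hm.lift (x ≫ u) (by rw [Category.assoc, hu.1, hx])
    exact ⟨hPB.lift x y hy.symm, by simp⟩
  · rw [← hu.1]
    exact hcu.isDeflation.comp hm.isDeflation
  · rw [← hmq, ← reassoc_of% hPB.w, hu.2]

end Basic

end ExactStructure

end Conflations

/-! ### Chain complexes and resolutions in an exact category -/

section Complexes

set_option linter.unusedSectionVars false

variable (C : Type u) [Category.{v} C] [Preadditive C]

/-- A chain complex indexed by the natural numbers, given by its objects and the differentials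
between neighbouring objects only. Compared with `ChainComplex C ℕ`, the differentials of
complexes that are defined by recursion on the degree hold by definition. -/
structure Cplx where
  X : ℕ → C
  d : ∀ n, X (n + 1) ⟶ X n
  d_comp_d : ∀ n, d (n + 1) ≫ d n = 0

variable {C}

namespace Cplx

lemma d_comp_d_assoc (K : Cplx C) (n : ℕ) {Z : C} (h : K.X n ⟶ Z) :
    K.d (n + 1) ≫ K.d n ≫ h = 0 := by
  rw [← Category.assoc, K.d_comp_d, zero_comp]

/-- Chain maps. -/
@[ext]
structure Hom (K L : Cplx C) where
  f : ∀ n, K.X n ⟶ L.X n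
  comm : ∀ n, f (n + 1) ≫ L.d n = K.d n ≫ f n

lemma Hom.comm_assoc {K L : Cplx C} (f : Hom K L) (n : ℕ) {Z : C} (h : L.X n ⟶ Z) :
    f.f (n + 1) ≫ L.d n ≫ h = K.d n ≫ f.f n ≫ h := by
  rw [← Category.assoc, f.comm, Category.assoc]

/-- The composite of two chain maps. -/
def Hom.comp {K L M : Cplx C} (f : Hom K L) (g : Hom L M) : Hom K M where
  f n := f.f n ≫ g.f n
  comm n := by rw [Category.assoc, g.comm, f.comm_assoc]

/-- The identity chain map. -/
def Hom.id (K : Cplx C) : Hom K K where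
  f n := 𝟙 _
  comm n := by simp

/-- Remove the object in degree `0`. -/
def tail (K : Cplx C) : Cplx C where
  X n := K.X (n + 1)
  d n := K.d (n + 1)
  d_comp_d n := K.d_comp_d (n + 1)

/-- The restriction of a chain map to the positive degrees. -/
def Hom.tail {K L : Cplx C} (f : Hom K L) : Hom K.tail L.tail where
  f n := f.f (n + 1)
  comm n := f.comm (n + 1)

/-- The complex with the opposite differential. -/
def neg (K : Cplx C) : Cplx C where
  X := K.X
  d n := -K.d n
  d_comp_d n := by simp [K.d_comp_d]

/-- The isomorphism `(-1)^n` between a complex and the one with opposite differential. -/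
def toNeg (K : Cplx C) : Hom K K.neg where
  f n := (-1 : ℤ) ^ n • 𝟙 _
  comm n := by simp [neg, pow_succ]

lemma isIso_toNeg (K : Cplx C) (n : ℕ) : IsIso (K.toNeg.f n) := by
  have h : ((-1 : ℤ) ^ n • 𝟙 (K.X n)) ≫ ((-1 : ℤ) ^ n • 𝟙 (K.X n)) = 𝟙 (K.X n) := by
    rw [Preadditive.zsmul_comp, Preadditive.comp_zsmul, smul_smul, ← mul_pow]
    simp
  exact ⟨(-1 : ℤ) ^ n • 𝟙 (K.X n), h, h⟩

/-- The objects of the complex `Y ← X₀ ← X₁ ← ⋯`. -/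
def consX (Y : C) (X : ℕ → C) : ℕ → C
  | 0 => Y
  | n + 1 => X n

/-- The differential of the complex `Y ← X₀ ← X₁ ← ⋯`. -/
def consD (Y : C) (K : Cplx C) (e : K.X 0 ⟶ Y) : ∀ n, consX Y K.X (n + 1) ⟶ consX Y K.X n
  | 0 => e
  | n + 1 => K.d n

/-- The complex `Y ← X₀ ← X₁ ← ⋯`. -/
def cons (Y : C) (K : Cplx C) (e : K.X 0 ⟶ Y) (h : K.d 0 ≫ e = 0) : Cplx C where
  X := consX Y K.X
  d := consD Y K e
  d_comp_d
    | 0 => h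
    | n + 1 => K.d_comp_d n

/-- The complex associated to an object of `ChainComplex C ℕ`. -/
def ofChain (K : ChainComplex C ℕ) : Cplx C where
  X := K.X
  d n := K.d (n + 1) n
  d_comp_d _ := K.d_comp_d _ _ _

/-- The chain map associated to a morphism of `ChainComplex C ℕ`. -/
def ofChainMap {K L : ChainComplex C ℕ} (f : K ⟶ L) : Hom (ofChain K) (ofChain L) where
  f n := f.f n
  comm _ := f.comm _ _

section Cone

variable [HasBinaryBiproducts C] {K L : Cplx C}

/-- The objects of the mapping cone. -/
def coneX (K L : ℕ → C) : ℕ → C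
  | 0 => L 0
  | n + 1 => K n ⊞ L (n + 1)

/-- The differential of the mapping cone. -/
def coneD (f : Hom K L) : ∀ n, coneX K.X L.X (n + 1) ⟶ coneX K.X L.X n
  | 0 => biprod.desc (f.f 0) (L.d 0)
  | n + 1 => biprod.lift (-(biprod.fst ≫ K.d n)) (biprod.desc (f.f (n + 1)) (L.d (n + 1)))

/-- The mapping cone of a chain map, with the differential `(x, y) ↦ (-d x, f x + d y)`. -/
def cone (f : Hom K L) : Cplx C where
  X := coneX K.X L.X
  d := coneD f
  d_comp_d
    | 0 => by
      change biprod.lift (-(biprod.fst ≫ K.d 0)) (biprod.desc (f.f 1) (L.d 1)) ≫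
        biprod.desc (f.f 0) (L.d 0) = 0
      ext <;> simp [biprod.lift_desc, f.comm, L.d_comp_d]
    | n + 1 => by
      change biprod.lift (-(biprod.fst ≫ K.d (n + 1))) (biprod.desc (f.f (n + 2)) (L.d (n + 2))) ≫
        biprod.lift (-(biprod.fst ≫ K.d n)) (biprod.desc (f.f (n + 1)) (L.d (n + 1))) = 0
      ext <;> simp [biprod.lift_desc, f.comm, L.d_comp_d, K.d_comp_d]

/-- The map of mapping cones induced by a commuting square. -/
def coneMapF {K' L' : Cplx C} (a : Hom K K') (b : Hom L L') :
    ∀ n, coneX K.X L.X n ⟶ coneX K'.X L'.X n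
  | 0 => b.f 0
  | n + 1 => biprod.map (a.f n) (b.f (n + 1))

/-- The map of mapping cones induced by a commuting square. -/
def coneMap {K' L' : Cplx C} (f : Hom K L) (f' : Hom K' L') (a : Hom K K') (b : Hom L L')
    (h : ∀ n, a.f n ≫ f'.f n = f.f n ≫ b.f n) : Hom (cone f) (cone f') where
  f := coneMapF a b
  comm
    | 0 => by
      change biprod.map (a.f 0) (b.f 1) ≫ biprod.desc (f'.f 0) (L'.d 0) =
        biprod.desc (f.f 0) (L.d 0) ≫ b.f 0
      ext <;> simp [h, b.comm]
    | n + 1 => by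
      change biprod.map (a.f (n + 1)) (b.f (n + 2)) ≫
          biprod.lift (-(biprod.fst ≫ K'.d n)) (biprod.desc (f'.f (n + 1)) (L'.d (n + 1))) =
        biprod.lift (-(biprod.fst ≫ K.d n)) (biprod.desc (f.f (n + 1)) (L.d (n + 1))) ≫
          biprod.map (a.f n) (b.f (n + 1))
      ext <;> simp [h, a.comm, b.comm]

lemma isIso_coneMapF {K' L' : Cplx C} (a : Hom K K') (b : Hom L L') {n : ℕ}
    (ha : ∀ m, m < n → IsIso (a.f m)) (hb : IsIso (b.f n)) : IsIso (coneMapF a b n) := by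
  cases n with
  | zero => exact hb
  | succ n =>
    have := ha n (Nat.lt_succ_self n)
    exact inferInstanceAs (IsIso (biprod.mapIso (asIso (a.f n)) (asIso (b.f (n + 1)))).hom)

end Cone

end Cplx

namespace ExactStructure

open Cplx

variable (ℰ : ExactStructure C)

/-- The map `e : X₀ ⟶ Z` extends to a resolution `⋯ ⟶ X₁ ⟶ X₀ ⟶ Z` in degrees less than `N`:
`e` is a deflation with a kernel `K`, and the map `X₁ ⟶ K` induced by the differential is the
start of a resolution in degrees less than `N - 1`. -/
def Resolves : ℕ → ∀ (X : Cplx C) {Z : C}, (X.X 0 ⟶ Z) → Prop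
  | 0, _, _, _ => True
  | N + 1, X, _, e => ∃ (K : C) (k : K ⟶ X.X 0) (e' : X.X 1 ⟶ K),
      ℰ.Conflation k e ∧ e' ≫ k = X.d 0 ∧ Resolves N X.tail e'

/-- The complex `X` is exact in degrees less than `N`. -/
def ExactBelow (N : ℕ) (X : Cplx C) : Prop := ℰ.Resolves N X.tail (X.d 0)

/-- The mapping cone of `f` is exact in degrees less than `N`. -/
def QuasiIsoBelow [HasBinaryBiproducts C] (N : ℕ) {X Y : Cplx C} (f : Hom X Y) : Prop :=
  ℰ.ExactBelow N (cone f)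

variable {ℰ}

lemma Resolves.mono {N : ℕ} : ∀ {M : ℕ} (_ : N ≤ M) {X : Cplx C} {Z : C} {e : X.X 0 ⟶ Z},
    ℰ.Resolves M X e → ℰ.Resolves N X e := by
  induction N with
  | zero => intros; trivial
  | succ N ih =>
    intro M hM X Z e h
    obtain ⟨M, rfl⟩ : ∃ k, M = k + 1 := ⟨M - 1, by omega⟩
    obtain ⟨K, k, e', h₁, h₂, h₃⟩ := h
    exact ⟨K, k, e', h₁, h₂, ih (by omega) h₃⟩

lemma ExactBelow.mono {N M : ℕ} (h : N ≤ M) {X : Cplx C} (hX : ℰ.ExactBelow M X) :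
    ℰ.ExactBelow N X := Resolves.mono h hX

lemma Resolves.of_iso {N : ℕ} : ∀ {X Y : Cplx C} (φ : Hom X Y) (_ : ∀ n, n < N → IsIso (φ.f n))
    {Z Z' : C} (z : Z ≅ Z') {e : X.X 0 ⟶ Z} {e' : Y.X 0 ⟶ Z'} (_ : e ≫ z.hom = φ.f 0 ≫ e')
    (_ : Y.d 0 ≫ e' = 0), ℰ.Resolves N X e → ℰ.Resolves N Y e' := by
  induction N with
  | zero => intros; trivial
  | succ N ih =>
    intro X Y φ hφ Z Z' z e e' hz he' h
    obtain ⟨K, k, e₁, h₁, h₂, h₃⟩ := h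
    have := hφ 0 (by omega)
    have hc : ℰ.Conflation (k ≫ φ.f 0) e' :=
      h₁.of_iso (Iso.refl _) (asIso (φ.f 0)) z (by simp) (by simpa using hz)
    obtain ⟨e₂, he₂⟩ := hc.lift _ he'
    have := hc.mono
    have c₁ : e₁ ≫ 𝟙 K = φ.f 1 ≫ e₂ := by
      rw [← cancel_mono (k ≫ φ.f 0), Category.comp_id, reassoc_of% h₂, Category.assoc, he₂, φ.comm]
    have c₂ : Y.d 1 ≫ e₂ = 0 := by
      rw [← cancel_mono (k ≫ φ.f 0), Category.assoc, he₂, zero_comp, Y.d_comp_d]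
    exact ⟨K, k ≫ φ.f 0, e₂, hc, he₂, ih φ.tail (fun n hn => hφ _ (by omega)) (Iso.refl K)
      c₁ c₂ h₃⟩

lemma ExactBelow.of_iso_le {N : ℕ} {X Y : Cplx C} (φ : Hom X Y)
    (hφ : ∀ n, n ≤ N → IsIso (φ.f n)) (h : ℰ.ExactBelow N X) : ℰ.ExactBelow N Y := by
  have := hφ 0 (by omega)
  exact Resolves.of_iso φ.tail (fun n hn => hφ _ (by omega)) (asIso (φ.f 0)) (φ.comm 0).symm
    (Y.d_comp_d 0) h

lemma ExactBelow.of_iso {N : ℕ} {X Y : Cplx C} (φ : Hom X Y)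
    (hφ : ∀ n, IsIso (φ.f n)) (h : ℰ.ExactBelow N X) : ℰ.ExactBelow N Y :=
  h.of_iso_le φ fun n _ => hφ n

lemma ExactBelow.neg {N : ℕ} {X : Cplx C} (h : ℰ.ExactBelow N X) : ℰ.ExactBelow N X.neg :=
  h.of_iso X.toNeg X.isIso_toNeg

variable [HasZeroObject C] [HasBinaryBiproducts C]

/-- An extension of two resolutions is a resolution. -/
lemma Resolves.extension {N : ℕ} : ∀ {K L M : Cplx C} (f : Hom K L) (g : Hom L M)
    (_ : ∀ n, ℰ.Conflation (f.f n) (g.f n)) {ZK ZL ZM : C} {i : ZK ⟶ ZL} {p : ZL ⟶ ZM}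
    (_ : ℰ.Conflation i p) {eK : K.X 0 ⟶ ZK} {eL : L.X 0 ⟶ ZL} {eM : M.X 0 ⟶ ZM}
    (_ : eK ≫ i = f.f 0 ≫ eL) (_ : eL ≫ p = g.f 0 ≫ eM) (_ : L.d 0 ≫ eL = 0),
    ℰ.Resolves N K eK → ℰ.Resolves N M eM → ℰ.Resolves N L eL := by
  induction N with
  | zero => intros; trivial
  | succ N ih =>
    intro K L M f g hfg ZK ZL ZM i p hip eK eL eM hi hp hL hK hM
    obtain ⟨KK, kK, eK', h₁, h₂, h₃⟩ := hK
    obtain ⟨KM, kM, eM', h₁', h₂', h₃'⟩ := hM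
    obtain ⟨KL, kL, i', p', hkL, hip', hi', hp'⟩ :=
      Conflation.three_by_three (hfg 0) hip hi hp h₁ h₁'
    obtain ⟨eL', heL'⟩ := hkL.lift _ hL
    have := hkL.mono
    have := h₁'.mono
    have c₁ : eK' ≫ i' = f.f 1 ≫ eL' := by
      rw [← cancel_mono kL, Category.assoc, hi', reassoc_of% h₂, Category.assoc, heL', f.comm]
    have c₂ : eL' ≫ p' = g.f 1 ≫ eM' := by
      rw [← cancel_mono kM, Category.assoc, hp', reassoc_of% heL', Category.assoc, h₂', g.comm]
    have c₃ : L.d 1 ≫ eL' = 0 := by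
      rw [← cancel_mono kL, Category.assoc, heL', zero_comp, L.d_comp_d]
    exact ⟨KL, kL, eL', hkL, heL', ih f.tail g.tail (fun n => hfg (n + 1)) hip' c₁ c₂ c₃ h₃ h₃'⟩

/-- An extension of two exact complexes is exact. -/
lemma ExactBelow.extension {N : ℕ} {K L M : Cplx C} (f : Hom K L) (g : Hom L M)
    (h : ∀ n, ℰ.Conflation (f.f n) (g.f n)) (hK : ℰ.ExactBelow N K) (hM : ℰ.ExactBelow N M) :
    ℰ.ExactBelow N L :=
  Resolves.extension f.tail g.tail (fun n => h (n + 1)) (h 0) (f.comm 0).symm (g.comm 0).symm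
    (L.d_comp_d 0) hK hM

lemma ExactBelow.cons {N : ℕ} {Y : C} (hY : IsZero Y) {K : Cplx C} (e : K.X 0 ⟶ Y)
    (h : K.d 0 ≫ e = 0) (hK : ℰ.ExactBelow N K) : ℰ.ExactBelow (N + 1) (Cplx.cons Y K e h) :=
  ⟨K.X 0, 𝟙 _, K.d 0, conflation_iso_zero ℰ hY (𝟙 (K.X 0)) e, Category.comp_id _, hK⟩

lemma ExactBelow.cons' {N : ℕ} {Y : C} (hY : IsZero Y) {K : Cplx C} (e : K.X 0 ⟶ Y)
    (h : K.d 0 ≫ e = 0) (hK : ℰ.ExactBelow N K) : ℰ.ExactBelow N (Cplx.cons Y K e h) :=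
  (hK.cons hY e h).mono (Nat.le_succ N)

open ZeroObject

/-- If `f` is a degreewise deflation with exact kernel `G` and `g` is a quasi-isomorphism, then
so is `g ∘ f`. -/
lemma QuasiIsoBelow.deflation_comp {N : ℕ} {G X Y W : Cplx C} (ι : Hom G X) (f : Hom X Y)
    (g : Hom Y W) (h : ∀ n, ℰ.Conflation (ι.f n) (f.f n)) (hG : ℰ.ExactBelow N G)
    (hg : ℰ.QuasiIsoBelow N g) : ℰ.QuasiIsoBelow N (f.comp g) := by
  let a : Hom (Cplx.cons (0 : C) G.neg 0 (by simp)) (cone (f.comp g)) :=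
    { f := fun n => match n with
        | 0 => 0
        | n + 1 => ι.f n ≫ biprod.inl
      comm := fun n => match n with
        | 0 => by
          change (ι.f 0 ≫ biprod.inl) ≫ biprod.desc (f.f 0 ≫ g.f 0) (W.d 0) = 0 ≫ 0
          simp [reassoc_of% (h 0).w]
        | n + 1 => by
          change (ι.f (n + 1) ≫ biprod.inl) ≫ biprod.lift (-(biprod.fst ≫ X.d n))
            (biprod.desc (f.f (n + 1) ≫ g.f (n + 1)) (W.d (n + 1))) =
              (-G.d n) ≫ ι.f n ≫ biprod.inl
          ext <;> simp [reassoc_of% (h (n + 1)).w, ι.comm] }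
  let b : Hom (cone (f.comp g)) (cone g) :=
    coneMap (f.comp g) g f (Hom.id W) (fun n => by simp [Hom.comp, Hom.id])
  refine ExactBelow.extension a b (fun n => ?_) (hG.neg.cons' (isZero_zero C) _ _) hg
  cases n with
  | zero => exact conflation_zero_iso ℰ (isZero_zero C) (𝟙 (W.X 0)) _
  | succ n => exact (h n).biprod_inl

/-- If `f` is a quasi-isomorphism and `g` is a degreewise inflation with exact cokernel `H`, then
`g ∘ f` is a quasi-isomorphism. -/
lemma QuasiIsoBelow.comp_inflation {N : ℕ} {X Y W H : Cplx C} (f : Hom X Y) (g : Hom Y W)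
    (q : Hom W H) (h : ∀ n, ℰ.Conflation (g.f n) (q.f n)) (hH : ℰ.ExactBelow N H)
    (hf : ℰ.QuasiIsoBelow N f) : ℰ.QuasiIsoBelow N (f.comp g) := by
  let a : Hom (cone f) (cone (f.comp g)) :=
    coneMap f (f.comp g) (Hom.id X) g (fun n => by simp [Hom.comp, Hom.id])
  let b : Hom (cone (f.comp g)) H :=
    { f := fun n => match n with
        | 0 => q.f 0
        | n + 1 => biprod.snd ≫ q.f (n + 1)
      comm := fun n => match n with
        | 0 => by
          change (biprod.snd ≫ q.f 1) ≫ H.d 0 = biprod.desc (f.f 0 ≫ g.f 0) (W.d 0) ≫ q.f 0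
          ext <;> simp [(h 0).w, q.comm]
        | n + 1 => by
          change (biprod.snd ≫ q.f (n + 2)) ≫ H.d (n + 1) = biprod.lift (-(biprod.fst ≫ X.d n))
            (biprod.desc (f.f (n + 1) ≫ g.f (n + 1)) (W.d (n + 1))) ≫ biprod.snd ≫ q.f (n + 1)
          ext <;> simp [(h (n + 1)).w, q.comm] }
  refine ExactBelow.extension a b (fun n => ?_) hf hH
  cases n with
  | zero => exact h 0
  | succ n => exact (h (n + 1)).biprod_map_id

/-- If `f` is a degreewise inflation with exact cokernel `H` and `g ∘ f` is a quasi-isomorphism,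
then so is `g`. -/
lemma QuasiIsoBelow.of_inflation_comp {N : ℕ} {X Y W H : Cplx C} (f : Hom X Y) (g : Hom Y W)
    (q : Hom Y H) (h : ∀ n, ℰ.Conflation (f.f n) (q.f n)) (hH : ℰ.ExactBelow N H)
    (hf : ℰ.QuasiIsoBelow N (f.comp g)) : ℰ.QuasiIsoBelow N g := by
  let a : Hom (cone (f.comp g)) (cone g) :=
    coneMap (f.comp g) g f (Hom.id W) (fun n => by simp [Hom.comp, Hom.id])
  let b : Hom (cone g) (Cplx.cons (0 : C) H.neg 0 (by simp)) :=
    { f := fun n => match n with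
        | 0 => 0
        | n + 1 => biprod.fst ≫ q.f n
      comm := fun n => match n with
        | 0 => by
          change (biprod.fst ≫ q.f 0) ≫ 0 = biprod.desc (g.f 0) (W.d 0) ≫ 0
          simp
        | n + 1 => by
          change (biprod.fst ≫ q.f (n + 1)) ≫ (-H.d n) = biprod.lift (-(biprod.fst ≫ Y.d n))
            (biprod.desc (g.f (n + 1)) (W.d (n + 1))) ≫ biprod.fst ≫ q.f n
          ext <;> simp [q.comm] }
  refine ExactBelow.extension a b (fun n => ?_) hf (hH.neg.cons' (isZero_zero C) _ _)
  cases n with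
  | zero => exact conflation_iso_zero ℰ (isZero_zero C) (𝟙 (W.X 0)) _
  | succ n => exact (h n).biprod_id_map

/-- A chain map is a quasi-isomorphism if it is an isomorphism in degree `0` and a
quasi-isomorphism between the truncations to positive degrees. -/
lemma QuasiIsoBelow.of_tail {N : ℕ} {X Y : Cplx C} (f : Hom X Y) (h₀ : IsIso (f.f 0))
    (h : ℰ.QuasiIsoBelow N f.tail) : ℰ.QuasiIsoBelow (N + 1) f := by
  have hd : ℰ.IsDeflation (biprod.desc (f.f 0) (Y.d 0)) := by
    have : biprod.desc (f.f 0) (Y.d 0) =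
        (biprod.braiding _ _).hom ≫ biprod.desc (Y.d 0) (f.f 0) := by ext <;> simp
    rw [this]
    exact (isDeflation_of_isIso ℰ _).comp
      (isDeflation_biprod_desc _ (isDeflation_of_isIso ℰ _))
  have hk : IsKer (biprod.lift (-(Y.d 0 ≫ inv (f.f 0))) (𝟙 (Y.X 1)))
      (biprod.desc (f.f 0) (Y.d 0)) := by
    refine ⟨by simp [biprod.lift_desc], ⟨fun a b hab => ?_⟩, fun x hx => ⟨x ≫ biprod.snd, ?_⟩⟩
    · simpa using congrArg (· ≫ biprod.snd) hab
    · have : x ≫ biprod.fst ≫ f.f 0 + x ≫ biprod.snd ≫ Y.d 0 = 0 := by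
        rw [← hx, ← Preadditive.comp_add]
        congr 1
        ext <;> simp
      rw [add_eq_zero_iff_eq_neg] at this
      ext
      · simp only [Category.assoc, biprod.lift_fst, Preadditive.comp_neg]
        rw [← cancel_mono (f.f 0)]
        simp [this]
      · simp
  refine ⟨Y.X 1, _, biprod.desc (f.f 1) (Y.d 1), hk.conflation hd, ?_, h⟩
  change biprod.desc (f.f 1) (Y.d 1) ≫ _ =
    biprod.lift (-(biprod.fst ≫ X.d 0)) (biprod.desc (f.f 1) (Y.d 1))
  ext <;> simp [Y.d_comp_d_assoc, f.comm_assoc]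

lemma QuasiIsoBelow.of_isIso (N : ℕ) {X Y : Cplx C} (f : Hom X Y) (h : ∀ n, IsIso (f.f n)) :
    ℰ.QuasiIsoBelow N f := by
  induction N generalizing X Y with
  | zero => trivial
  | succ N ih => exact of_tail f (h 0) (ih f.tail fun n => h (n + 1))

lemma QuasiIsoBelow.of_iso {N : ℕ} {X Y X' Y' : Cplx C} {f : Hom X Y} {f' : Hom X' Y'}
    (a : Hom X X') (b : Hom Y Y') (ha : ∀ n, IsIso (a.f n)) (hb : ∀ n, IsIso (b.f n))
    (h : ∀ n, a.f n ≫ f'.f n = f.f n ≫ b.f n) (hf : ℰ.QuasiIsoBelow N f) :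
    ℰ.QuasiIsoBelow N f' :=
  ExactBelow.of_iso (coneMap f f' a b h) (fun n => isIso_coneMapF a b (fun m _ => ha m) (hb n)) hf

/-- The zero complex. -/
def _root_.HochschildExcision.Cplx.zero (C : Type u) [Category.{v} C] [Preadditive C]
    [HasZeroObject C] : Cplx C where
  X _ := 0
  d _ := 0
  d_comp_d _ := by simp

/-- The zero map from the zero complex. -/
def _root_.HochschildExcision.Cplx.zeroHom (Y : Cplx C) : Hom (Cplx.zero C) Y where
  f _ := 0
  comm _ := by simp

lemma quasiIsoBelow_zeroHom_iff {N : ℕ} {Y : Cplx C} :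
    ℰ.QuasiIsoBelow N (zeroHom Y) ↔ ℰ.ExactBelow N Y := by
  have hz : ∀ n, IsIso (match n with | 0 => 𝟙 _ | n + 1 => biprod.snd :
      (cone (zeroHom Y)).X n ⟶ Y.X n) := by
    intro n
    cases n with
    | zero => exact inferInstanceAs (IsIso (𝟙 _))
    | succ n =>
      have h : (biprod.snd : (0 : C) ⊞ Y.X (n + 1) ⟶ _) ≫ biprod.inr = 𝟙 _ := by
        ext <;> first | exact (isZero_zero C).eq_of_src _ _ | exact (isZero_zero C).eq_of_tgt _ _ | simp
      exact ⟨(biprod.inr : _ ⟶ (0 : C) ⊞ Y.X (n + 1)), h, biprod.inr_snd⟩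
  let b : Hom (cone (zeroHom Y)) Y :=
    { f := fun n => match n with
        | 0 => 𝟙 _
        | n + 1 => biprod.snd
      comm := fun n => match n with
        | 0 => by
          change biprod.snd ≫ Y.d 0 = biprod.desc ((zeroHom Y).f 0) (Y.d 0) ≫ 𝟙 _
          ext <;> simp [zeroHom]
        | n + 1 => by
          change biprod.snd ≫ Y.d (n + 1) = biprod.lift _
            (biprod.desc ((zeroHom Y).f (n + 1)) (Y.d (n + 1))) ≫ biprod.snd
          ext <;> simp [zeroHom] }
  have hb : ∀ n, IsIso (b.f n) := hz
  let c : Hom Y (cone (zeroHom Y)) :=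
    { f := fun n => inv (b.f n)
      comm := fun n => by rw [IsIso.inv_comp_eq, ← Category.assoc, IsIso.eq_comp_inv, b.comm] }
  exact ⟨fun h => ExactBelow.of_iso b hb h,
    fun h => ExactBelow.of_iso c (fun n => inferInstanceAs (IsIso (inv (b.f n)))) h⟩

end ExactStructure

end Complexes

/-! ### Pure conflations and pure quasi-isomorphisms -/

section Pure

set_option linter.unusedSectionVars false

variable {C : Type u} [Category.{v} C] [Preadditive C] [MonoidalCategory C]
  [MonoidalPreadditive C]

namespace Cplx

/-- The complex `K ⊗ V`. -/
def tensor (K : Cplx C) (V : C) : Cplx C where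
  X n := K.X n ⊗ V
  d n := K.d n ▷ V
  d_comp_d n := by
    rw [← comp_whiskerRight, K.d_comp_d, MonoidalPreadditive.zero_whiskerRight]

/-- The chain map `f ⊗ V`. -/
def Hom.tensor {K L : Cplx C} (f : Hom K L) (V : C) : Hom (K.tensor V) (L.tensor V) where
  f n := f.f n ▷ V
  comm n := by
    simp only [Cplx.tensor]
    rw [← comp_whiskerRight, f.comm, comp_whiskerRight]

lemma Hom.comp_tensor {K L M : Cplx C} (f : Hom K L) (g : Hom L M) (V : C) :
    (f.comp g).tensor V = (f.tensor V).comp (g.tensor V) := by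
  ext n
  exact comp_whiskerRight _ _ _

/-- `(K ⊗ V) ⊗ W ≅ K ⊗ (V ⊗ W)`. -/
def tensorAssoc (K : Cplx C) (V W : C) : Hom (K.tensor (V ⊗ W)) ((K.tensor V).tensor W) where
  f n := (α_ (K.X n) V W).inv
  comm n := by simp [tensor]

/-- `K ⊗ 𝟙 ≅ K`. -/
def tensorUnit (K : Cplx C) : Hom (K.tensor (𝟙_ C)) K where
  f n := (ρ_ (K.X n)).hom
  comm n := by simp [tensor]

end Cplx

lemma isZero_tensor {Z : C} (h : IsZero Z) (V : C) : IsZero (Z ⊗ V) := by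
  rw [IsZero.iff_id_eq_zero] at h ⊢
  rw [← id_whiskerRight, h, MonoidalPreadditive.zero_whiskerRight]

namespace ExactStructure

open Cplx ZeroObject

variable (ℰ : ExactStructure C)

/-- The maps `i` and `p` form a conflation after tensoring with any object. -/
def PureConflation {X Y Z : C} (i : X ⟶ Y) (p : Y ⟶ Z) : Prop :=
  ∀ V : C, ℰ.Conflation (i ▷ V) (p ▷ V)

/-- The complex `K ⊗ V` is exact in degrees less than `N` for all `V`. -/
def PureExactBelow (N : ℕ) (K : Cplx C) : Prop := ∀ V : C, ℰ.ExactBelow N (K.tensor V)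

/-- The mapping cone of `f ⊗ V` is exact in degrees less than `N` for all `V`. -/
def PureQuasiIsoBelow [HasBinaryBiproducts C] (N : ℕ) {X Y : Cplx C} (f : Hom X Y) : Prop :=
  ∀ V : C, ℰ.QuasiIsoBelow N (f.tensor V)

variable {ℰ}

namespace PureConflation

variable {X Y Z : C} {i : X ⟶ Y} {p : Y ⟶ Z}

lemma of_iso (h : ℰ.PureConflation i p) {X' Y' Z' : C} {i' : X' ⟶ Y'} {p' : Y' ⟶ Z'}
    (a : X ≅ X') (b : Y ≅ Y') (c : Z ≅ Z') (h₁ : i ≫ b.hom = a.hom ≫ i')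
    (h₂ : p ≫ c.hom = b.hom ≫ p') : ℰ.PureConflation i' p' := fun V =>
  (h V).of_iso (whiskerRightIso a V) (whiskerRightIso b V) (whiskerRightIso c V)
    (by simp [← comp_whiskerRight, h₁]) (by simp [← comp_whiskerRight, h₂])

lemma conflation (h : ℰ.PureConflation i p) : ℰ.Conflation i p :=
  (h (𝟙_ C)).of_iso (ρ_ X) (ρ_ Y) (ρ_ Z) (by simp) (by simp)

lemma whiskerRight (h : ℰ.PureConflation i p) (W : C) : ℰ.PureConflation (i ▷ W) (p ▷ W) :=
  fun V => (h (W ⊗ V)).of_iso (α_ X W V).symm (α_ Y W V).symm (α_ Z W V).symm (by simp) (by simp)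

lemma whiskerLeft [BraidedCategory C] (h : ℰ.PureConflation i p) (W : C) :
    ℰ.PureConflation (W ◁ i) (W ◁ p) :=
  (h.whiskerRight W).of_iso (β_ X W) (β_ Y W) (β_ Z W) (by simp) (by simp)

variable [HasZeroObject C]

lemma iso_zero (ℰ : ExactStructure C) (hZ : IsZero Z) (i : X ⟶ Y) [IsIso i] (p : Y ⟶ Z) :
    ℰ.PureConflation i p := fun V =>
  conflation_iso_zero ℰ (isZero_tensor hZ V) _ _

end PureConflation

lemma PureExactBelow.mono {N M : ℕ} (h : N ≤ M) {X : Cplx C} (hX : ℰ.PureExactBelow M X) :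
    ℰ.PureExactBelow N X := fun V => (hX V).mono h

lemma PureExactBelow.of_iso {N : ℕ} {X Y : Cplx C} (φ : Hom X Y)
    (hφ : ∀ n, IsIso (φ.f n)) (h : ℰ.PureExactBelow N X) : ℰ.PureExactBelow N Y := fun V =>
  (h V).of_iso (φ.tensor V) fun n => inferInstanceAs (IsIso (φ.f n ▷ V))

lemma PureExactBelow.tensor {N : ℕ} {X : Cplx C} (h : ℰ.PureExactBelow N X) (W : C) :
    ℰ.PureExactBelow N (X.tensor W) := fun V =>
  (h (W ⊗ V)).of_iso (X.tensorAssoc W V) fun n => inferInstanceAs (IsIso (α_ (X.X n) W V).inv)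

lemma PureExactBelow.exactBelow {N : ℕ} {X : Cplx C} (h : ℰ.PureExactBelow N X) :
    ℰ.ExactBelow N X :=
  (h (𝟙_ C)).of_iso X.tensorUnit fun n => inferInstanceAs (IsIso (ρ_ (X.X n)).hom)

variable [HasZeroObject C] [HasBinaryBiproducts C]

lemma PureExactBelow.cons {N : ℕ} {Y : C} (hY : IsZero Y) {K : Cplx C} (e : K.X 0 ⟶ Y)
    (h : K.d 0 ≫ e = 0) (hK : ℰ.PureExactBelow N K) :
    ℰ.PureExactBelow (N + 1) (Cplx.cons Y K e h) := fun V =>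
  ((hK V).cons (isZero_tensor hY V) (e ▷ V) (by
      change K.d 0 ▷ V ≫ e ▷ V = 0
      rw [← comp_whiskerRight, h, MonoidalPreadditive.zero_whiskerRight])).of_iso
    { f := fun n => match n with
        | 0 => 𝟙 _
        | n + 1 => 𝟙 _
      comm := fun n => match n with
        | 0 => (Category.id_comp _).trans (Category.comp_id _).symm
        | n + 1 => (Category.id_comp _).trans (Category.comp_id _).symm }
    (fun n => match n with
      | 0 => inferInstanceAs (IsIso (𝟙 _))
      | n + 1 => inferInstanceAs (IsIso (𝟙 _)))

lemma PureQuasiIsoBelow.deflation_comp {N : ℕ} {G X Y W : Cplx C} (ι : Hom G X) (f : Hom X Y)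
    (g : Hom Y W) (h : ∀ n, ℰ.PureConflation (ι.f n) (f.f n)) (hG : ℰ.PureExactBelow N G)
    (hg : ℰ.PureQuasiIsoBelow N g) : ℰ.PureQuasiIsoBelow N (f.comp g) := fun V => by
  rw [Hom.comp_tensor]
  exact QuasiIsoBelow.deflation_comp (ι.tensor V) _ _ (fun n => h n V) (hG V) (hg V)

lemma PureQuasiIsoBelow.comp_inflation {N : ℕ} {X Y W H : Cplx C} (f : Hom X Y) (g : Hom Y W)
    (q : Hom W H) (h : ∀ n, ℰ.PureConflation (g.f n) (q.f n)) (hH : ℰ.PureExactBelow N H)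
    (hf : ℰ.PureQuasiIsoBelow N f) : ℰ.PureQuasiIsoBelow N (f.comp g) := fun V => by
  rw [Hom.comp_tensor]
  exact QuasiIsoBelow.comp_inflation _ _ (q.tensor V) (fun n => h n V) (hH V) (hf V)

lemma PureQuasiIsoBelow.of_tail {N : ℕ} {X Y : Cplx C} (f : Hom X Y) (h₀ : IsIso (f.f 0))
    (h : ℰ.PureQuasiIsoBelow N f.tail) : ℰ.PureQuasiIsoBelow (N + 1) f := fun V =>
  QuasiIsoBelow.of_tail (f.tensor V) (inferInstanceAs (IsIso (f.f 0 ▷ V))) (h V)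

lemma PureQuasiIsoBelow.of_isIso (N : ℕ) {X Y : Cplx C} (f : Hom X Y)
    (h : ∀ n, IsIso (f.f n)) : ℰ.PureQuasiIsoBelow N f := fun V =>
  QuasiIsoBelow.of_isIso N (f.tensor V) fun n => inferInstanceAs (IsIso (f.f n ▷ V))

lemma PureQuasiIsoBelow.of_iso {N : ℕ} {X Y X' Y' : Cplx C} {f : Hom X Y} {f' : Hom X' Y'}
    (a : Hom X X') (b : Hom Y Y') (ha : ∀ n, IsIso (a.f n)) (hb : ∀ n, IsIso (b.f n))
    (h : ∀ n, a.f n ≫ f'.f n = f.f n ≫ b.f n) (hf : ℰ.PureQuasiIsoBelow N f) :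
    ℰ.PureQuasiIsoBelow N f' := fun V =>
  QuasiIsoBelow.of_iso (a.tensor V) (b.tensor V)
    (fun n => inferInstanceAs (IsIso (a.f n ▷ V))) (fun n => inferInstanceAs (IsIso (b.f n ▷ V)))
    (fun n => by
      change a.f n ▷ V ≫ f'.f n ▷ V = f.f n ▷ V ≫ b.f n ▷ V
      rw [← comp_whiskerRight, h, comp_whiskerRight]) (hf V)

/-- A map into a complex `Y` remains a quasi-isomorphism in low degrees after composition with
a map that is invertible in low degrees. -/
lemma PureQuasiIsoBelow.comp_of_isIso_le {N : ℕ} {X Y W : Cplx C} (f : Hom X Y) (g : Hom Y W)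
    (hg : ∀ n, n ≤ N → IsIso (g.f n)) (hf : ℰ.PureQuasiIsoBelow N f) :
    ℰ.PureQuasiIsoBelow N (f.comp g) := fun V =>
  ExactBelow.of_iso_le (coneMap (f.tensor V) ((f.comp g).tensor V) (Hom.id _) (g.tensor V)
      (fun n => (Category.id_comp _).trans (comp_whiskerRight _ _ _)))
    (fun n hn => isIso_coneMapF _ _ (fun _ _ => inferInstanceAs (IsIso (𝟙 _)))
      (have := hg n hn; inferInstanceAs (IsIso (g.f n ▷ V)))) (hf V)

lemma pureQuasiIsoBelow_zeroHom_iff {N : ℕ} {Y : Cplx C} :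
    ℰ.PureQuasiIsoBelow N (zeroHom Y) ↔ ℰ.PureExactBelow N Y := by
  refine forall_congr' fun V => ?_
  rw [← quasiIsoBelow_zeroHom_iff]
  let a : Hom ((zero C).tensor V) (zero C) := ⟨fun _ => 0, fun _ => by simp⟩
  let a' : Hom (zero C) ((zero C).tensor V) := ⟨fun _ => 0, fun _ => by simp⟩
  have hz : IsZero ((0 : C) ⊗ V) := isZero_tensor (isZero_zero C) V
  have ha : ∀ n, IsIso (a.f n) := fun n =>
    ⟨a'.f n, hz.eq_of_src _ _, (isZero_zero C).eq_of_src _ _⟩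
  have ha' : ∀ n, IsIso (a'.f n) := fun n =>
    ⟨a.f n, (isZero_zero C).eq_of_src _ _, hz.eq_of_src _ _⟩
  exact ⟨QuasiIsoBelow.of_iso a (Hom.id _) ha (fun _ => inferInstanceAs (IsIso (𝟙 _)))
      (fun n => (isZero_tensor (isZero_zero C) V).eq_of_src _ _),
    QuasiIsoBelow.of_iso a' (Hom.id _) ha' (fun _ => inferInstanceAs (IsIso (𝟙 _)))
      (fun n => (isZero_zero C).eq_of_src _ _)⟩

end ExactStructure

end Pure

/-! ### Bimodules -/

section Bimodules

set_option linter.unusedSectionVars false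

variable {C : Type u} [Category.{v} C] [MonoidalCategory C]

/-- The identity of an algebra. -/
def AlgHom.id (A : Alg C) : AlgHom A A where
  hom := 𝟙 _
  map_mul := by simp

/-- A bimodule map over the identity of `A` from its compatibility with the actions, written with
whiskerings. -/
def BimoduleHom.ofId {A : Alg C} {M N : Bimodule A} (hom : M.X ⟶ N.X)
    (hl : M.left ≫ hom = A.X ◁ hom ≫ N.left) (hr : M.right ≫ hom = hom ▷ A.X ≫ N.right) :
    BimoduleHom (AlgHom.id A) M N where
  hom := hom
  map_left := by simpa [AlgHom.id] using hl
  map_right := by simpa [AlgHom.id] using hr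

lemma BimoduleHom.tensorPow_ofId_succ {A : Alg C} {M N : Bimodule A}
    (φ : BimoduleHom (AlgHom.id A) M N) (n : ℕ) :
    (φ.tensorPow (n + 1)).hom = (φ.tensorPow n).hom ▷ A.X :=
  tensorHom_id _ _

namespace Bimodule

variable {A B : Alg C}

/-- The restriction of a bimodule along an algebra homomorphism. -/
def restrict (f : AlgHom A B) (N : Bimodule B) : Bimodule A where
  X := N.X
  left := f.hom ▷ N.X ≫ N.left
  right := N.X ◁ f.hom ≫ N.right
  left_assoc := by
    rw [← comp_whiskerRight_assoc, f.map_mul, comp_whiskerRight_assoc, N.left_assoc,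
      MonoidalCategory.tensorHom_def, MonoidalCategory.whiskerLeft_comp, Category.assoc,
      whisker_exchange_assoc, comp_whiskerRight_assoc, associator_naturality_middle_assoc,
      associator_naturality_left_assoc, ← whisker_exchange_assoc]
  right_assoc := by
    rw [← MonoidalCategory.whiskerLeft_comp_assoc, f.map_mul,
      MonoidalCategory.whiskerLeft_comp_assoc, comp_whiskerRight, Category.assoc,
      ← whisker_exchange_assoc, N.right_assoc, MonoidalCategory.tensorHom_def,
      MonoidalCategory.whiskerLeft_comp_assoc, associator_naturality_right_assoc,
      associator_naturality_middle_assoc]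
  middle_assoc := by
    rw [comp_whiskerRight, Category.assoc, ← whisker_exchange_assoc, N.middle_assoc,
      MonoidalCategory.whiskerLeft_comp_assoc, whisker_exchange_assoc, whisker_exchange_assoc,
      ← associator_naturality_left_assoc, associator_naturality_right_assoc]

/-- The identity map as a bimodule map from a restriction. -/
def restrictHom (f : AlgHom A B) (N : Bimodule B) : BimoduleHom f (N.restrict f) N where
  hom := 𝟙 _
  map_left := by simp [restrict]
  map_right := by simp [restrict]

/-- The bimodule `L ⊗ R` with the left action on `L` and the right action on `R`. -/
def outer (L R : Bimodule A) : Bimodule A where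
  X := L.X ⊗ R.X
  left := (α_ A.X L.X R.X).inv ≫ L.left ▷ R.X
  right := (α_ L.X R.X A.X).hom ≫ L.X ◁ R.right
  left_assoc := by
    have h := congrArg (fun t => (α_ (A.X ⊗ A.X) L.X R.X).inv ≫ t ▷ R.X) L.left_assoc
    simp only [comp_whiskerRight] at h
    have h' : A.mul ▷ (L.X ⊗ R.X) ≫ (α_ A.X L.X R.X).inv ≫ L.left ▷ R.X =
        (α_ (A.X ⊗ A.X) L.X R.X).inv ≫ A.mul ▷ L.X ▷ R.X ≫ L.left ▷ R.X := by
      simp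
    rw [h', h]
    monoidal
  right_assoc := by
    have h := congrArg (fun t => (α_ (L.X ⊗ R.X) A.X A.X).hom ≫ (α_ L.X R.X (A.X ⊗ A.X)).hom ≫
      L.X ◁ ((α_ R.X A.X A.X).inv ≫ t)) R.right_assoc
    simp only [Iso.inv_hom_id_assoc, MonoidalCategory.whiskerLeft_comp] at h
    have h' : ((α_ L.X R.X A.X).hom ≫ L.X ◁ R.right) ▷ A.X ≫ (α_ L.X R.X A.X).hom ≫
        L.X ◁ R.right = (α_ (L.X ⊗ R.X) A.X A.X).hom ≫ (α_ L.X R.X (A.X ⊗ A.X)).hom ≫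
          L.X ◁ (α_ R.X A.X A.X).inv ≫ L.X ◁ R.right ▷ A.X ≫ L.X ◁ R.right := by
      simp
    rw [h', h]
    simp
  middle_assoc := by
    have h := congrArg (fun t => (α_ (A.X ⊗ L.X) R.X A.X).hom ≫ t)
      (whisker_exchange L.left R.right)
    simp only [whisker_exchange, comp_whiskerRight, Category.assoc] at h ⊢
    simp only [associator_naturality_left_assoc, ← whisker_exchange]
    simp

variable [Preadditive C] [MonoidalPreadditive C]

lemma sub_whiskerRight (X : C) {Y Z : C} (f g : Y ⟶ Z) : (f - g) ▷ X = f ▷ X - g ▷ X :=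
  (tensorRight X).map_sub

lemma whiskerLeft_sub (X : C) {Y Z : C} (f g : Y ⟶ Z) : X ◁ (f - g) = X ◁ f - X ◁ g :=
  (tensorLeft X).map_sub

/-- The bimodule of noncommutative `1`-forms with coefficients in `M`: it is `M ⊗ A` with the left
action on `M` and the right action `(m ⊗ a) · c = m ⊗ a c - m a ⊗ c`. The Hochschild complex with
coefficients in `M` is, in positive degrees and up to sign, the one with coefficients in
this bimodule. -/
def omega (M : Bimodule A) : Bimodule A where
  X := M.X ⊗ A.X
  left := (α_ A.X M.X A.X).inv ≫ M.left ▷ A.X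
  right := (α_ M.X A.X A.X).hom ≫ M.X ◁ A.mul - M.right ▷ A.X
  left_assoc := M.tensorAlg.left_assoc
  right_assoc := by
    have h₁ := M.tensorAlg.right_assoc
    simp only [tensorAlg] at h₁
    set r₁ := (α_ M.X A.X A.X).hom ≫ M.X ◁ A.mul with hr₁
    set r₂ := M.right ▷ A.X with hr₂
    have h₂ : (α_ (M.X ⊗ A.X) A.X A.X).hom ≫ (M.X ⊗ A.X) ◁ A.mul ≫ r₂ = r₂ ▷ A.X ≫ r₁ := by
      rw [hr₁, hr₂, associator_naturality_left_assoc, ← whisker_exchange]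
    have h₃ : r₁ ▷ A.X ≫ r₂ = r₂ ▷ A.X ≫ r₂ := by
      rw [hr₁, hr₂, ← comp_whiskerRight, ← comp_whiskerRight, M.right_assoc, Category.assoc]
    simp only [Preadditive.comp_sub, sub_whiskerRight, Preadditive.sub_comp, ← h₁, h₂, h₃]
    abel
  middle_assoc := by
    have h₁ := M.tensorAlg.middle_assoc
    simp only [tensorAlg] at h₁
    have h₂ : ((α_ A.X M.X A.X).inv ≫ M.left ▷ A.X) ▷ A.X ≫ M.right ▷ A.X =
        (α_ A.X (M.X ⊗ A.X) A.X).hom ≫ A.X ◁ M.right ▷ A.X ≫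
          (α_ A.X M.X A.X).inv ≫ M.left ▷ A.X := by
      have := congrArg (fun t => (α_ A.X M.X A.X).inv ▷ A.X ≫ t ▷ A.X) M.middle_assoc
      simp only [comp_whiskerRight, Category.assoc] at this ⊢
      rw [this]
      monoidal
    rw [Preadditive.comp_sub, whiskerLeft_sub, Preadditive.sub_comp, Preadditive.comp_sub, h₁, h₂]

/-- The trivial bimodule `𝟙`, on which `A` acts by zero. -/
def trivial (A : Alg C) : Bimodule A where
  X := 𝟙_ C
  left := 0
  right := 0
  left_assoc := by simp
  right_assoc := by simp
  middle_assoc := by simp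

lemma tensorPow_left_eq_zero (M : Bimodule A) (h : M.left = 0) (n : ℕ) :
    (M.tensorPow n).left = 0 := by
  induction n with
  | zero => exact h
  | succ n ih =>
    change (α_ A.X (M.tensorPow n).X A.X).inv ≫ (M.tensorPow n).left ▷ A.X = 0
    rw [ih]
    simp

end Bimodule

end Bimodules

/-! ### Bar and Hochschild complexes with coefficients -/

section Complexes

set_option linter.unusedSectionVars false

open Cplx

variable {C : Type u} [Category.{v} C] [Preadditive C] [MonoidalCategory C]
  [MonoidalPreadditive C] {A B : Alg C}

/-- The complex `(M ⊗ A^{⊗n}, b')`. -/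
def barCplx (M : Bimodule A) : Cplx C where
  X n := (M.tensorPow n).X
  d n := bPrime M n
  d_comp_d n := bPrime_sq M n

/-- The map of bar complexes induced by a bimodule map. -/
def barMap {f : AlgHom A B} {M : Bimodule A} {N : Bimodule B} (φ : BimoduleHom f M N) :
    Hom (barCplx M) (barCplx N) where
  f n := (φ.tensorPow n).hom
  comm n := bPrime_naturality φ n

lemma isIso_tensorPow {f : AlgHom A B} {M : Bimodule A} {N : Bimodule B}
    (φ : BimoduleHom f M N) [IsIso f.hom] [IsIso φ.hom] (n : ℕ) :
    IsIso (φ.tensorPow n).hom := by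
  induction n with
  | zero => assumption
  | succ n ih => exact inferInstanceAs (IsIso ((φ.tensorPow n).hom ⊗ₘ f.hom))

variable [SymmetricCategory C]

/-- The Hochschild complex `(M ⊗ A^{⊗n}, b)`. -/
def hochCplx (M : Bimodule A) : Cplx C where
  X n := (M.tensorPow n).X
  d n := hochschildB M n
  d_comp_d n := hochschildB_sq M n

/-- The map of Hochschild complexes induced by a bimodule map. -/
def hochMap {f : AlgHom A B} {M : Bimodule A} {N : Bimodule B} (φ : BimoduleHom f M N) :
    Hom (hochCplx M) (hochCplx N) where
  f n := (φ.tensorPow n).hom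
  comm n := hochschildB_naturality φ n

/-- The Hochschild complex is the bar complex if `A` acts by zero on the left. -/
def barToHoch (M : Bimodule A) (h : M.left = 0) : Hom (barCplx M) (hochCplx M) where
  f n := 𝟙 _
  comm n := by
    have : hochschildB M n = bPrime M n := by
      rw [hochschildB, bLast, M.tensorPow_left_eq_zero h]
      simp
    exact (Category.id_comp _).trans (this.trans (Category.comp_id _).symm)

/-- `(M ⊗ A) ⊗ A^{⊗n} ≅ M ⊗ A^{⊗(n+1)}`. -/
def omegaTailF (M : Bimodule A) : ∀ n, (M.omega.tensorPow n).X ⟶ (M.tensorPow (n + 1)).X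
  | 0 => 𝟙 _
  | n + 1 => omegaTailF M n ▷ A.X

instance (M : Bimodule A) (n : ℕ) : IsIso (omegaTailF M n) := by
  induction n with
  | zero => exact inferInstanceAs (IsIso (𝟙 _))
  | succ n ih => exact inferInstanceAs (IsIso (omegaTailF M n ▷ A.X))

lemma omegaTailF_left (M : Bimodule A) (n : ℕ) :
    (M.omega.tensorPow n).left ≫ omegaTailF M n =
      A.X ◁ omegaTailF M n ≫ (M.tensorPow (n + 1)).left := by
  induction n with
  | zero =>
    change M.omega.left ≫ 𝟙 _ = A.X ◁ 𝟙 _ ≫ M.tensorAlg.left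
    rw [Category.comp_id, MonoidalCategory.whiskerLeft_id, Category.id_comp]
    rfl
  | succ n ih =>
    change ((α_ _ _ _).inv ≫ (M.omega.tensorPow n).left ▷ A.X) ≫ omegaTailF M n ▷ A.X =
      A.X ◁ omegaTailF M n ▷ A.X ≫ (α_ _ _ _).inv ≫ (M.tensorPow (n + 1)).left ▷ A.X
    rw [Category.assoc, ← comp_whiskerRight, ih]
    simp

lemma omegaTailF_bPrime (M : Bimodule A) (n : ℕ) :
    omegaTailF M n ▷ A.X ≫ bPrime M (n + 1) = -(bPrime M.omega n ≫ omegaTailF M n) := by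
  induction n with
  | zero =>
    change 𝟙 (M.X ⊗ A.X) ▷ A.X ≫ (M.right ▷ A.X +
      (-1 : ℤ) ^ (0 + 1) • ((α_ M.X A.X A.X).hom ≫ M.X ◁ A.mul)) =
      -(((α_ M.X A.X A.X).hom ≫ M.X ◁ A.mul - M.right ▷ A.X) ≫ 𝟙 _)
    simp
    abel
  | succ n ih =>
    have h : omegaTailF M n ▷ A.X ▷ A.X ≫ M.mulLast (n + 1) =
        M.omega.mulLast n ≫ omegaTailF M n ▷ A.X := by
      rw [Bimodule.mulLast, Bimodule.mulLast, associator_naturality_left_assoc,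
        ← whisker_exchange, Category.assoc]
    change omegaTailF M n ▷ A.X ▷ A.X ≫
        (bPrime M (n + 1) ▷ A.X + (-1 : ℤ) ^ (n + 2) • M.mulLast (n + 1)) =
      -((bPrime M.omega n ▷ A.X + (-1 : ℤ) ^ (n + 1) • M.omega.mulLast n) ≫
        omegaTailF M n ▷ A.X)
    rw [Preadditive.comp_add, Preadditive.comp_zsmul, h, Preadditive.add_comp,
      ← comp_whiskerRight, ← comp_whiskerRight, ih, Preadditive.zsmul_comp, pow_succ _ (n + 1),
      neg_add, show ∀ {Y Z : C} (f : Y ⟶ Z), (-f) ▷ A.X = -(f ▷ A.X) from fun f => (tensorRight A.X).map_neg]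
    simp

lemma omegaTailF_hochschildB (M : Bimodule A) (n : ℕ) :
    omegaTailF M n ▷ A.X ≫ hochschildB M (n + 1) =
      -(hochschildB M.omega n ≫ omegaTailF M n) := by
  have h : omegaTailF M n ▷ A.X ≫ bLast M (n + 1) = bLast M.omega n ≫ omegaTailF M n := by
    rw [bLast, bLast, BraidedCategory.braiding_naturality_left_assoc, ← omegaTailF_left,
      Category.assoc]
  rw [hochschildB, hochschildB, Preadditive.comp_add, Preadditive.comp_zsmul, h,
    Preadditive.add_comp, Preadditive.zsmul_comp, pow_succ _ (n + 1), omegaTailF_bPrime, neg_add]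
  simp

lemma isIso_zsmul {X Y : C} (n : ℕ) (f : X ⟶ Y) [IsIso f] : IsIso ((-1 : ℤ) ^ n • f) := by
  have h : (-1 : ℤ) ^ n * (-1) ^ n = 1 := by rw [← mul_pow]; simp
  exact ⟨(-1 : ℤ) ^ n • inv f, by
    rw [Preadditive.zsmul_comp, Preadditive.comp_zsmul, smul_smul, h]; simp, by
    rw [Preadditive.zsmul_comp, Preadditive.comp_zsmul, smul_smul, h]; simp⟩

/-- In positive degrees, the Hochschild complex with coefficients in `M` is isomorphic to the one
with coefficients in `M.omega`. The sign `(-1)^n` compensates for the sign of the differential. -/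
def omegaTail (M : Bimodule A) : Hom (hochCplx M.omega) (hochCplx M).tail where
  f n := (-1 : ℤ) ^ n • omegaTailF M n
  comm n := by
    change ((-1 : ℤ) ^ (n + 1) • (omegaTailF M n ▷ A.X)) ≫ hochschildB M (n + 1) =
      hochschildB M.omega n ≫ ((-1 : ℤ) ^ n • omegaTailF M n)
    rw [Preadditive.zsmul_comp, omegaTailF_hochschildB, pow_succ, Preadditive.comp_zsmul]
    simp

lemma isIso_omegaTail (M : Bimodule A) (n : ℕ) : IsIso ((omegaTail M).f n) :=
  isIso_zsmul n (omegaTailF M n)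

end Complexes

/-! ### Change of algebra for H-unital coefficients -/

section Stages

set_option linter.unusedSectionVars false

open Cplx ExactStructure ZeroObject

variable {C : Type u} [Category.{v} C] [Preadditive C] [MonoidalCategory C]
  [MonoidalPreadditive C] [SymmetricCategory C] [HasZeroObject C] [HasBinaryBiproducts C]

lemma add_zsmul_comp_eq {X Y Z W : C} {a b : X ⟶ Y} {j : Y ⟶ Z} {j' : X ⟶ W} {a' b' : W ⟶ Z}
    (e : ℤ) (ha : a ≫ j = j' ≫ a') (hb : b ≫ j = j' ≫ b') :
    (a + e • b) ≫ j = j' ≫ (a' + e • b') := by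
  rw [Preadditive.add_comp, Preadditive.zsmul_comp, Preadditive.comp_add, Preadditive.comp_zsmul,
    ha, hb]

lemma add_zsmul_comp_of_eq_zero {X Y Z : C} {a b : X ⟶ Y} {q : Y ⟶ Z} {t : X ⟶ Z}
    (e : ℤ) (ha : a ≫ q = t) (hb : b ≫ q = 0) : (a + e • b) ≫ q = t := by
  rw [Preadditive.add_comp, Preadditive.zsmul_comp, ha, hb, smul_zero, add_zero]

/-- A subcomplex `U` of the Hochschild complex `(M ⊗ E^{⊗n}, b)`, given by maps `j`, that is
closed under `b'` and under the left action of `E`, is closed under the right action of `E` in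
positive degrees, contains everything in degree `0`, and satisfies `U (n + 1) ⊆ U n ⊗ E`.
The maps `q` are the cokernels of these last inclusions `u`; they form a complex `G`, whose
differential is induced by `b' ⊗ E`, and this complex is required to be pure exact. -/
structure Stage (ℰ : ExactStructure C) {E : Alg C} (M : Bimodule E) where
  U : ℕ → C
  j : ∀ n, U n ⟶ (M.tensorPow n).X
  mono_j : ∀ n V, Mono (j n ▷ V)
  isIso_j : IsIso (j 0)
  b : ∀ n, U (n + 1) ⟶ U n
  b_j : ∀ n, b n ≫ j n = j (n + 1) ≫ bPrime M n
  l : ∀ n, E.X ⊗ U n ⟶ U n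
  l_j : ∀ n, l n ≫ j n = E.X ◁ j n ≫ (M.tensorPow n).left
  r : ∀ n, U (n + 1) ⊗ E.X ⟶ U (n + 1)
  r_j : ∀ n, r n ≫ j (n + 1) = j (n + 1) ▷ E.X ≫ (M.tensorPow (n + 1)).right
  u : ∀ n, U (n + 1) ⟶ U n ⊗ E.X
  u_j : ∀ n, u n ≫ j n ▷ E.X = j (n + 1)
  G : Cplx C
  q : ∀ n, U n ⊗ E.X ⟶ G.X n
  conflation : ∀ n, ℰ.PureConflation (u n) (q n)
  q_d : ∀ n, q (n + 1) ≫ G.d n = b n ▷ E.X ≫ q n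
  exact : ∀ N, ℰ.PureExactBelow N G

namespace Stage

variable {ℰ : ExactStructure C} {E : Alg C} {M : Bimodule E} (S : Stage ℰ M)

lemma mono_j' (n : ℕ) : Mono (S.j n) := by
  have h := S.mono_j n (𝟙_ C)
  have : S.j n = (ρ_ _).inv ≫ S.j n ▷ (𝟙_ C) ≫ (ρ_ _).hom := by simp
  rw [this]
  infer_instance

/-- The cyclic face of the differential `b` on the subcomplex. -/
def c (n : ℕ) : S.U (n + 1) ⟶ S.U n := S.u n ≫ (β_ (S.U n) E.X).hom ≫ S.l n

lemma c_j (n : ℕ) : S.c n ≫ S.j n = S.j (n + 1) ≫ bLast M n := by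
  rw [c, Category.assoc, Category.assoc, S.l_j, ← BraidedCategory.braiding_naturality_left_assoc,
    reassoc_of% S.u_j, bLast]
  rfl

lemma d_j (n : ℕ) : (S.b n + (-1 : ℤ) ^ (n + 1) • S.c n) ≫ S.j n =
    S.j (n + 1) ≫ hochschildB M n :=
  add_zsmul_comp_eq _ (S.b_j n) (S.c_j n)

/-- The subcomplex as a complex. -/
def cplx : Cplx C where
  X := S.U
  d n := S.b n + (-1 : ℤ) ^ (n + 1) • S.c n
  d_comp_d n := by
    have := S.mono_j' n
    refine (cancel_mono (S.j n)).1 ((Category.assoc _ _ _).trans ((congrArg _ (S.d_j n)).trans ?_))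
    refine (Category.assoc _ _ _).symm.trans ((congrArg (· ≫ hochschildB M n)
      (S.d_j (n + 1))).trans ((Category.assoc _ _ _).trans ?_))
    exact (congrArg _ (hochschildB_sq M n)).trans (comp_zero.trans zero_comp.symm)

/-- The inclusion into the Hochschild complex. -/
def toHoch : Hom S.cplx (hochCplx M) where
  f := S.j
  comm n := (S.d_j n).symm

/-- The subcomplex that is `M` in degree `0` and `U n ⊗ E` in degree `n + 1`. -/
def next : Stage ℰ M where
  U := consX M.X fun n => S.U n ⊗ E.X
  j
    | 0 => 𝟙 M.X
    | n + 1 => S.j n ▷ E.X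
  mono_j
    | 0, V => inferInstanceAs (Mono (𝟙 M.X ▷ V))
    | n + 1, V => by
      have := S.mono_j n (E.X ⊗ V)
      change Mono (S.j n ▷ E.X ▷ V)
      have : S.j n ▷ E.X ▷ V = (α_ _ _ _).hom ≫ S.j n ▷ (E.X ⊗ V) ≫ (α_ _ _ _).inv := by simp
      rw [this]
      infer_instance
  isIso_j := inferInstanceAs (IsIso (𝟙 M.X))
  b
    | 0 => S.j 0 ▷ E.X ≫ M.right
    | n + 1 => S.b n ▷ E.X + (-1 : ℤ) ^ (n + 1) • (S.r n ≫ S.u n)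
  b_j
    | 0 => Category.comp_id _
    | n + 1 => by
      have h₁ : S.b n ▷ E.X ≫ S.j n ▷ E.X = S.j (n + 1) ▷ E.X ≫ bPrime M n ▷ E.X := by
        rw [← comp_whiskerRight, S.b_j]
        exact comp_whiskerRight _ _ _
      have h₂ : (S.r n ≫ S.u n) ≫ S.j n ▷ E.X = S.j (n + 1) ▷ E.X ≫ M.mulLast n := by
        rw [Category.assoc, S.u_j]
        exact S.r_j n
      exact add_zsmul_comp_eq _ h₁ h₂
  l
    | 0 => M.left
    | n + 1 => (α_ E.X (S.U n) E.X).inv ≫ S.l n ▷ E.X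
  l_j
    | 0 => (Category.comp_id _).trans
        ((Category.id_comp _).symm.trans (congrArg (· ≫ M.left) (MonoidalCategory.whiskerLeft_id _ _).symm))
    | n + 1 => by
      change ((α_ E.X (S.U n) E.X).inv ≫ S.l n ▷ E.X) ≫ S.j n ▷ E.X =
        E.X ◁ S.j n ▷ E.X ≫ (α_ _ _ _).inv ≫ (M.tensorPow n).left ▷ E.X
      rw [Category.assoc, ← comp_whiskerRight, S.l_j]
      simp
  r n := (α_ (S.U n) E.X E.X).hom ≫ S.U n ◁ E.mul
  r_j n := by
    change ((α_ (S.U n) E.X E.X).hom ≫ S.U n ◁ E.mul) ≫ S.j n ▷ E.X =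
      S.j n ▷ E.X ▷ E.X ≫ (α_ _ _ _).hom ≫ (M.tensorPow n).X ◁ E.mul
    rw [Category.assoc, whisker_exchange, associator_naturality_left_assoc]
  u
    | 0 => S.j 0 ▷ E.X
    | n + 1 => S.u n ▷ E.X
  u_j
    | 0 => (congrArg _ (id_whiskerRight _ _)).trans (Category.comp_id _)
    | n + 1 => by
      change S.u n ▷ E.X ≫ S.j n ▷ E.X ▷ E.X = S.j (n + 1) ▷ E.X
      rw [← comp_whiskerRight, S.u_j]
      rfl
  G := Cplx.cons 0 (S.G.tensor E.X) 0 (by simp)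
  q
    | 0 => 0
    | n + 1 => S.q n ▷ E.X
  conflation
    | 0 => by
      have := S.isIso_j
      exact PureConflation.iso_zero ℰ (isZero_zero C) (S.j 0 ▷ E.X) _
    | n + 1 => (S.conflation n).whiskerRight E.X
  q_d
    | 0 => (isZero_zero C).eq_of_tgt _ _
    | n + 1 => by
      change S.q (n + 1) ▷ E.X ≫ S.G.d n ▷ E.X =
        (S.b n ▷ E.X + (-1 : ℤ) ^ (n + 1) • (S.r n ≫ S.u n)) ▷ E.X ≫ S.q n ▷ E.X
      have h : S.u n ≫ S.q n = 0 := (S.conflation n).conflation.w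
      rw [← comp_whiskerRight, ← comp_whiskerRight, S.q_d, Preadditive.add_comp,
        Preadditive.zsmul_comp, Category.assoc, h, comp_zero, smul_zero, add_zero]
  exact N := (((S.exact N).tensor E.X).cons (isZero_zero C) _ _).mono (Nat.le_succ N)

/-- The inclusion of a subcomplex into the next one. -/
def toNext : Hom S.cplx S.next.cplx where
  f
    | 0 => S.j 0
    | n + 1 => S.u n
  comm n := by
    have := S.next.mono_j' n
    have h : ∀ n, (match n with | 0 => S.j 0 | n + 1 => S.u n :
        S.U n ⟶ S.next.U n) ≫ S.next.j n = S.j n := fun n => match n with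
      | 0 => Category.comp_id _
      | n + 1 => S.u_j n
    have h₁ : S.next.cplx.d n ≫ S.next.j n = S.next.j (n + 1) ≫ hochschildB M n := S.next.d_j n
    have h₂ : S.cplx.d n ≫ S.j n = S.j (n + 1) ≫ hochschildB M n := S.d_j n
    have h₃ := h (n + 1)
    have h₄ := h n
    refine (cancel_mono (S.next.j n)).1 ((Category.assoc _ _ _).trans ((congrArg _ h₁).trans ?_))
    refine Eq.trans ?_ (Category.assoc _ _ _).symm
    refine Eq.trans ?_ (congrArg (S.cplx.d n ≫ ·) h₄).symm
    refine (Category.assoc _ _ _).symm.trans ?_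
    exact (congrArg (· ≫ hochschildB M n) h₃).trans h₂.symm

lemma toNext_toHoch : S.toNext.comp S.next.toHoch = S.toHoch := by
  ext n
  cases n with
  | zero => exact Category.comp_id _
  | succ n => exact S.u_j n

lemma next_c_q (n : ℕ) : S.next.c (n + 1) ≫ S.q n = 0 := by
  have h : S.next.c (n + 1) = ((β_ (S.U (n + 1)) E.X).hom ≫ S.l (n + 1)) ≫ S.u n := by
    have := S.mono_j n E.X
    have h₁ : (((β_ (S.U (n + 1)) E.X).hom ≫ S.l (n + 1)) ≫ S.u n) ≫ S.j n ▷ E.X =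
        S.j (n + 1) ▷ E.X ≫ bLast M (n + 1) := by
      rw [Category.assoc, Category.assoc, S.u_j]
      refine (congrArg _ (S.l_j (n + 1))).trans ?_
      exact (BraidedCategory.braiding_naturality_left_assoc (S.j (n + 1)) E.X _).symm
    exact (cancel_mono (S.j n ▷ E.X)).1 ((S.next.c_j (n + 1)).trans h₁.symm)
  have h' : S.u n ≫ S.q n = 0 := (S.conflation n).conflation.w
  rw [h]
  exact (Category.assoc _ _ _).trans ((congrArg _ h').trans comp_zero)

/-- The projection from the next subcomplex to the quotient by the previous one. -/
def nextToG : Hom S.next.cplx (Cplx.cons 0 S.G 0 (by simp)) where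
  f
    | 0 => 0
    | n + 1 => S.q n
  comm
    | 0 => (isZero_zero C).eq_of_tgt _ _
    | n + 1 => by
      have h : S.u n ≫ S.q n = 0 := (S.conflation n).conflation.w
      have h₁ : (S.b n ▷ E.X + (-1 : ℤ) ^ (n + 1) • (S.r n ≫ S.u n)) ≫ S.q n =
          S.q (n + 1) ≫ S.G.d n := by
        rw [S.q_d]
        exact add_zsmul_comp_of_eq_zero _ rfl (by rw [Category.assoc, h, comp_zero])
      exact (add_zsmul_comp_of_eq_zero _ h₁ (S.next_c_q n)).symm

lemma conflation_toNext (n : ℕ) : ℰ.PureConflation (S.toNext.f n) (S.nextToG.f n) := by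
  cases n with
  | zero =>
    have := S.isIso_j
    exact PureConflation.iso_zero ℰ (isZero_zero C) (S.j 0) _
  | succ n => exact S.conflation n

/-- The `k`th subcomplex after a given one. -/
def iter : ℕ → Stage ℰ M
  | 0 => S
  | k + 1 => (iter k).next

/-- From the `n`th subcomplex on, the inclusion is invertible in degree `n`. -/
lemma isIso_iter_j {k n : ℕ} (h : n ≤ k) : IsIso ((S.iter k).j n) := by
  induction k generalizing n with
  | zero =>
    obtain rfl : n = 0 := by omega
    exact S.isIso_j
  | succ k ih =>
    cases n with
    | zero => exact inferInstanceAs (IsIso (𝟙 M.X))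
    | succ n =>
      have := ih (Nat.le_of_succ_le_succ h)
      exact inferInstanceAs (IsIso ((S.iter k).j n ▷ E.X))

/-- A quasi-isomorphism to the subcomplex remains a quasi-isomorphism as a map to the whole
Hochschild complex: each subcomplex is included in the next one with exact quotient `G`, shifted by
one degree, and in each degree the sequence of subcomplexes reaches the whole complex. -/
lemma quasiIso_toHoch {N : ℕ} {K : Cplx C} (f : Hom K S.cplx) (hf : ℰ.PureQuasiIsoBelow N f) :
    ℰ.PureQuasiIsoBelow N (f.comp S.toHoch) := by
  have h : ∀ k, ∃ g : Hom K (S.iter k).cplx, ℰ.PureQuasiIsoBelow N g ∧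
      g.comp (S.iter k).toHoch = f.comp S.toHoch := by
    intro k
    induction k with
    | zero => exact ⟨f, hf, rfl⟩
    | succ k ih =>
      obtain ⟨g, hg, hgf⟩ := ih
      refine ⟨g.comp (S.iter k).toNext,
        PureQuasiIsoBelow.comp_inflation g _ (S.iter k).nextToG (S.iter k).conflation_toNext
          ((((S.iter k).exact N).cons (isZero_zero C) _ _).mono (Nat.le_succ N)) hg, ?_⟩
      rw [← hgf, ← (S.iter k).toNext_toHoch]
      ext n
      exact Category.assoc _ _ _
  obtain ⟨g, hg, hgf⟩ := h N
  rw [← hgf]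
  exact hg.comp_of_isIso_le g _ fun n hn => S.isIso_iter_j hn

end Stage

end Stages

/-! ### Excision with coefficients -/

section Coefficients

set_option linter.unusedSectionVars false

open Cplx ExactStructure ZeroObject

variable {C : Type u} [Category.{v} C] [Preadditive C] [MonoidalCategory C]
  [MonoidalPreadditive C]

namespace Bimodule

variable {I E Q : Alg C} {i : AlgHom I E} {p : AlgHom E Q}

lemma exists_ideal_left (h : IsKer i.hom p.hom) :
    ∃ l : E.X ⊗ I.X ⟶ I.X, l ≫ i.hom = E.X ◁ i.hom ≫ E.mul :=
  h.lift _ (by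
    rw [Category.assoc, p.map_mul, MonoidalCategory.tensorHom_def', Category.assoc,
      ← whiskerLeft_comp_assoc, h.w]
    simp)

lemma exists_ideal_right (h : IsKer i.hom p.hom) :
    ∃ r : I.X ⊗ E.X ⟶ I.X, r ≫ i.hom = i.hom ▷ E.X ≫ E.mul :=
  h.lift _ (by
    rw [Category.assoc, p.map_mul, MonoidalCategory.tensorHom_def, Category.assoc,
      ← comp_whiskerRight_assoc, h.w]
    simp)

/-- The left action of `E` on the kernel `I` of an algebra homomorphism `E ⟶ Q`. -/
def idealLeft (h : IsKer i.hom p.hom) : E.X ⊗ I.X ⟶ I.X := (exists_ideal_left h).choose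

/-- The right action of `E` on the kernel `I` of an algebra homomorphism `E ⟶ Q`. -/
def idealRight (h : IsKer i.hom p.hom) : I.X ⊗ E.X ⟶ I.X := (exists_ideal_right h).choose

lemma idealLeft_comp (h : IsKer i.hom p.hom) : idealLeft h ≫ i.hom = E.X ◁ i.hom ≫ E.mul :=
  (exists_ideal_left h).choose_spec

lemma idealRight_comp (h : IsKer i.hom p.hom) : idealRight h ≫ i.hom = i.hom ▷ E.X ≫ E.mul :=
  (exists_ideal_right h).choose_spec

/-- The kernel `I` of an algebra homomorphism `E ⟶ Q` as an `E`-bimodule. -/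
def ideal (h : IsKer i.hom p.hom) : Bimodule E where
  X := I.X
  left := idealLeft h
  right := idealRight h
  left_assoc := by
    have hl := idealLeft_comp h
    have := h.mono
    rw [← cancel_mono i.hom, Category.assoc, hl, ← whisker_exchange_assoc, E.assoc,
      Category.assoc, Category.assoc, hl, ← whiskerLeft_comp_assoc, hl]
    simp
  right_assoc := by
    have hr := idealRight_comp h
    have := h.mono
    rw [← cancel_mono i.hom, Category.assoc, Category.assoc, Category.assoc, hr,
      ← comp_whiskerRight_assoc, hr, comp_whiskerRight_assoc, E.assoc, whisker_exchange_assoc]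
    simp
  middle_assoc := by
    have hl := idealLeft_comp h
    have hr := idealRight_comp h
    have := h.mono
    rw [← cancel_mono i.hom, Category.assoc, Category.assoc, Category.assoc, hr, hl,
      ← comp_whiskerRight_assoc, hl, comp_whiskerRight_assoc, E.assoc, ← whiskerLeft_comp_assoc,
      hr]
    simp

/-- Restricting the `E`-bimodule `I` to `I` gives the regular bimodule. -/
def regularToIdeal (h : IsKer i.hom p.hom) :
    BimoduleHom (AlgHom.id I) (regular I) ((ideal h).restrict i) :=
  BimoduleHom.ofId (𝟙 I.X)
    (by
      have := h.mono
      change I.mul ≫ 𝟙 I.X = I.X ◁ 𝟙 I.X ≫ i.hom ▷ I.X ≫ idealLeft h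
      rw [← cancel_mono i.hom, Category.assoc, Category.assoc, Category.assoc, idealLeft_comp,
        MonoidalCategory.whiskerLeft_id, Category.id_comp, Category.id_comp, i.map_mul,
        MonoidalCategory.tensorHom_def, Category.assoc])
    (by
      have := h.mono
      change I.mul ≫ 𝟙 I.X = 𝟙 I.X ▷ I.X ≫ I.X ◁ i.hom ≫ idealRight h
      rw [← cancel_mono i.hom, Category.assoc, Category.assoc, Category.assoc, idealRight_comp,
        id_whiskerRight, Category.id_comp, Category.id_comp, i.map_mul,
        MonoidalCategory.tensorHom_def', Category.assoc])

/-- Restriction commutes with the outer tensor product. -/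
def outerRestrict (f : AlgHom I E) (L R : Bimodule E) :
    BimoduleHom (AlgHom.id I) ((L.restrict f).outer (R.restrict f)) ((L.outer R).restrict f) :=
  BimoduleHom.ofId (𝟙 (L.X ⊗ R.X))
    (by simp [outer, restrict])
    (by simp [outer, restrict])

/-- `(x ⊗ y) ⊗ A^{⊗n}` as `x ⊗ (y ⊗ A^{⊗n})`. -/
def outerPow {A : Alg C} (L R : Bimodule A) :
    ∀ n, L.X ⊗ (R.tensorPow n).X ⟶ ((L.outer R).tensorPow n).X
  | 0 => 𝟙 _
  | n + 1 => (α_ L.X (R.tensorPow n).X A.X).inv ≫ outerPow L R n ▷ A.X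

instance {A : Alg C} (L R : Bimodule A) (n : ℕ) : IsIso (outerPow L R n) := by
  induction n with
  | zero => exact inferInstanceAs (IsIso (𝟙 _))
  | succ n ih =>
    exact inferInstanceAs (IsIso ((α_ L.X (R.tensorPow n).X A.X).inv ≫ outerPow L R n ▷ A.X))

lemma outerPow_bPrime {A : Alg C} (L R : Bimodule A) (n : ℕ) :
    ((α_ L.X (R.tensorPow n).X A.X).inv ≫ outerPow L R n ▷ A.X) ≫ bPrime (L.outer R) n =
      L.X ◁ bPrime R n ≫ outerPow L R n := by
  induction n with
  | zero =>
    change ((α_ L.X R.X A.X).inv ≫ 𝟙 (L.X ⊗ R.X) ▷ A.X) ≫ (α_ L.X R.X A.X).hom ≫ L.X ◁ R.right =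
      L.X ◁ R.right ≫ 𝟙 _
    simp
  | succ n ih =>
    have h₁ : ((α_ L.X ((R.tensorPow n).X ⊗ A.X) A.X).inv ≫
        ((α_ L.X (R.tensorPow n).X A.X).inv ≫ outerPow L R n ▷ A.X) ▷ A.X) ≫
          bPrime (L.outer R) n ▷ A.X = L.X ◁ bPrime R n ▷ A.X ≫
            (α_ L.X (R.tensorPow n).X A.X).inv ≫ outerPow L R n ▷ A.X := by
      rw [Category.assoc, ← comp_whiskerRight, ih, comp_whiskerRight, whisker_assoc_symm]
      simp
    have h₂ : ((α_ L.X ((R.tensorPow n).X ⊗ A.X) A.X).inv ≫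
        ((α_ L.X (R.tensorPow n).X A.X).inv ≫ outerPow L R n ▷ A.X) ▷ A.X) ≫
          (L.outer R).mulLast n = L.X ◁ R.mulLast n ≫
            (α_ L.X (R.tensorPow n).X A.X).inv ≫ outerPow L R n ▷ A.X := by
      rw [mulLast, mulLast, comp_whiskerRight, Category.assoc, Category.assoc,
        associator_naturality_left_assoc, ← whisker_exchange]
      simp
    change ((α_ L.X ((R.tensorPow n).X ⊗ A.X) A.X).inv ≫
        ((α_ L.X (R.tensorPow n).X A.X).inv ≫ outerPow L R n ▷ A.X) ▷ A.X) ≫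
        (bPrime (L.outer R) n ▷ A.X + (-1 : ℤ) ^ (n + 1) • (L.outer R).mulLast n) =
      L.X ◁ (bPrime R n ▷ A.X + (-1 : ℤ) ^ (n + 1) • R.mulLast n) ≫
        (α_ L.X (R.tensorPow n).X A.X).inv ≫ outerPow L R n ▷ A.X
    rw [Preadditive.comp_add, Preadditive.comp_zsmul, h₁, h₂, MonoidalPreadditive.whiskerLeft_add,
      whiskerLeft_zsmul, Preadditive.add_comp, Preadditive.zsmul_comp]

/-- The inclusion of the kernel of the map `omegaToOmega` below. -/
def outerToOmega (h : IsKer i.hom p.hom) (M : Bimodule Q) :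
    BimoduleHom (AlgHom.id E) ((M.restrict p).outer (ideal h)) (M.restrict p).omega :=
  BimoduleHom.ofId (M.X ◁ i.hom)
    (by
      change ((α_ _ _ _).inv ≫ (p.hom ▷ M.X ≫ M.left) ▷ I.X) ≫ M.X ◁ i.hom =
        E.X ◁ M.X ◁ i.hom ≫ (α_ _ _ _).inv ≫ (p.hom ▷ M.X ≫ M.left) ▷ E.X
      rw [Category.assoc, ← whisker_exchange]
      simp)
    (by
      have h' : (M.X ◁ i.hom) ▷ E.X ≫ (M.X ◁ p.hom ≫ M.right) ▷ E.X = 0 := by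
        rw [← comp_whiskerRight, ← whiskerLeft_comp_assoc, h.w]
        simp
      change ((α_ M.X I.X E.X).hom ≫ M.X ◁ idealRight h) ≫ M.X ◁ i.hom = (M.X ◁ i.hom) ▷ E.X ≫
        ((α_ M.X E.X E.X).hom ≫ M.X ◁ E.mul - (M.X ◁ p.hom ≫ M.right) ▷ E.X)
      rw [Preadditive.comp_sub, h', sub_zero, Category.assoc,
        ← MonoidalCategory.whiskerLeft_comp, idealRight_comp]
      simp)

/-- The map `M ⊗ E ⟶ M ⊗ Q` induced by `E ⟶ Q`. -/
def omegaToOmega (p : AlgHom E Q) (M : Bimodule Q) :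
    BimoduleHom (AlgHom.id E) (M.restrict p).omega (M.omega.restrict p) :=
  BimoduleHom.ofId (M.X ◁ p.hom)
    (by
      change ((α_ _ _ _).inv ≫ (p.hom ▷ M.X ≫ M.left) ▷ E.X) ≫ M.X ◁ p.hom =
        E.X ◁ M.X ◁ p.hom ≫ p.hom ▷ (M.X ⊗ Q.X) ≫ (α_ _ _ _).inv ≫ M.left ▷ Q.X
      rw [Category.assoc, ← whisker_exchange]
      simp)
    (by
      have h₁ : ((α_ M.X E.X E.X).hom ≫ M.X ◁ E.mul) ≫ M.X ◁ p.hom =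
          (M.X ◁ p.hom) ▷ E.X ≫ (M.X ⊗ Q.X) ◁ p.hom ≫ (α_ M.X Q.X Q.X).hom ≫ M.X ◁ Q.mul := by
        rw [Category.assoc, ← MonoidalCategory.whiskerLeft_comp, p.map_mul,
          MonoidalCategory.tensorHom_def]
        simp
      have h₂ : (M.X ◁ p.hom ≫ M.right) ▷ E.X ≫ M.X ◁ p.hom =
          (M.X ◁ p.hom) ▷ E.X ≫ (M.X ⊗ Q.X) ◁ p.hom ≫ M.right ▷ Q.X := by
        rw [comp_whiskerRight, Category.assoc, ← whisker_exchange]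
      change ((α_ M.X E.X E.X).hom ≫ M.X ◁ E.mul - (M.X ◁ p.hom ≫ M.right) ▷ E.X) ≫ M.X ◁ p.hom =
        (M.X ◁ p.hom) ▷ E.X ≫ (M.X ⊗ Q.X) ◁ p.hom ≫
          ((α_ M.X Q.X Q.X).hom ≫ M.X ◁ Q.mul - M.right ▷ Q.X)
      rw [Preadditive.sub_comp, h₁, h₂, Preadditive.comp_sub, Preadditive.comp_sub])

end Bimodule

variable [SymmetricCategory C] [HasZeroObject C] {ℰ : ExactStructure C}

/-- A pure conflation of bimodules induces pure conflations on all tensor powers. -/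
lemma pureConflation_tensorPow {A : Alg C} {M₁ M₂ M₃ : Bimodule A}
    {φ : BimoduleHom (AlgHom.id A) M₁ M₂} {ψ : BimoduleHom (AlgHom.id A) M₂ M₃}
    (h : ℰ.PureConflation φ.hom ψ.hom) (n : ℕ) :
    ℰ.PureConflation (φ.tensorPow n).hom (ψ.tensorPow n).hom := by
  induction n with
  | zero => exact h
  | succ n ih =>
    rw [φ.tensorPow_ofId_succ, ψ.tensorPow_ofId_succ]
    exact ih.whiskerRight A.X

lemma pureExactBelow_barCplx_outer {A : Alg C} (L R : Bimodule A) {N : ℕ}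
    (h : ℰ.PureExactBelow N (barCplx R)) : ℰ.PureExactBelow N (barCplx (L.outer R)) := by
  let a : Hom ((barCplx R).tensor L.X) (barCplx (L.outer R)) :=
    { f := fun n => (β_ (R.tensorPow n).X L.X).hom ≫ L.outerPow R n
      comm := fun n => by
        have h₁ : (β_ ((R.tensorPow n).X ⊗ A.X) L.X).hom ≫ L.X ◁ bPrime R n =
          bPrime R n ▷ L.X ≫ (β_ (R.tensorPow n).X L.X).hom :=
          (BraidedCategory.braiding_naturality_left _ _).symm
        refine (Category.assoc _ _ _).trans ((congrArg _ (L.outerPow_bPrime R n)).trans ?_)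
        refine (Category.assoc _ _ _).symm.trans ((congrArg (· ≫ _) h₁).trans ?_)
        exact Category.assoc _ _ _ }
  exact (h.tensor L.X).of_iso a fun n =>
    inferInstanceAs (IsIso ((β_ (R.tensorPow n).X L.X).hom ≫ L.outerPow R n))

variable [HasBinaryBiproducts C] {I E Q : Alg C} {i : AlgHom I E} {p : AlgHom E Q}

open Bimodule

/-- The left action of `E` on `M ⊗ I^{⊗n}`. -/
def restrictPowLeft (i : AlgHom I E) (M : Bimodule E) :
    ∀ n, E.X ⊗ ((M.restrict i).tensorPow n).X ⟶ ((M.restrict i).tensorPow n).X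
  | 0 => M.left
  | n + 1 => (α_ _ _ _).inv ≫ restrictPowLeft i M n ▷ I.X

/-- The subcomplex `M ⊗ I^{⊗n}` of `M ⊗ E^{⊗n}`. -/
def Stage.initial (h : ℰ.PureConflation i.hom p.hom) (M : Bimodule E)
    (hM : ∀ N, ℰ.PureExactBelow N (barCplx (M.restrict i))) : Stage ℰ M where
  U n := ((M.restrict i).tensorPow n).X
  j n := ((M.restrictHom i).tensorPow n).hom
  mono_j n := by
    induction n with
    | zero => exact fun V => inferInstanceAs (Mono (𝟙 M.X ▷ V))
    | succ n ih =>
      intro V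
      have := ih (I.X ⊗ V)
      have := (h.whiskerLeft (M.tensorPow n).X V).mono
      have e : (((M.restrictHom i).tensorPow n).hom ⊗ₘ i.hom) ▷ V = (α_ _ _ _).hom ≫
          ((M.restrictHom i).tensorPow n).hom ▷ (I.X ⊗ V) ≫ (α_ _ _ _).inv ≫
            ((M.tensorPow n).X ◁ i.hom) ▷ V := by
        rw [MonoidalCategory.tensorHom_def, comp_whiskerRight]
        simp
      change Mono ((((M.restrictHom i).tensorPow n).hom ⊗ₘ i.hom) ▷ V)
      rw [e]
      infer_instance
  isIso_j := inferInstanceAs (IsIso (𝟙 M.X))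
  b n := bPrime (M.restrict i) n
  b_j n := (bPrime_naturality (M.restrictHom i) n).symm
  l := restrictPowLeft i M
  l_j n := by
    induction n with
    | zero =>
      change M.left ≫ 𝟙 M.X = E.X ◁ 𝟙 M.X ≫ M.left
      simp
    | succ n ih =>
      change ((α_ _ _ _).inv ≫ restrictPowLeft i M n ▷ I.X) ≫
        (((M.restrictHom i).tensorPow n).hom ⊗ₘ i.hom) =
          E.X ◁ (((M.restrictHom i).tensorPow n).hom ⊗ₘ i.hom) ≫ (α_ _ _ _).inv ≫
            (M.tensorPow n).left ▷ E.X
      rw [MonoidalCategory.tensorHom_def, Category.assoc, ← comp_whiskerRight_assoc, ih,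
        comp_whiskerRight_assoc, ← whisker_exchange]
      simp
  r n := (α_ _ _ _).hom ≫ ((M.restrict i).tensorPow n).X ◁ idealRight h.conflation.isKer
  r_j n := by
    change ((α_ _ _ _).hom ≫ ((M.restrict i).tensorPow n).X ◁ idealRight h.conflation.isKer) ≫
        (((M.restrictHom i).tensorPow n).hom ⊗ₘ i.hom) =
      (((M.restrictHom i).tensorPow n).hom ⊗ₘ i.hom) ▷ E.X ≫ (α_ _ _ _).hom ≫
        (M.tensorPow n).X ◁ E.mul
    rw [MonoidalCategory.tensorHom_def', Category.assoc, ← whiskerLeft_comp_assoc,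
      idealRight_comp, comp_whiskerRight, Category.assoc,
      associator_naturality_left_assoc, ← whisker_exchange]
    simp
  u n := ((M.restrict i).tensorPow n).X ◁ i.hom
  u_j n := (MonoidalCategory.tensorHom_def' _ _).symm
  G := (barCplx (M.restrict i)).tensor Q.X
  q n := ((M.restrict i).tensorPow n).X ◁ p.hom
  conflation n := h.whiskerLeft _
  q_d n := whisker_exchange _ _
  exact N := (hM N).tensor Q.X

/-- If `M ⊗ I^{⊗n}` with the boundary `b'` is pure exact, then a quasi-isomorphism to the
Hochschild complex of `I` with coefficients in `M` remains one as a map to the Hochschild complex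
of `E` with coefficients in `M`. -/
theorem PureQuasiIsoBelow.comp_restrictHom (h : ℰ.PureConflation i.hom p.hom) (M : Bimodule E)
    (hM : ∀ N, ℰ.PureExactBelow N (barCplx (M.restrict i))) {N : ℕ} {K : Cplx C}
    (f : Hom K (hochCplx (M.restrict i))) (hf : ℰ.PureQuasiIsoBelow N f) :
    ℰ.PureQuasiIsoBelow N (f.comp (hochMap (M.restrictHom i))) := by
  let S := Stage.initial h M hM
  let a : Hom (hochCplx (M.restrict i)) S.cplx :=
    { f := fun n => 𝟙 _
      comm := fun n => by
        have := S.mono_j' n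
        refine (Category.id_comp _).trans (Eq.trans ?_ (Category.comp_id _).symm)
        exact (cancel_mono (S.j n)).1 ((S.d_j n).trans (hochschildB_naturality (M.restrictHom i) n)) }
  have ha := hf.comp_of_isIso_le f a fun n _ => inferInstanceAs (IsIso (𝟙 _))
  have := S.quasiIso_toHoch _ ha
  convert this using 1
  ext n
  exact congrArg (· ≫ ((M.restrictHom i).tensorPow n).hom) (Category.comp_id (f.f n)).symm

/-- The case of `PureQuasiIsoBelow.comp_restrictHom` where the given quasi-isomorphism starts at the
zero complex. -/
lemma pureExactBelow_hochCplx_of_restrict (h : ℰ.PureConflation i.hom p.hom) (M : Bimodule E)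
    (hM : ∀ N, ℰ.PureExactBelow N (barCplx (M.restrict i))) {N : ℕ}
    (hf : ℰ.PureExactBelow N (hochCplx (M.restrict i))) : ℰ.PureExactBelow N (hochCplx M) := by
  rw [← pureQuasiIsoBelow_zeroHom_iff] at hf ⊢
  have := PureQuasiIsoBelow.comp_restrictHom h M hM _ hf
  convert this using 1
  ext n
  exact (isZero_zero C).eq_of_src _ _

/-- The ideal `I` acts by zero on the left of `M ⊗ I`, so that the Hochschild complex of `I` with
these coefficients is the bar complex, a tensor product of `M` with the bar complex of `I`. -/
lemma pureExactBelow_hochCplx_outer (h : ℰ.PureConflation i.hom p.hom)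
    (hI : ∀ N, ℰ.PureExactBelow N (barCplx (regular I))) (M : Bimodule Q) (N : ℕ) :
    ℰ.PureExactBelow N (hochCplx ((M.restrict p).outer (ideal h.conflation.isKer))) := by
  have hid : IsIso (regularToIdeal h.conflation.isKer).hom := inferInstanceAs (IsIso (𝟙 _))
  have hid' : IsIso (AlgHom.id I).hom := inferInstanceAs (IsIso (𝟙 _))
  have hb : ∀ N, ℰ.PureExactBelow N
      (barCplx (((M.restrict p).outer (ideal h.conflation.isKer)).restrict i)) := fun N => by
    have h₁ := (hI N).of_iso (barMap (regularToIdeal h.conflation.isKer))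
      (isIso_tensorPow _)
    have h₂ := pureExactBelow_barCplx_outer ((M.restrict p).restrict i) _ h₁
    have hid'' : IsIso (outerRestrict i (M.restrict p) (ideal h.conflation.isKer)).hom :=
      inferInstanceAs (IsIso (𝟙 _))
    exact h₂.of_iso (barMap (outerRestrict i (M.restrict p) (ideal h.conflation.isKer)))
      (isIso_tensorPow _)
  have h0 : (((M.restrict p).outer (ideal h.conflation.isKer)).restrict i).left = 0 := by
    change i.hom ▷ (M.X ⊗ I.X) ≫ (α_ _ _ _).inv ≫ (p.hom ▷ M.X ≫ M.left) ▷ I.X = 0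
    rw [associator_inv_naturality_left_assoc, ← comp_whiskerRight, ← comp_whiskerRight_assoc,
      h.conflation.w]
    simp
  exact pureExactBelow_hochCplx_of_restrict h _ hb
    ((hb N).of_iso (barToHoch _ h0) fun n => inferInstanceAs (IsIso (𝟙 _)))

/-- The passage to positive degrees replaces `M` by `M.omega`. The `E`-bimodule `M.restrict p`
contributes `M ⊗ E` instead of `M ⊗ Q`, and the kernel `M ⊗ I` of the map between them has exact
Hochschild complex. -/
lemma pureQuasiIsoBelow_tail_restrictHom (h : ℰ.PureConflation i.hom p.hom)
    (hI : ∀ N, ℰ.PureExactBelow N (barCplx (regular I))) (M : Bimodule Q) (N : ℕ)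
    (hN : ℰ.PureQuasiIsoBelow N (hochMap (M.omega.restrictHom p))) :
    ℰ.PureQuasiIsoBelow N (hochMap (M.restrictHom p)).tail := by
  have h₁ := PureQuasiIsoBelow.deflation_comp (hochMap (outerToOmega h.conflation.isKer M))
    (hochMap (omegaToOmega p M)) _
    (pureConflation_tensorPow (h.whiskerLeft M.X)) (pureExactBelow_hochCplx_outer h hI M N) hN
  refine PureQuasiIsoBelow.of_iso (omegaTail _) (omegaTail _) (isIso_omegaTail _)
    (isIso_omegaTail _) (fun n => ?_) h₁
  have h₂ : omegaTailF (M.restrict p) n ≫ ((M.restrictHom p).tensorPow (n + 1)).hom =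
      (((omegaToOmega p M).tensorPow n).hom ≫ ((M.omega.restrictHom p).tensorPow n).hom) ≫
        omegaTailF M n := by
    induction n with
    | zero =>
      change 𝟙 (M.X ⊗ E.X) ≫ (𝟙 M.X ⊗ₘ p.hom) = (M.X ◁ p.hom ≫ 𝟙 _) ≫ 𝟙 _
      simp
    | succ n ih =>
      change omegaTailF (M.restrict p) n ▷ E.X ≫
          (((M.restrictHom p).tensorPow (n + 1)).hom ⊗ₘ p.hom) =
        ((((omegaToOmega p M).tensorPow n).hom ⊗ₘ 𝟙 E.X) ≫
          (((M.omega.restrictHom p).tensorPow n).hom ⊗ₘ p.hom)) ≫ omegaTailF M n ▷ Q.X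
      rw [tensorHom_comp_tensorHom, Category.id_comp, ← tensorHom_id, ← tensorHom_id,
        tensorHom_comp_tensorHom, tensorHom_comp_tensorHom, ih, Category.id_comp,
        Category.comp_id]
  change ((-1 : ℤ) ^ n • omegaTailF (M.restrict p) n) ≫
      ((M.restrictHom p).tensorPow (n + 1)).hom =
    (((omegaToOmega p M).tensorPow n).hom ≫ ((M.omega.restrictHom p).tensorPow n).hom) ≫
      ((-1 : ℤ) ^ n • omegaTailF M n)
  rw [Preadditive.comp_zsmul, ← h₂]
  exact Preadditive.zsmul_comp _ _ _

/-- If `I` is homologically unital, then the Hochschild complexes of `E` and `Q` with coefficients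
in a `Q`-bimodule are quasi-isomorphic. The map is the identity in degree `0`, and passing to
positive degrees trades one degree for the coefficients `M.omega`; hence the induction on the
bound `N`. -/
theorem pureQuasiIsoBelow_restrictHom (h : ℰ.PureConflation i.hom p.hom)
    (hI : ∀ N, ℰ.PureExactBelow N (barCplx (regular I))) (N : ℕ) (M : Bimodule Q) :
    ℰ.PureQuasiIsoBelow N (hochMap (M.restrictHom p)) := by
  induction N generalizing M with
  | zero => exact fun V => trivial
  | succ N ih =>
    exact PureQuasiIsoBelow.of_tail _ (inferInstanceAs (IsIso (𝟙 M.X)))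
      (pureQuasiIsoBelow_tail_restrictHom h hI M N (ih M.omega))

end Coefficients

/-! ### Comparison with chain complexes -/

section Comparison

set_option linter.unusedSectionVars false

open Cplx ExactStructure ZeroObject

variable {C : Type u} [Category.{v} C] [Preadditive C]

namespace Cplx

variable [HasBinaryBiproducts C]

/-- The components of `coneToCofiber`. -/
def coneToCofiberF {K L : ChainComplex C ℕ} (φ : K ⟶ L) :
    ∀ n, (cone (ofChainMap φ)).X n ⟶ (HomologicalComplex.homotopyCofiber φ).X n
  | 0 => HomologicalComplex.homotopyCofiber.inrX φ 0
  | n + 1 => biprod.desc (HomologicalComplex.homotopyCofiber.inlX φ n (n + 1) rfl)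
      (HomologicalComplex.homotopyCofiber.inrX φ (n + 1))

/-- The comparison isomorphism of the two mapping cones of a chain map. -/
def coneToCofiber {K L : ChainComplex C ℕ} (φ : K ⟶ L) :
    Hom (cone (ofChainMap φ)) (ofChain (HomologicalComplex.homotopyCofiber φ)) where
  f := coneToCofiberF φ
  comm
    | 0 => by
      have h := HomologicalComplex.homotopyCofiber.inlX_d' φ 1 0 rfl (by simp)
      change biprod.desc (HomologicalComplex.homotopyCofiber.inlX φ 0 1 rfl)
          (HomologicalComplex.homotopyCofiber.inrX φ 1) ≫
            HomologicalComplex.homotopyCofiber.d φ 1 0 =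
        biprod.desc (φ.f 0) (L.d 1 0) ≫ HomologicalComplex.homotopyCofiber.inrX φ 0
      ext
      · simpa using h
      · simp
    | n + 1 => by
      have h := HomologicalComplex.homotopyCofiber.inlX_d φ (n + 2) (n + 1) n rfl rfl
      change biprod.desc (HomologicalComplex.homotopyCofiber.inlX φ (n + 1) (n + 2) rfl)
          (HomologicalComplex.homotopyCofiber.inrX φ (n + 2)) ≫
            HomologicalComplex.homotopyCofiber.d φ (n + 2) (n + 1) =
        biprod.lift (-(biprod.fst ≫ K.d (n + 1) n)) (biprod.desc (φ.f (n + 1)) (L.d (n + 2) (n + 1))) ≫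
          biprod.desc (HomologicalComplex.homotopyCofiber.inlX φ n (n + 1) rfl)
            (HomologicalComplex.homotopyCofiber.inrX φ (n + 1))
      ext
      · simpa [biprod.lift_desc] using h
      · simp [biprod.lift_desc]

lemma isIso_coneToCofiber {K L : ChainComplex C ℕ} (φ : K ⟶ L) (n : ℕ) :
    IsIso ((coneToCofiber φ).f n) := by
  cases n with
  | zero =>
    exact ⟨HomologicalComplex.homotopyCofiber.sndX φ 0,
      HomologicalComplex.homotopyCofiber.inrX_sndX φ 0,
      HomologicalComplex.homotopyCofiber.sndX_inrX φ 0 (by simp)⟩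
  | succ n =>
    have hr : (ComplexShape.down ℕ).Rel (n + 1) n := rfl
    refine ⟨biprod.lift (HomologicalComplex.homotopyCofiber.fstX φ (n + 1) n hr)
      (HomologicalComplex.homotopyCofiber.sndX φ (n + 1)), ?_, ?_⟩
    · change biprod.desc (HomologicalComplex.homotopyCofiber.inlX φ n (n + 1) hr)
        (HomologicalComplex.homotopyCofiber.inrX φ (n + 1)) ≫ biprod.lift _ _ = 𝟙 _
      ext <;> simp
    · change biprod.lift _ _ ≫ biprod.desc (HomologicalComplex.homotopyCofiber.inlX φ n (n + 1) hr)
        (HomologicalComplex.homotopyCofiber.inrX φ (n + 1)) = 𝟙 _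
      rw [biprod.lift_desc]
      apply HomologicalComplex.homotopyCofiber.ext_to_X φ (n + 1) n hr <;> simp

/-- The map from the mapping cone of `f` induced by `g` with `g ∘ f = 0`. -/
def coneDesc {K L M : Cplx C} (f : Hom K L) (g : Hom L M) (w : ∀ n, f.f n ≫ g.f n = 0) :
    Hom (cone f) M where
  f := fun n => match n with
    | 0 => g.f 0
    | n + 1 => biprod.snd ≫ g.f (n + 1)
  comm := fun n => match n with
    | 0 => by
      change (biprod.snd ≫ g.f 1) ≫ M.d 0 = biprod.desc (f.f 0) (L.d 0) ≫ g.f 0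
      ext <;> simp [w, g.comm]
    | n + 1 => by
      change (biprod.snd ≫ g.f (n + 2)) ≫ M.d (n + 1) = biprod.lift (-(biprod.fst ≫ K.d n))
        (biprod.desc (f.f (n + 1)) (L.d (n + 1))) ≫ biprod.snd ≫ g.f (n + 1)
      ext <;> simp [w, g.comm]

end Cplx

namespace ExactStructure

variable {ℰ : ExactStructure C}

/-- The condition of `IsExact` in degrees `n ≥ 1`. -/
def ExactAt (ℰ : ExactStructure C) (X : Cplx C) (n : ℕ) : Prop :=
  ∃ (Z : C) (ι : Z ⟶ X.X (n + 1)) (π : X.X (n + 2) ⟶ Z),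
    IsKer ι (X.d n) ∧ π ≫ ι = X.d (n + 1) ∧ ℰ.IsDeflation π

lemma IsKer.of_comp_mono {X Y Z W : C} {k : X ⟶ Y} {f : Y ⟶ W} (h : IsKer k f) {e : Y ⟶ Z}
    {m : Z ⟶ W} (hm : Mono m) (w : e ≫ m = f) : IsKer k e where
  w := by rw [← cancel_mono m, Category.assoc, w, h.w, zero_comp]
  mono := h.mono
  lift x hx := h.lift x (by rw [← w, reassoc_of% hx, zero_comp])

lemma IsKer.comp_mono {X Y Z W : C} {k : X ⟶ Y} {e : Y ⟶ Z} (h : IsKer k e) {m : Z ⟶ W}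
    (hm : Mono m) : IsKer k (e ≫ m) where
  w := by rw [reassoc_of% h.w, zero_comp]
  mono := h.mono
  lift x hx := h.lift x (by rw [← cancel_mono m, Category.assoc, hx, zero_comp])

lemma resolves_of_exactAt (N : ℕ) : ∀ (Y : Cplx C) {Z W : C} (e : Y.X 0 ⟶ Z) (m : Z ⟶ W)
    (_ : Mono m) (_ : ℰ.IsDeflation e) {K : C} (ι : K ⟶ Y.X 0) (π : Y.X 1 ⟶ K)
    (_ : IsKer ι (e ≫ m)) (_ : π ≫ ι = Y.d 0) (_ : ℰ.IsDeflation π) (_ : ∀ n, ℰ.ExactAt Y n),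
    ℰ.Resolves N Y e := by
  induction N with
  | zero => intros; trivial
  | succ N ih =>
    intro Y Z W e m hm he K ι π hι hπ hπ' hY
    obtain ⟨K', ι', π', h₁, h₂, h₃⟩ := hY 0
    rw [← hπ] at h₁
    exact ⟨K, ι, π, (hι.of_comp_mono hm rfl).conflation he, hπ,
      ih Y.tail π ι hι.mono hπ' ι' π' h₁ h₂ h₃ fun n => hY (n + 1)⟩

/-- Around degree `n + 1`, the differentials of `X` factor through conflations: the image of
`X_{n+1}` in `X_n` is an admissible subobject and its kernel is an admissible quotient of
`X_{n+2}`. -/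
def Factors (ℰ : ExactStructure C) (X : Cplx C) (n : ℕ) : Prop :=
  ∃ (Z K : C) (a : X.X (n + 1) ⟶ Z) (m : Z ⟶ X.X n) (ι : K ⟶ X.X (n + 1)) (π : X.X (n + 2) ⟶ K),
    a ≫ m = X.d n ∧ ℰ.IsInflation m ∧ ℰ.Conflation ι a ∧ π ≫ ι = X.d (n + 1) ∧ ℰ.IsDeflation π

lemma IsInflation.mono {X Y : C} {i : X ⟶ Y} (h : ℰ.IsInflation i) : Mono i := by
  obtain ⟨Q, p, w, h⟩ := h
  exact Conflation.mono ⟨w, h⟩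

lemma Resolves.factors (n : ℕ) : ∀ (Y : Cplx C) {Z : C} (e : Y.X 0 ⟶ Z),
    ℰ.Resolves (n + 3) Y e → ℰ.Factors Y n := by
  induction n with
  | zero =>
    rintro Y Z e ⟨K, k, e', h₁, h₂, K', k', e'', h₁', h₂', K'', k'', e₃, h₁'', -⟩
    exact ⟨K, K', e', k, k', e'', h₂, h₁.isInflation, h₁', h₂', h₁''.isDeflation⟩
  | succ n ih =>
    rintro Y Z e ⟨K, k, e', -, -, h⟩
    exact ih Y.tail e' h

open ZeroObject in
lemma factors_of_exactBelow [HasZeroObject C] {X : Cplx C} (h : ∀ N, ℰ.ExactBelow N X) (n : ℕ) :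
    ℰ.Factors X n := by
  cases n with
  | zero =>
    obtain ⟨K, k, e, h₁, h₂, K', k', e', h₁', -⟩ := h 2
    have h₀ : ℰ.Conflation (𝟙 (X.X 0)) (0 : X.X 0 ⟶ (0 : C)) :=
      conflation_iso_zero ℰ (isZero_zero C) (𝟙 _) 0
    exact ⟨X.X 0, K, X.d 0, 𝟙 _, k, e, Category.comp_id _, h₀.isInflation, h₁, h₂,
      h₁'.isDeflation⟩
  | succ n => exact Resolves.factors n _ _ (h (n + 3))

lemma isExact_iff_exactBelow [HasZeroObject C] (K : ChainComplex C ℕ) :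
    ℰ.IsExact K ↔ ∀ N, ℰ.ExactBelow N (ofChain K) := by
  have h0 : K.d 0 (0 - 1) = 0 := K.shape _ _ (by simp)
  constructor
  · intro h N
    have hK : ∀ n, ℰ.ExactAt (ofChain K) n := fun n => by
      obtain ⟨Z, ι, w, ⟨hι⟩, π, hπ, hπ'⟩ := h (n + 1)
      exact ⟨Z, ι, π, .of_isLimit hι, hπ, hπ'⟩
    obtain ⟨Z, ι, w, ⟨hι⟩, π, hπ, hπ'⟩ := h 0
    have hι := IsKer.of_isLimit hι
    have hm := hι.mono
    obtain ⟨s, hs⟩ := hι.lift (𝟙 _) (by rw [h0, comp_zero])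
    have : IsIso ι := ⟨s, by rw [← cancel_mono ι, Category.assoc, hs]; simp, hs⟩
    have hd : ℰ.IsDeflation ((ofChain K).d 0) := by
      change ℰ.IsDeflation (K.d (0 + 1) 0)
      rw [← hπ]
      exact hπ'.comp (isDeflation_of_isIso ℰ ι)
    obtain ⟨Z', ι', π', h₁, h₂, h₃⟩ := hK 0
    have h₁ : IsKer ι' ((ofChain K).d 0 ≫ 𝟙 _) := by rwa [Category.comp_id]
    exact resolves_of_exactAt N (ofChain K).tail ((ofChain K).d 0) (𝟙 _) inferInstance hd ι' π'
      h₁ h₂ h₃ fun n => hK (n + 1)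
  · intro h n
    cases n with
    | zero =>
      obtain ⟨K₁, k₁, e₁, h₁, -⟩ := h 1
      refine ⟨K.X 0, 𝟙 _, by rw [h0, comp_zero], ?_, K.d 1 0, Category.comp_id _, h₁.isDeflation⟩
      exact IsKer.isLimit ⟨by rw [h0, comp_zero], inferInstance, fun x _ => ⟨x, Category.comp_id x⟩⟩
    | succ n =>
      obtain ⟨Z, Z', a, m, ι, π, h₁, h₂, h₃, h₄, h₅⟩ := factors_of_exactBelow h n
      have hι : IsKer ι ((ofChain K).d n) := by
        rw [← h₁]
        have := h₂.mono
        exact h₃.isKer.comp_mono h₂.mono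
      exact ⟨Z', ι, hι.w, hι.isLimit, π, h₄, h₅⟩

end ExactStructure

end Comparison

/-! ### Excision for Hochschild complexes -/

section Excision

set_option linter.unusedSectionVars false

open Cplx ExactStructure ZeroObject Bimodule

variable {C : Type u} [Category.{v} C] [Preadditive C] [MonoidalCategory C]
  [MonoidalPreadditive C]

/-- The composite of two bimodule maps. -/
def BimoduleHom.comp {A B D : Alg C} {f : AlgHom A B} {g : AlgHom B D} {M : Bimodule A}
    {N : Bimodule B} {P : Bimodule D} (φ : BimoduleHom f M N) (ψ : BimoduleHom g N P)
    (h : AlgHom A D) (hfg : f.hom ≫ g.hom = h.hom) : BimoduleHom h M P where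
  hom := φ.hom ≫ ψ.hom
  map_left := by
    rw [reassoc_of% φ.map_left, ψ.map_left, tensorHom_comp_tensorHom_assoc, hfg]
  map_right := by
    rw [reassoc_of% φ.map_right, ψ.map_right, tensorHom_comp_tensorHom_assoc, hfg]

lemma BimoduleHom.tensorPow_comp {A B D : Alg C} {f : AlgHom A B} {g : AlgHom B D}
    {h : AlgHom A D} {M : Bimodule A} {N : Bimodule B} {P : Bimodule D} (φ : BimoduleHom f M N)
    (ψ : BimoduleHom g N P) (χ : BimoduleHom h M P) (hfg : f.hom ≫ g.hom = h.hom)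
    (hφψ : φ.hom ≫ ψ.hom = χ.hom) (n : ℕ) :
    (φ.tensorPow n).hom ≫ (ψ.tensorPow n).hom = (χ.tensorPow n).hom := by
  induction n with
  | zero => exact hφψ
  | succ n ih =>
    change ((φ.tensorPow n).hom ⊗ₘ f.hom) ≫ ((ψ.tensorPow n).hom ⊗ₘ g.hom) =
      ((χ.tensorPow n).hom ⊗ₘ h.hom)
    rw [tensorHom_comp_tensorHom, ih, hfg]

namespace ExactStructure

variable {ℰ : ExactStructure C} [HasBinaryBiproducts C]

/-- `(X ⊞ Y) ⊗ V ≅ X ⊗ V ⊞ Y ⊗ V`. -/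
def biprodTensor (X Y V : C) : (X ⊞ Y) ⊗ V ≅ X ⊗ V ⊞ Y ⊗ V where
  hom := biprod.lift (biprod.fst ▷ V) (biprod.snd ▷ V)
  inv := biprod.desc (biprod.inl ▷ V) (biprod.inr ▷ V)
  hom_inv_id := by
    rw [biprod.lift_desc, ← comp_whiskerRight, ← comp_whiskerRight,
      ← MonoidalPreadditive.add_whiskerRight, biprod.total, id_whiskerRight]
  inv_hom_id := by
    ext <;> simp [← comp_whiskerRight]

variable [HasZeroObject C]

lemma PureConflation.biprod_map_id {X Y Z W : C} {i : X ⟶ Y} {p : Y ⟶ Z}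
    (h : ℰ.PureConflation i p) :
    ℰ.PureConflation (biprod.map (𝟙 W) i) (biprod.snd ≫ p) := fun V =>
  ((h V).biprod_map_id (W := W ⊗ V)).of_iso (biprodTensor W X V).symm (biprodTensor W Y V).symm
    (Iso.refl _)
    (by
      ext <;> simp [biprodTensor, ← comp_whiskerRight])
    (by ext <;> simp [biprodTensor, ← comp_whiskerRight])

lemma PureConflation.biprod_id_map {X Y Z W : C} {i : X ⟶ Y} {p : Y ⟶ Z}
    (h : ℰ.PureConflation i p) :
    ℰ.PureConflation (biprod.map i (𝟙 W)) (biprod.fst ≫ p) :=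
  (h.biprod_map_id (W := W)).of_iso (biprod.braiding _ _) (biprod.braiding _ _) (Iso.refl _)
    (by ext <;> simp) (by simp)

lemma PureConflation.biprod_inl {X Y Z W : C} {i : X ⟶ Y} {p : Y ⟶ Z}
    (h : ℰ.PureConflation i p) :
    ℰ.PureConflation (i ≫ biprod.inl) (biprod.map p (𝟙 W)) := fun V =>
  ((h V).biprod_inl (W := W ⊗ V)).of_iso (Iso.refl _) (biprodTensor Y W V).symm
    (biprodTensor Z W V).symm (by simp [biprodTensor])
    (by ext <;> simp [biprodTensor, ← comp_whiskerRight])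

lemma PureExactBelow.neg {N : ℕ} {X : Cplx C} (h : ℰ.PureExactBelow N X) :
    ℰ.PureExactBelow N X.neg :=
  h.of_iso X.toNeg X.isIso_toNeg

lemma PureQuasiIsoBelow.of_inflation_comp {N : ℕ} {X Y W H : Cplx C} (f : Hom X Y) (g : Hom Y W)
    (q : Hom Y H) (h : ∀ n, ℰ.PureConflation (f.f n) (q.f n)) (hH : ℰ.PureExactBelow N H)
    (hf : ℰ.PureQuasiIsoBelow N (f.comp g)) : ℰ.PureQuasiIsoBelow N g := fun V =>
  QuasiIsoBelow.of_inflation_comp (f.tensor V) (g.tensor V) (q.tensor V) (fun n => h n V) (hH V)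
    (by rw [← Hom.comp_tensor]; exact hf V)

/-- `cone (f ⊗ V) ≅ cone f ⊗ V`. -/
def coneTensor {K L : Cplx C} (f : Hom K L) (V : C) : Hom ((cone f).tensor V) (cone (f.tensor V)) where
  f := fun n => match n with
    | 0 => 𝟙 _
    | n + 1 => (biprodTensor (K.X n) (L.X (n + 1)) V).hom
  comm := fun n => match n with
    | 0 => by
      change biprod.lift (biprod.fst ▷ V) (biprod.snd ▷ V) ≫ biprod.desc (f.f 0 ▷ V) (L.d 0 ▷ V) =
        biprod.desc (f.f 0) (L.d 0) ▷ V ≫ 𝟙 _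
      rw [biprod.lift_desc, ← comp_whiskerRight, ← comp_whiskerRight,
        ← MonoidalPreadditive.add_whiskerRight, Category.comp_id]
      congr 1
      ext <;> simp
    | n + 1 => by
      change biprod.lift (biprod.fst ▷ V) (biprod.snd ▷ V) ≫ biprod.lift (-(biprod.fst ≫ K.d n ▷ V))
          (biprod.desc (f.f (n + 1) ▷ V) (L.d (n + 1) ▷ V)) =
        biprod.lift (-(biprod.fst ≫ K.d n)) (biprod.desc (f.f (n + 1)) (L.d (n + 1))) ▷ V ≫
          biprod.lift (biprod.fst ▷ V) (biprod.snd ▷ V)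
      ext
      · have : (-(biprod.fst ≫ K.d n) : K.X (n + 1) ⊞ L.X (n + 2) ⟶ K.X n) ▷ V =
            -((biprod.fst ≫ K.d n) ▷ V) := (tensorRight V).map_neg
        simp [← comp_whiskerRight, this]
      · simp only [Category.assoc, biprod.lift_snd, biprod.lift_desc, ← comp_whiskerRight,
          ← MonoidalPreadditive.add_whiskerRight]
        congr 1
        ext <;> simp

lemma isIso_coneTensor {K L : Cplx C} (f : Hom K L) (V : C) (n : ℕ) :
    IsIso ((coneTensor f V).f n) := by
  cases n with
  | zero => exact inferInstanceAs (IsIso (𝟙 _))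
  | succ n => exact inferInstanceAs (IsIso (biprodTensor (K.X n) (L.X (n + 1)) V).hom)

/-- The inverse of a chain map that is an isomorphism in each degree. -/
def _root_.HochschildExcision.Cplx.Hom.inverse {K L : Cplx C} (f : Hom K L)
    (h : ∀ n, IsIso (f.f n)) : Hom L K where
  f n := inv (f.f n)
  comm n := by rw [IsIso.inv_comp_eq, ← Category.assoc, IsIso.eq_comp_inv, f.comm]

lemma PureQuasiIsoBelow.pureExactBelow_cone {N : ℕ} {K L : Cplx C} {f : Hom K L}
    (h : ℰ.PureQuasiIsoBelow N f) : ℰ.PureExactBelow N (cone f) := fun V =>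
  ExactBelow.of_iso ((coneTensor f V).inverse (isIso_coneTensor f V))
    (fun n => inferInstanceAs (IsIso (@inv _ _ _ _ _ (isIso_coneTensor f V n)))) (h V)

lemma PureQuasiIsoBelow.mono {N M : ℕ} (h : N ≤ M) {X Y : Cplx C} {f : Hom X Y}
    (hf : ℰ.PureQuasiIsoBelow M f) : ℰ.PureQuasiIsoBelow N f := fun V => ExactBelow.mono h (hf V)

end ExactStructure

variable [SymmetricCategory C] {A B : Alg C}

/-- The Hochschild complex `(M ⊗ A^{⊗n}, b)` with the object in degree `0` replaced by `Y` along
a map `M ⟶ Y`. -/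
def augCplx (M : Bimodule A) {Y : C} (y : M.X ⟶ Y) : Cplx C :=
  cons Y (hochCplx M).tail (hochschildB M 0 ≫ y)
    ((Category.assoc _ _ _).symm.trans ((congrArg (· ≫ y) (hochschildB_sq M 0)).trans zero_comp))

/-- The chain map between two complexes `augCplx` induced by a bimodule map. -/
def augMap {f : AlgHom A B} {M : Bimodule A} {N : Bimodule B} (φ : BimoduleHom f M N) {Y Z : C}
    (y : M.X ⟶ Y) (z : N.X ⟶ Z) (t : Y ⟶ Z) (h : φ.hom ≫ z = y ≫ t) :
    Hom (augCplx M y) (augCplx N z) where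
  f := fun n => match n with
    | 0 => t
    | n + 1 => (φ.tensorPow (n + 1)).hom
  comm := fun n => match n with
    | 0 => comp_square_aux (hochschildB_naturality φ 0) h
    | n + 1 => hochschildB_naturality φ (n + 1)

/-- The complex `augCplx M (𝟙 _)` is the Hochschild complex. -/
def hochToAug (M : Bimodule A) : Hom (hochCplx M) (augCplx M (𝟙 M.X)) where
  f := fun n => match n with
    | 0 => 𝟙 _
    | n + 1 => 𝟙 _
  comm := fun n => match n with
    | 0 => by
      change 𝟙 (M.X ⊗ A.X) ≫ hochschildB M 0 ≫ 𝟙 M.X = hochschildB M 0 ≫ 𝟙 M.X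
      exact Category.id_comp _
    | n + 1 => (Category.id_comp _).trans (Category.comp_id _).symm

lemma isIso_hochToAug (M : Bimodule A) (n : ℕ) : IsIso ((hochToAug M).f n) := by
  cases n <;> exact inferInstanceAs (IsIso (𝟙 _))

/-- The map `φ ⊗ id : M ⊗ A^{⊗n} ⟶ N ⊗ A^{⊗n}`. -/
def rightPow {M N : Bimodule A} (φ : M.X ⟶ N.X) : ∀ n, (M.tensorPow n).X ⟶ (N.tensorPow n).X
  | 0 => φ
  | n + 1 => rightPow φ n ▷ A.X

/-- The bar complex is functorial for maps that are only compatible with the right actions. -/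
def barMapRight {M N : Bimodule A} (φ : M.X ⟶ N.X) (h : φ ▷ A.X ≫ N.right = M.right ≫ φ) :
    Hom (barCplx M) (barCplx N) where
  f := rightPow φ
  comm n := by
    induction n with
    | zero => exact h
    | succ n ih =>
      have h₁ : rightPow φ n ▷ A.X ▷ A.X ≫ bPrime N n ▷ A.X =
          bPrime M n ▷ A.X ≫ rightPow φ n ▷ A.X := by
        rw [← comp_whiskerRight, ← comp_whiskerRight]
        exact congrArg (· ▷ A.X) ih
      have h₂ : rightPow φ n ▷ A.X ▷ A.X ≫ N.mulLast n = M.mulLast n ≫ rightPow φ n ▷ A.X := by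
        rw [mulLast, mulLast, associator_naturality_left_assoc, ← whisker_exchange, Category.assoc]
      change rightPow φ n ▷ A.X ▷ A.X ≫ (bPrime N n ▷ A.X + (-1 : ℤ) ^ (n + 1) • N.mulLast n) =
        (bPrime M n ▷ A.X + (-1 : ℤ) ^ (n + 1) • M.mulLast n) ≫ rightPow φ n ▷ A.X
      rw [Preadditive.comp_add, Preadditive.comp_zsmul, h₁, h₂, Preadditive.add_comp,
        Preadditive.zsmul_comp]

lemma isIso_rightPow {M N : Bimodule A} (φ : M.X ⟶ N.X) (hφ : IsIso φ) (n : ℕ) :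
    IsIso (rightPow φ n) := by
  induction n with
  | zero => assumption
  | succ n ih => exact inferInstanceAs (IsIso (rightPow φ n ▷ A.X))

variable [HasZeroObject C] [HasBinaryBiproducts C] {ℰ : ExactStructure C}

/-- For a homologically unital algebra, the Hochschild complex with coefficients in the trivial
bimodule is exact in positive degrees: there it is the bar complex. -/
lemma pureExactBelow_augCplx_trivial (hA : ∀ N, ℰ.PureExactBelow N (barCplx (regular A))) (N : ℕ) :
    ℰ.PureExactBelow N (augCplx (trivial A) (0 : 𝟙_ C ⟶ (0 : C))) := by
  have hl : (trivial A).omega.left = 0 := by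
    change (α_ A.X (𝟙_ C) A.X).inv ≫ (0 : A.X ⊗ 𝟙_ C ⟶ 𝟙_ C) ▷ A.X = 0
    simp
  have hφ : (λ_ A.X).inv ▷ A.X ≫ (trivial A).omega.right = A.mul ≫ (λ_ A.X).inv := by
    change (λ_ A.X).inv ▷ A.X ≫ ((α_ (𝟙_ C) A.X A.X).hom ≫ 𝟙_ C ◁ A.mul -
      (0 : 𝟙_ C ⊗ A.X ⟶ 𝟙_ C) ▷ A.X) = A.mul ≫ (λ_ A.X).inv
    simp
  have h₁ := (hA N).of_iso (barMapRight (M := regular A) (N := (trivial A).omega) (λ_ A.X).inv hφ)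
    (isIso_rightPow (M := regular A) (N := (trivial A).omega) (λ_ A.X).inv
      (inferInstanceAs (IsIso (λ_ A.X).inv)))
  have h₂ := h₁.of_iso (barToHoch _ hl) fun n => inferInstanceAs (IsIso (𝟙 _))
  have h₃ := h₂.of_iso (omegaTail _) (isIso_omegaTail _)
  exact (h₃.cons (isZero_zero C) _ _).mono (Nat.le_succ N)

/-- The Hochschild complex of an algebra. -/
abbrev hochAlg (A : Alg C) : Cplx C :=
  augCplx (adjoinUnit A) (biprod.fst : A.X ⊞ 𝟙_ C ⟶ A.X)

/-- The map of Hochschild complexes induced by an algebra homomorphism. -/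
abbrev hochAlgMap (f : AlgHom A B) : Hom (hochAlg A) (hochAlg B) :=
  augMap (adjoinUnitMap f) _ _ f.hom (biprod.map_fst _ _)

/-- The inclusion of `A` into `A⁺`. -/
def toAdjoinUnit (A : Alg C) : BimoduleHom (AlgHom.id A) (regular A) (adjoinUnit A) :=
  BimoduleHom.ofId (biprod.inl : A.X ⟶ A.X ⊞ 𝟙_ C)
    (by
      change A.mul ≫ biprod.inl = A.X ◁ biprod.inl ≫
        (A.X ◁ biprod.fst ≫ A.mul + A.X ◁ biprod.snd ≫ (ρ_ A.X).hom) ≫ biprod.inl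
      simp [← whiskerLeft_comp_assoc])
    (by
      change A.mul ≫ biprod.inl = biprod.inl ▷ A.X ≫
        (biprod.fst ▷ A.X ≫ A.mul + biprod.snd ▷ A.X ≫ (λ_ A.X).hom) ≫ biprod.inl
      simp [← comp_whiskerRight_assoc])

/-- The augmentation of `A⁺`. -/
def adjoinUnitToTrivial (A : Alg C) : BimoduleHom (AlgHom.id A) (adjoinUnit A) (trivial A) :=
  BimoduleHom.ofId (biprod.snd : A.X ⊞ 𝟙_ C ⟶ 𝟙_ C)
    (by
      change ((A.X ◁ biprod.fst ≫ A.mul + A.X ◁ biprod.snd ≫ (ρ_ A.X).hom) ≫ biprod.inl) ≫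
        biprod.snd = A.X ◁ biprod.snd ≫ 0
      simp)
    (by
      change ((biprod.fst ▷ A.X ≫ A.mul + biprod.snd ▷ A.X ≫ (λ_ A.X).hom) ≫ biprod.inl) ≫
        biprod.snd = biprod.snd ▷ A.X ≫ 0
      simp)

variable {I E Q : Alg C} {i : AlgHom I E} {p : AlgHom E Q}

/-- The inclusion of an ideal `I` of `E` into `E⁺`. -/
def idealToAdjoinUnit (h : IsKer i.hom p.hom) :
    BimoduleHom (AlgHom.id E) (ideal h) (adjoinUnit E) :=
  BimoduleHom.ofId (i.hom ≫ biprod.inl : I.X ⟶ E.X ⊞ 𝟙_ C)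
    (by
      change idealLeft h ≫ i.hom ≫ biprod.inl = E.X ◁ (i.hom ≫ biprod.inl) ≫
        (E.X ◁ biprod.fst ≫ E.mul + E.X ◁ biprod.snd ≫ (ρ_ E.X).hom) ≫ biprod.inl
      rw [reassoc_of% idealLeft_comp h]
      simp [← whiskerLeft_comp_assoc])
    (by
      change idealRight h ≫ i.hom ≫ biprod.inl = (i.hom ≫ biprod.inl) ▷ E.X ≫
        (biprod.fst ▷ E.X ≫ E.mul + biprod.snd ▷ E.X ≫ (λ_ E.X).hom) ≫ biprod.inl
      rw [reassoc_of% idealRight_comp h]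
      simp [← comp_whiskerRight_assoc])

/-- A bimodule map over `f` as a bimodule map to the restriction along `f`. -/
def BimoduleHom.toRestrict {f : AlgHom A B} {M : Bimodule A} {N : Bimodule B}
    (φ : BimoduleHom f M N) : BimoduleHom (AlgHom.id A) M (N.restrict f) :=
  BimoduleHom.ofId (N := N.restrict f) φ.hom
    (φ.map_left.trans (by
      change (f.hom ⊗ₘ φ.hom) ≫ N.left = A.X ◁ φ.hom ≫ f.hom ▷ N.X ≫ N.left
      rw [MonoidalCategory.tensorHom_def', Category.assoc]))
    (φ.map_right.trans (by
      change (φ.hom ⊗ₘ f.hom) ≫ N.right = φ.hom ▷ A.X ≫ N.X ◁ f.hom ≫ N.right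
      rw [MonoidalCategory.tensorHom_def, Category.assoc]))

lemma pureConflation_toAdjoinUnit (A : Alg C) :
    ℰ.PureConflation (toAdjoinUnit A).hom (adjoinUnitToTrivial A).hom := by
  have h : ℰ.PureConflation (0 : (0 : C) ⟶ 𝟙_ C) (𝟙 (𝟙_ C)) := fun V =>
    conflation_zero_iso ℰ (isZero_tensor (isZero_zero C) V) _ _
  let e : A.X ⊞ (0 : C) ≅ A.X :=
    ⟨biprod.fst, biprod.inl, by ext; first | exact (isZero_zero C).eq_of_tgt _ _ | simp,
      by simp⟩
  exact (h.biprod_map_id (W := A.X)).of_iso e (Iso.refl _) (Iso.refl _)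
    (by
      change biprod.map (𝟙 A.X) 0 ≫ 𝟙 (A.X ⊞ 𝟙_ C) = biprod.fst ≫ biprod.inl
      ext <;> simp)
    (by
      change (biprod.snd ≫ 𝟙 (𝟙_ C)) ≫ 𝟙 (𝟙_ C) = 𝟙 (A.X ⊞ 𝟙_ C) ≫ biprod.snd
      simp)

lemma pureConflation_idealToAdjoinUnit (h : ℰ.PureConflation i.hom p.hom) :
    ℰ.PureConflation (idealToAdjoinUnit h.conflation.isKer).hom
      (adjoinUnitMap p).toRestrict.hom :=
  h.biprod_inl

lemma hochAlgMap_comp_eq_zero (w : i.hom ≫ p.hom = 0) (n : ℕ) :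
    (hochAlgMap i).f n ≫ (hochAlgMap p).f n = 0 := by
  cases n with
  | zero => exact w
  | succ n =>
    change (((adjoinUnitMap i).tensorPow n).hom ⊗ₘ i.hom) ≫
      (((adjoinUnitMap p).tensorPow n).hom ⊗ₘ p.hom) = 0
    rw [tensorHom_comp_tensorHom, w]
    simp

/-- Excision for the Hochschild complexes. The complex of `I` is replaced by the one with
coefficients in `I` instead of `I⁺`, which changes it by an exact quotient, and the complex of `Q`
by that of `E` with coefficients in `Q⁺`. The sequence that results has the kernel of its second
map equal to the complex of `E` with coefficients in `I`. -/
theorem pureQuasiIsoBelow_coneDesc (h : ℰ.PureConflation i.hom p.hom)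
    (hI : ∀ N, ℰ.PureExactBelow N (barCplx (regular I))) (N : ℕ) :
    ℰ.PureQuasiIsoBelow N (coneDesc (hochAlgMap i) (hochAlgMap p)
      (hochAlgMap_comp_eq_zero h.conflation.w)) := by
  have hk := h.conflation.isKer
  -- the inclusion of the Hochschild complex of `I` with coefficients in `I`, and its cokernel
  let a : Hom (augCplx (regular I) (𝟙 I.X)) (hochAlg I) :=
    augMap (toAdjoinUnit I) (𝟙 I.X) biprod.fst (𝟙 I.X)
      ((biprod.inl_fst : (biprod.inl : I.X ⟶ I.X ⊞ 𝟙_ C) ≫ biprod.fst = 𝟙 _).trans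
        (Category.comp_id _).symm)
  let q : Hom (hochAlg I) (augCplx (trivial I) (0 : 𝟙_ C ⟶ (0 : C))) :=
    augMap (adjoinUnitToTrivial I) biprod.fst 0 0 (comp_zero.trans comp_zero.symm)
  have haq : ∀ n, ℰ.PureConflation (a.f n) (q.f n) := fun n => match n with
    | 0 => PureConflation.iso_zero ℰ (isZero_zero C) (𝟙 I.X) (0 : I.X ⟶ (0 : C))
    | n + 1 => pureConflation_tensorPow (pureConflation_toAdjoinUnit I) (n + 1)
  -- the map `r` to the complex of `E` with coefficients in `Q⁺`, and its kernel `k`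
  let φ : BimoduleHom i (regular I) (ideal hk) :=
    (regularToIdeal hk).comp ((ideal hk).restrictHom i) i (Category.id_comp _)
  let c : Hom (augCplx (regular I) (𝟙 I.X)) (augCplx (ideal hk) (𝟙 I.X)) :=
    augMap φ (𝟙 I.X) (𝟙 I.X) (𝟙 I.X) (by
      change (𝟙 I.X ≫ 𝟙 I.X) ≫ 𝟙 I.X = 𝟙 I.X ≫ 𝟙 I.X
      simp)
  let k : Hom (augCplx (ideal hk) (𝟙 I.X)) (hochAlg E) :=
    augMap (idealToAdjoinUnit hk) (𝟙 I.X) biprod.fst i.hom (by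
      change (i.hom ≫ biprod.inl) ≫ biprod.fst = 𝟙 I.X ≫ i.hom
      simp)
  let r : Hom (hochAlg E) (augCplx ((adjoinUnit Q).restrict p) (biprod.fst : Q.X ⊞ 𝟙_ C ⟶ Q.X)) :=
    augMap (adjoinUnitMap p).toRestrict biprod.fst biprod.fst p.hom (biprod.map_fst _ _)
  let s : Hom (augCplx ((adjoinUnit Q).restrict p) (biprod.fst : Q.X ⊞ 𝟙_ C ⟶ Q.X)) (hochAlg Q) :=
    augMap ((adjoinUnit Q).restrictHom p) biprod.fst biprod.fst (𝟙 Q.X)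
      ((Category.id_comp _).trans (Category.comp_id _).symm)
  have hkr : ∀ n, ℰ.PureConflation (k.f n) (r.f n) := fun n => match n with
    | 0 => h
    | n + 1 => pureConflation_tensorPow (pureConflation_idealToAdjoinUnit h) (n + 1)
  have hs : ℰ.PureQuasiIsoBelow N s :=
    (PureQuasiIsoBelow.of_tail s (inferInstanceAs (IsIso (𝟙 Q.X)))
      (pureQuasiIsoBelow_tail_restrictHom h hI (adjoinUnit Q) N
        (pureQuasiIsoBelow_restrictHom h hI N (adjoinUnit Q).omega))).mono (Nat.le_succ N)
  have hc : ℰ.PureQuasiIsoBelow N c := by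
    have hid : IsIso (regularToIdeal hk).hom := inferInstanceAs (IsIso (𝟙 _))
    have hid' : IsIso (AlgHom.id I).hom := inferInstanceAs (IsIso (𝟙 _))
    have := PureQuasiIsoBelow.comp_restrictHom h (ideal hk)
      (fun N => (hI N).of_iso (barMap (regularToIdeal hk)) (isIso_tensorPow _)) _
      (PureQuasiIsoBelow.of_isIso N (hochMap (regularToIdeal hk)) (isIso_tensorPow _))
    refine this.of_iso (hochToAug _) (hochToAug _) (isIso_hochToAug _) (isIso_hochToAug _)
      fun n => ?_
    cases n with
    | zero =>
      change 𝟙 I.X ≫ 𝟙 I.X = (𝟙 I.X ≫ 𝟙 I.X) ≫ 𝟙 I.X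
      simp
    | succ n =>
      exact (Category.id_comp _).trans ((BimoduleHom.tensorPow_comp (regularToIdeal hk)
        ((ideal hk).restrictHom i) φ (Category.id_comp _) rfl (n + 1)).symm.trans
          (Category.comp_id _).symm)
  have hack : ∀ n, a.f n ≫ (hochAlgMap i).f n = c.f n ≫ k.f n := fun n => match n with
    | 0 => rfl
    | n + 1 =>
      (BimoduleHom.tensorPow_comp (toAdjoinUnit I) (adjoinUnitMap i)
        ((toAdjoinUnit I).comp (adjoinUnitMap i) i (Category.id_comp _)) (Category.id_comp _)
          rfl (n + 1)).trans
      (BimoduleHom.tensorPow_comp φ (idealToAdjoinUnit hk)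
        ((toAdjoinUnit I).comp (adjoinUnitMap i) i (Category.id_comp _)) (Category.comp_id _) (by
          change (𝟙 I.X ≫ 𝟙 I.X) ≫ i.hom ≫ biprod.inl = biprod.inl ≫ biprod.map i.hom (𝟙 _)
          simp) (n + 1)).symm
  have hrs : ∀ n, r.f n ≫ s.f n = (hochAlgMap p).f n := fun n => match n with
    | 0 => Category.comp_id _
    | n + 1 => BimoduleHom.tensorPow_comp _ _ _ (Category.id_comp _) (Category.comp_id _) (n + 1)
  have hair : ∀ n, (a.comp (hochAlgMap i)).f n ≫ r.f n = 0 := fun n => by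
    change (a.f n ≫ (hochAlgMap i).f n) ≫ r.f n = 0
    rw [hack, Category.assoc, (hkr n).conflation.w, comp_zero]
  have hair' : ∀ n, (a.comp (hochAlgMap i)).f n ≫ (hochAlgMap p).f n = 0 := fun n => by
    rw [← hrs, reassoc_of% hair, zero_comp]
  have h₁ : ℰ.PureQuasiIsoBelow N (coneDesc (a.comp (hochAlgMap i)) (hochAlgMap p) hair') := by
    have := PureQuasiIsoBelow.deflation_comp
      (coneMap c (a.comp (hochAlgMap i)) (Hom.id _) k fun n => (Category.id_comp _).trans (hack n))
      (coneDesc (a.comp (hochAlgMap i)) r hair) s (fun n => match n with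
        | 0 => hkr 0
        | n + 1 => (hkr (n + 1)).biprod_map_id) hc.pureExactBelow_cone hs
    convert this using 1
    ext n
    cases n with
    | zero => exact (hrs 0).symm
    | succ n =>
      exact (congrArg (biprod.snd ≫ ·) (hrs (n + 1)).symm).trans (Category.assoc _ _ _).symm
  -- replacing `I` by `I⁺` changes the mapping cone by an exact quotient
  let b : Hom (cone (a.comp (hochAlgMap i))) (cone (hochAlgMap i)) :=
    coneMap _ _ a (Hom.id _) fun n => (Category.comp_id _).symm
  let q' : Hom (cone (hochAlgMap i))
      (Cplx.cons (0 : C) (augCplx (trivial I) (0 : 𝟙_ C ⟶ (0 : C))).neg 0 comp_zero) :=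
    { f := fun n => match n with
        | 0 => 0
        | n + 1 => biprod.fst ≫ q.f n
      comm := fun n => match n with
        | 0 => comp_zero.trans comp_zero.symm
        | n + 1 => by
          change (biprod.fst ≫ q.f (n + 1)) ≫
              (-(augCplx (trivial I) (0 : 𝟙_ C ⟶ (0 : C))).d n) =
            biprod.lift (-(biprod.fst ≫ (hochAlg I).d n)) (biprod.desc ((hochAlgMap i).f (n + 1))
              ((hochAlg E).d (n + 1))) ≫ biprod.fst ≫ q.f n
          ext <;> simp [q.comm] }
  refine PureQuasiIsoBelow.of_inflation_comp b _ q' (fun n => match n with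
    | 0 => PureConflation.iso_zero ℰ (isZero_zero C) (𝟙 E.X) (0 : E.X ⟶ (0 : C))
    | n + 1 => (haq n).biprod_id_map)
    (((pureExactBelow_augCplx_trivial hI N).neg.cons (isZero_zero C) _ _).mono (Nat.le_succ N)) ?_
  convert h₁ using 1
  ext n
  cases n with
  | zero => exact Category.id_comp _
  | succ n =>
    change biprod.map (a.f n) (𝟙 _) ≫ biprod.snd ≫ (hochAlgMap p).f (n + 1) =
      biprod.snd ≫ (hochAlgMap p).f (n + 1)
    simp

/-- The comparison of `hochAlg` with the chain complex `hochschild`. -/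
def hochAlgToOfChain (A : Alg C) : Hom (hochAlg A) (ofChain (hochschild A)) where
  f := fun n => match n with
    | 0 => 𝟙 A.X
    | n + 1 => 𝟙 _
  comm := fun n => match n with
    | 0 => by
      have h : (hochschild A).d 1 0 = hochschildD A 0 :=
        ChainComplex.of_d (hochschildX A) (hochschildD A) 0
      exact (Category.id_comp _).trans (h.trans (Category.comp_id _).symm)
    | n + 1 => by
      have h : (hochschild A).d (n + 2) (n + 1) = hochschildD A (n + 1) :=
        ChainComplex.of_d (hochschildX A) (hochschildD A) (n + 1)
      exact (Category.id_comp _).trans (h.trans (Category.comp_id _).symm)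

lemma isIso_hochAlgToOfChain (A : Alg C) (n : ℕ) : IsIso ((hochAlgToOfChain A).f n) := by
  cases n <;> exact inferInstanceAs (IsIso (𝟙 _))

lemma hochAlgToOfChain_naturality (f : AlgHom A B) (n : ℕ) :
    (hochAlgToOfChain A).f n ≫ (ofChainMap (hochschildMap f)).f n =
      (hochAlgMap f).f n ≫ (hochAlgToOfChain B).f n := by
  cases n <;> exact (Category.id_comp _).trans (Category.comp_id _).symm

lemma hochschildMap_comp_eq_zero (w : i.hom ≫ p.hom = 0) :
    hochschildMap i ≫ hochschildMap p = 0 := by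
  ext n
  cases n with
  | zero => exact w
  | succ n => exact hochAlgMap_comp_eq_zero w (n + 1)

/-- Excision for the Hochschild complexes as chain complexes: the truncations of the mapping cone
are exact. -/
lemma pureQuasiIsoBelow_ofChain (h : ℰ.PureConflation i.hom p.hom)
    (hI : ∀ N, ℰ.PureExactBelow N (barCplx (regular I))) (N : ℕ) :
    ℰ.PureQuasiIsoBelow N (coneDesc (ofChainMap (hochschildMap i)) (ofChainMap (hochschildMap p))
      fun n => congrArg (fun t => HomologicalComplex.Hom.f t n)
        (hochschildMap_comp_eq_zero h.conflation.w)) := by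
  refine (pureQuasiIsoBelow_coneDesc h hI N).of_iso
    (coneMap (hochAlgMap i) (ofChainMap (hochschildMap i)) (hochAlgToOfChain I)
      (hochAlgToOfChain E) (hochAlgToOfChain_naturality i)) (hochAlgToOfChain Q)
    (fun n => isIso_coneMapF _ _ (fun m _ => isIso_hochAlgToOfChain I m)
      (isIso_hochAlgToOfChain E n)) (isIso_hochAlgToOfChain Q) fun n => ?_
  cases n with
  | zero => exact hochAlgToOfChain_naturality p 0
  | succ n =>
    have := hochAlgToOfChain_naturality p (n + 1)
    change biprod.map ((hochAlgToOfChain I).f n) ((hochAlgToOfChain E).f (n + 1)) ≫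
        biprod.snd ≫ (ofChainMap (hochschildMap p)).f (n + 1) =
      (biprod.snd ≫ (hochAlgMap p).f (n + 1)) ≫ (hochAlgToOfChain Q).f (n + 1)
    rw [Category.assoc, ← this, biprod.map_snd_assoc]

lemma QuasiIsoBelow.exactBelow_homotopyCofiber {K L : ChainComplex C ℕ} {φ : K ⟶ L} {N : ℕ}
    (h : ℰ.QuasiIsoBelow N (ofChainMap φ)) :
    ℰ.ExactBelow N (ofChain (HomologicalComplex.homotopyCofiber φ)) :=
  ExactBelow.of_iso (coneToCofiber φ) (isIso_coneToCofiber φ) h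

/-- The mapping cone of `f` in the sense of `Cplx` and the one in the sense of `ChainComplex` have
the same induced maps. -/
lemma coneToCofiber_desc {K L M : ChainComplex C ℕ} (f : K ⟶ L) (g : L ⟶ M) (w : f ≫ g = 0)
    (n : ℕ) : (coneToCofiber f).f n ≫
      (HomologicalComplex.homotopyCofiber.desc f g (Homotopy.ofEq w)).f n =
    (coneDesc (ofChainMap f) (ofChainMap g)
      fun n => congrArg (fun t => HomologicalComplex.Hom.f t n) w).f n := by
  cases n with
  | zero => exact HomologicalComplex.homotopyCofiber.inrX_desc_f f g (Homotopy.ofEq w) 0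
  | succ n =>
    have h₁ := HomologicalComplex.homotopyCofiber.inrX_desc_f f g (Homotopy.ofEq w) (n + 1)
    have h₂ := HomologicalComplex.homotopyCofiber.inlX_desc_f f g (Homotopy.ofEq w) n (n + 1) rfl
    change biprod.desc (HomologicalComplex.homotopyCofiber.inlX f n (n + 1) rfl)
      (HomologicalComplex.homotopyCofiber.inrX f (n + 1)) ≫ _ = biprod.snd ≫ g.f (n + 1)
    ext
    · rw [biprod.inl_desc_assoc, biprod.inl_snd_assoc, zero_comp]
      exact h₂.trans rfl
    · rw [biprod.inr_desc_assoc, biprod.inr_snd_assoc]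
      exact h₁

lemma ExactStructure.IsHUnital.pureExactBelow (hA : ℰ.IsHUnital A) (N : ℕ) :
    ℰ.PureExactBelow N (barCplx (regular A)) := fun V => by
  have h := (isExact_iff_exactBelow _).1 (hA V) N
  let e : Hom (ofChain (((tensorRight V).mapHomologicalComplex _).obj (barComplex A)))
      ((barCplx (regular A)).tensor V) :=
    { f := fun n => 𝟙 (((regular A).tensorPow n).X ⊗ V)
      comm := fun n => by
        have h : (barComplex A).d (n + 1) n = bPrime (regular A) n :=
          ChainComplex.of_d (fun n => ((regular A).tensorPow n).X) (fun n => bPrime (regular A) n) n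
        exact (Category.id_comp _).trans ((congrArg (· ▷ V) h).symm.trans
          (Category.comp_id _).symm) }
  exact h.of_iso e fun n => inferInstanceAs (IsIso (𝟙 _))

lemma AlgConflation.IsPure.pureConflation {S : AlgConflation ℰ} (hS : S.IsPure) :
    ℰ.PureConflation S.i.hom S.p.hom := fun V =>
  ⟨_, hS.2 V⟩

theorem isPureCofibreSequence_hochschildMap {S : AlgConflation ℰ} (hS : S.IsPure)
    (hI : ℰ.IsHUnital S.I) :
    ℰ.IsPureCofibreSequence (hochschildMap S.i) (hochschildMap S.p) := by
  refine ⟨hochschildMap_comp_eq_zero S.zero, fun V => ?_⟩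
  refine (isExact_iff_exactBelow _).2 fun N => ?_
  have h := pureQuasiIsoBelow_ofChain hS.pureConflation hI.pureExactBelow N V
  refine QuasiIsoBelow.exactBelow_homotopyCofiber (QuasiIsoBelow.of_iso
    ((coneToCofiber (hochschildMap S.i)).tensor V) (Hom.id _)
    (fun n => ?_) (fun n => inferInstanceAs (IsIso (𝟙 _))) (fun n => ?_) h)
  · have := isIso_coneToCofiber (hochschildMap S.i) n
    exact inferInstanceAs (IsIso ((coneToCofiber (hochschildMap S.i)).f n ▷ V))
  · refine Eq.trans ?_ (Category.comp_id _).symm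
    refine (comp_whiskerRight _ _ V).symm.trans (congrArg (· ▷ V) ?_)
    exact coneToCofiber_desc _ _ _ n

end Excision

/-! ### Long exact sequences of complexes of abelian groups -/

section LongExact

variable {ι : Type*} {c : ComplexShape ι}

section Elements

variable (K : HomologicalComplex AddCommGrpCat.{v} c)

lemma d_apply_d_apply (i j k : ι) (x : K.X i) : K.d j k (K.d i j x) = 0 := by
  rw [← ConcreteCategory.comp_apply, K.d_comp_d]
  rfl

lemma hom_f_d_apply {K L : HomologicalComplex AddCommGrpCat.{v} c} (f : K ⟶ L) (i j : ι)
    (x : K.X i) : f.f j (K.d i j x) = L.d i j (f.f i x) := by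
  rw [← ConcreteCategory.comp_apply, ← ConcreteCategory.comp_apply, f.comm]

lemma d_iCycles_apply (i j : ι) (z : K.cycles i) : K.d i j (K.iCycles i z) = 0 := by
  rw [← ConcreteCategory.comp_apply, K.iCycles_d]
  rfl

lemma exists_iCycles_eq {i : ι} (x : K.X i) (hx : ∀ j, K.d i j x = 0) :
    ∃ z : K.cycles i, K.iCycles i z = x :=
  ⟨(K.sc i).abCyclesIso.inv ⟨x, hx _⟩, (K.sc i).abCyclesIso_inv_apply_iCycles ⟨x, hx _⟩⟩

lemma homologyπ_surjective (i : ι) : Function.Surjective (K.homologyπ i) :=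
  (AddCommGrpCat.epi_iff_surjective _).1 inferInstance

lemma iCycles_injective (i : ι) : Function.Injective (K.iCycles i) :=
  (AddCommGrpCat.mono_iff_injective _).1 inferInstance

lemma homologyπ_eq_zero_iff {j : ι} (z : K.cycles j) :
    K.homologyπ j z = 0 ↔ ∃ i x, K.d i j x = K.iCycles j z := by
  constructor
  · intro h
    have hS : (ShortComplex.mk (K.toCycles (c.prev j) j) (K.homologyπ j)
        (K.toCycles_comp_homologyπ _ _)).Exact :=
      ShortComplex.exact_of_g_is_cokernel _ (K.homologyIsCokernel _ _ rfl)
    obtain ⟨x, hx⟩ := (ShortComplex.ab_exact_iff _).1 hS z h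
    refine ⟨_, x, ?_⟩
    rw [← hx, ← ConcreteCategory.comp_apply, K.toCycles_i]
  · rintro ⟨i, x, hx⟩
    have : K.toCycles i j x = z := by
      apply iCycles_injective
      rw [← hx, ← ConcreteCategory.comp_apply, K.toCycles_i]
    rw [← this, ← ConcreteCategory.comp_apply, K.toCycles_comp_homologyπ]
    rfl

lemma d_apply_eq_zero {i j : ι} (hij : ¬ c.Rel i j) (x : K.X i) : K.d i j x = 0 := by
  rw [K.shape _ _ hij]
  rfl

lemma exists_d_eq {i j : ι} (hij : c.Rel i j) (i' : ι) (x : K.X i') :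
    ∃ x' : K.X i, K.d i j x' = K.d i' j x := by
  by_cases hi : c.Rel i' j
  · obtain rfl := c.prev_eq hij hi
    exact ⟨x, rfl⟩
  · exact ⟨0, by rw [map_zero, d_apply_eq_zero K hi]⟩

lemma exists_d_prev_eq (i j : ι) (x : K.X i) :
    ∃ x' : K.X (c.prev j), K.d (c.prev j) j x' = K.d i j x := by
  by_cases hi : c.Rel i j
  · obtain rfl := c.prev_eq' hi
    exact ⟨x, rfl⟩
  · exact ⟨0, by rw [map_zero, d_apply_eq_zero K hi]⟩

lemma homologyMap_homologyπ {K L : HomologicalComplex AddCommGrpCat.{v} c} (f : K ⟶ L) (i : ι)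
    (z : K.cycles i) (z' : L.cycles i) (h : L.iCycles i z' = f.f i (K.iCycles i z)) :
    HomologicalComplex.homologyMap f i (K.homologyπ i z) = L.homologyπ i z' := by
  have : HomologicalComplex.cyclesMap f i z = z' := by
    apply iCycles_injective
    rw [h, ← ConcreteCategory.comp_apply, ← ConcreteCategory.comp_apply,
      HomologicalComplex.cyclesMap_i]
  rw [← this, ← ConcreteCategory.comp_apply, ← ConcreteCategory.comp_apply,
    HomologicalComplex.homologyπ_naturality]

end Elements

variable {K L M : HomologicalComplex AddCommGrpCat.{v} c}

/-- Complexes `K ⟶ L ⟶ M` of abelian groups with zero composite such that `L ⟶ M` is surjective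
and `K` is quasi-isomorphic to its kernel. The last two conditions say that the map from the
homology of `K` to the homology of the kernel is injective and surjective. -/
structure CofibreSequence (f : K ⟶ L) (g : L ⟶ M) : Prop where
  zero : ∀ i x, g.f i (f.f i x) = 0
  surjective : ∀ i, Function.Surjective (g.f i)
  injective_homology : ∀ {i j} (x : K.X j) (y : L.X i), (∀ k, K.d j k x = 0) →
    f.f j x = L.d i j y → g.f i y = 0 → ∃ i' x', K.d i' j x' = x
  surjective_homology : ∀ {j} (l : L.X j), (∀ k, L.d j k l = 0) → g.f j l = 0 →
    ∃ (x : K.X j) (i : ι) (y : L.X i), (∀ k, K.d j k x = 0) ∧ g.f i y = 0 ∧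
      l = f.f j x + L.d i j y

namespace CofibreSequence

variable {f : K ⟶ L} {g : L ⟶ M} (h : CofibreSequence f g)

include h

/-- Cycles `z` in `M` lift to chains `y` in `L` whose boundary comes from a cycle `x` in `K`. Since
`y` may be changed by a chain that vanishes in `M`, the boundary itself, and not only its homology
class, comes from `K`. -/
lemma exists_lift {i : ι} (j : ι) (z : M.X i) (hz : M.d i j z = 0) :
    ∃ (x : K.cycles j) (y : L.X i), f.f j (K.iCycles j x) = L.d i j y ∧ g.f i y = z := by
  by_cases hij : c.Rel i j
  · obtain ⟨y, rfl⟩ := h.surjective i z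
    obtain ⟨x, i', y', hx, hy', e⟩ := h.surjective_homology (L.d i j y)
      (fun k => d_apply_d_apply L i j k y) (by rw [hom_f_d_apply, hz])
    obtain ⟨x, rfl⟩ := exists_iCycles_eq K x hx
    by_cases hi : c.Rel i' j
    · obtain rfl := c.prev_eq hij hi
      exact ⟨x, y - y', by rw [map_sub, e, add_sub_cancel_right], by rw [map_sub, hy', sub_zero]⟩
    · exact ⟨x, y, by rw [e, d_apply_eq_zero L hi, add_zero], rfl⟩
  · obtain ⟨y, rfl⟩ := h.surjective i z
    exact ⟨0, y, by rw [d_apply_eq_zero L hij, map_zero, map_zero], rfl⟩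

/-- The class of the lift in `K` depends only on the class in `M`. -/
lemma homologyπ_eq_zero {i j : ι} (x : K.cycles j) (y : L.X i) (z : M.cycles i)
    (hx : f.f j (K.iCycles j x) = L.d i j y) (hy : g.f i y = M.iCycles i z)
    (hz : M.homologyπ i z = 0) : K.homologyπ j x = 0 := by
  obtain ⟨k, m, hm⟩ := (homologyπ_eq_zero_iff M z).1 hz
  obtain ⟨l, rfl⟩ := h.surjective k m
  rw [homologyπ_eq_zero_iff]
  refine h.injective_homology (i := i) _ (y - L.d k i l) (fun k => d_iCycles_apply K j k x) ?_ ?_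
  · rw [map_sub, d_apply_d_apply, sub_zero, hx]
  · rw [map_sub, hy, hom_f_d_apply, hm, sub_self]

lemma exists_class (i j : ι) (w : M.homology i) :
    ∃ a : K.homology j, ∀ (x : K.cycles j) (y : L.X i) (z : M.cycles i),
      f.f j (K.iCycles j x) = L.d i j y → g.f i y = M.iCycles i z → M.homologyπ i z = w →
        K.homologyπ j x = a := by
  obtain ⟨z, rfl⟩ := homologyπ_surjective M i w
  obtain ⟨x, y, hx, hy⟩ := h.exists_lift j (M.iCycles i z) (d_iCycles_apply M i j z)
  refine ⟨K.homologyπ j x, fun x' y' z' hx' hy' hz' => ?_⟩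
  rw [← sub_eq_zero, ← map_sub]
  refine h.homologyπ_eq_zero (x' - x) (y' - y) (z' - z) ?_ ?_ ?_
  · simp only [map_sub, hx, hx']
  · simp only [map_sub, hy, hy']
  · rw [map_sub, hz', sub_self]

/-- The connecting map. -/
def connecting (i j : ι) : M.homology i ⟶ K.homology j :=
  AddCommGrpCat.ofHom (AddMonoidHom.mk' (fun w => (h.exists_class i j w).choose) fun w w' => by
    obtain ⟨z, rfl⟩ := homologyπ_surjective M i w
    obtain ⟨z', rfl⟩ := homologyπ_surjective M i w'
    obtain ⟨x, y, hx, hy⟩ := h.exists_lift j (M.iCycles i z) (d_iCycles_apply M i j z)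
    obtain ⟨x', y', hx', hy'⟩ := h.exists_lift j (M.iCycles i z') (d_iCycles_apply M i j z')
    rw [← (h.exists_class i j _).choose_spec x y z hx hy rfl,
      ← (h.exists_class i j _).choose_spec x' y' z' hx' hy' rfl]
    refine Eq.trans ((h.exists_class i j _).choose_spec (x + x') (y + y') (z + z') ?_ ?_ ?_).symm
      (map_add (K.homologyπ j).hom x x')
    · simp only [map_add, hx, hx']
    · simp only [map_add, hy, hy']
    · exact map_add (M.homologyπ i).hom z z')

lemma isConnectingMap (i j : ι) : IsConnectingMap f g i j (h.connecting i j) :=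
  fun x y z hx hy => ((h.exists_class i j _).choose_spec x y z hx hy rfl).symm

lemma exact_map (i : ι) : Function.Exact (HomologicalComplex.homologyMap f i)
    (HomologicalComplex.homologyMap g i) := by
  intro w
  constructor
  · obtain ⟨l, rfl⟩ := homologyπ_surjective L i w
    intro hw
    obtain ⟨m, hm⟩ := exists_iCycles_eq M (g.f i (L.iCycles i l)) fun j => by
      rw [← hom_f_d_apply, d_iCycles_apply, map_zero]
    rw [homologyMap_homologyπ g i l m hm, homologyπ_eq_zero_iff] at hw
    obtain ⟨k, m', hm'⟩ := hw
    obtain ⟨l', rfl⟩ := h.surjective k m'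
    obtain ⟨x, k', y, hx, hy, e⟩ := h.surjective_homology (L.iCycles i l - L.d k i l')
      (fun j => by rw [map_sub, d_iCycles_apply, d_apply_d_apply, sub_zero])
      (by rw [map_sub, hom_f_d_apply, hm', hm, sub_self])
    obtain ⟨x, rfl⟩ := exists_iCycles_eq K x hx
    obtain ⟨x', hx'⟩ := exists_iCycles_eq L (f.f i (K.iCycles i x)) fun j => by
      rw [← hom_f_d_apply, d_iCycles_apply, map_zero]
    refine ⟨K.homologyπ i x, ?_⟩
    rw [homologyMap_homologyπ f i x x' hx', ← sub_eq_zero, ← map_sub, homologyπ_eq_zero_iff,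
      map_sub, hx']
    obtain ⟨a, ha⟩ := exists_d_prev_eq L k i l'
    obtain ⟨b, hb⟩ := exists_d_prev_eq L k' i y
    refine ⟨c.prev i, -(a + b), ?_⟩
    rw [map_neg, map_add, ha, hb, eq_sub_of_add_eq e.symm]
    abel
  · rintro ⟨w, rfl⟩
    obtain ⟨x, rfl⟩ := homologyπ_surjective K i w
    obtain ⟨x', hx'⟩ := exists_iCycles_eq L (f.f i (K.iCycles i x)) fun j => by
      rw [← hom_f_d_apply, d_iCycles_apply, map_zero]
    rw [homologyMap_homologyπ f i x x' hx', homologyMap_homologyπ g i x' 0 (by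
      rw [hx', h.zero, map_zero]), map_zero]

lemma exact_connecting (i j : ι) (hij : c.Rel i j) : Function.Exact
    (HomologicalComplex.homologyMap g i) (h.connecting i j) := by
  intro w
  constructor
  · obtain ⟨z, rfl⟩ := homologyπ_surjective M i w
    intro hw
    obtain ⟨x, y, hx, hy⟩ := h.exists_lift j (M.iCycles i z) (d_iCycles_apply M i j z)
    rw [h.isConnectingMap i j x y z hx hy, homologyπ_eq_zero_iff] at hw
    obtain ⟨i', x', hx'⟩ := hw
    obtain ⟨x', e⟩ := exists_d_eq K hij i' x'
    rw [hx'] at e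
    obtain ⟨l, hl⟩ := exists_iCycles_eq L (y - f.f i x') fun k => by
      by_cases hk : c.Rel i k
      · obtain rfl := c.next_eq hij hk
        rw [map_sub, ← hx, ← hom_f_d_apply, e, sub_self]
      · exact d_apply_eq_zero L hk _
    exact ⟨L.homologyπ i l, homologyMap_homologyπ g i l z (by rw [hl, map_sub, h.zero, hy, sub_zero])⟩
  · rintro ⟨w, rfl⟩
    obtain ⟨y, rfl⟩ := homologyπ_surjective L i w
    obtain ⟨z, hz⟩ := exists_iCycles_eq M (g.f i (L.iCycles i y)) fun j => by
      rw [← hom_f_d_apply, d_iCycles_apply, map_zero]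
    rw [homologyMap_homologyπ g i y z hz, h.isConnectingMap i j 0 (L.iCycles i y) z
      (by rw [d_iCycles_apply, map_zero, map_zero]) hz.symm, map_zero]

lemma connecting_exact (i j : ι) (hij : c.Rel i j) : Function.Exact
    (h.connecting i j) (HomologicalComplex.homologyMap f j) := by
  intro w
  constructor
  · obtain ⟨x, rfl⟩ := homologyπ_surjective K j w
    intro hw
    obtain ⟨x', hx'⟩ := exists_iCycles_eq L (f.f j (K.iCycles j x)) fun k => by
      rw [← hom_f_d_apply, d_iCycles_apply, map_zero]
    rw [homologyMap_homologyπ f j x x' hx', homologyπ_eq_zero_iff] at hw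
    obtain ⟨i', y', e⟩ := hw
    obtain ⟨y, hy⟩ := exists_d_eq L hij i' y'
    rw [e, hx'] at hy
    obtain ⟨z, hz⟩ := exists_iCycles_eq M (g.f i y) fun k => by
      by_cases hk : c.Rel i k
      · obtain rfl := c.next_eq hij hk
        rw [← hom_f_d_apply, hy, h.zero]
      · exact d_apply_eq_zero M hk _
    exact ⟨M.homologyπ i z, h.isConnectingMap i j x y z hy.symm hz.symm⟩
  · rintro ⟨w, rfl⟩
    obtain ⟨z, rfl⟩ := homologyπ_surjective M i w
    obtain ⟨x, y, hx, hy⟩ := h.exists_lift j (M.iCycles i z) (d_iCycles_apply M i j z)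
    obtain ⟨x', hx'⟩ := exists_iCycles_eq L (f.f j (K.iCycles j x)) fun j => by
      rw [← hom_f_d_apply, d_iCycles_apply, map_zero]
    rw [h.isConnectingMap i j x y z hx hy, homologyMap_homologyπ f j x x' hx',
      homologyπ_eq_zero_iff]
    exact ⟨i, y, by rw [hx', hx]⟩

lemma surjective_homologyMap (i : ι) (hi : ∀ j, ¬ c.Rel i j) :
    Function.Surjective (HomologicalComplex.homologyMap g i) := by
  intro w
  obtain ⟨z, rfl⟩ := homologyπ_surjective M i w
  obtain ⟨y, hy⟩ := h.surjective i (M.iCycles i z)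
  obtain ⟨l, rfl⟩ := exists_iCycles_eq L y fun j => d_apply_eq_zero L (hi j) _
  exact ⟨L.homologyπ i l, homologyMap_homologyπ g i l z hy.symm⟩

lemma injective_homologyMap (i : ι) (hi : ∀ j, ¬ c.Rel j i) :
    Function.Injective (HomologicalComplex.homologyMap f i) := by
  refine (injective_iff_map_eq_zero _).2 fun w hw => ?_
  obtain ⟨x, rfl⟩ := homologyπ_surjective K i w
  obtain ⟨x', hx'⟩ := exists_iCycles_eq L (f.f i (K.iCycles i x)) fun k => by
    rw [← hom_f_d_apply, d_iCycles_apply, map_zero]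
  rw [homologyMap_homologyπ f i x x' hx', homologyπ_eq_zero_iff] at hw
  obtain ⟨j, y, e⟩ := hw
  rw [homologyπ_eq_zero_iff]
  refine h.injective_homology (i := j) _ 0 (fun k => d_iCycles_apply K i k x) ?_ (map_zero _)
  rw [← hx', ← e, d_apply_eq_zero L (hi j), d_apply_eq_zero L (hi j)]

lemma connecting_naturality {K' L' M' : HomologicalComplex AddCommGrpCat.{v} c} {f' : K' ⟶ L'}
    {g' : L' ⟶ M'} (h' : CofibreSequence f' g') (a : K ⟶ K') (b : L ⟶ L') (e : M ⟶ M')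
    (hab : f ≫ b = a ≫ f') (hbe : g ≫ e = b ≫ g') (i j : ι) :
    h.connecting i j ≫ HomologicalComplex.homologyMap a j =
      HomologicalComplex.homologyMap e i ≫ h'.connecting i j := by
  have hab' : ∀ k u, b.f k (f.f k u) = f'.f k (a.f k u) := fun k u =>
    ConcreteCategory.congr_hom (HomologicalComplex.congr_hom hab k) u
  have hbe' : ∀ k u, e.f k (g.f k u) = g'.f k (b.f k u) := fun k u =>
    ConcreteCategory.congr_hom (HomologicalComplex.congr_hom hbe k) u
  ext w
  obtain ⟨z, rfl⟩ := homologyπ_surjective M i w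
  obtain ⟨x, y, hx, hy⟩ := h.exists_lift j (M.iCycles i z) (d_iCycles_apply M i j z)
  obtain ⟨x', hx'⟩ := exists_iCycles_eq K' (a.f j (K.iCycles j x)) fun k => by
    rw [← hom_f_d_apply, d_iCycles_apply, map_zero]
  obtain ⟨z', hz'⟩ := exists_iCycles_eq M' (e.f i (M.iCycles i z)) fun k => by
    rw [← hom_f_d_apply, d_iCycles_apply, map_zero]
  rw [ConcreteCategory.comp_apply, ConcreteCategory.comp_apply, h.isConnectingMap i j x y z hx hy,
    homologyMap_homologyπ a j x x' hx', homologyMap_homologyπ e i z z' hz']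
  refine (h'.isConnectingMap i j x' (b.f i y) z' ?_ ?_).symm
  · rw [hx', ← hom_f_d_apply, ← hx, hab']
  · rw [hz', ← hy, hbe']

end CofibreSequence

end LongExact

/-! ### Exact complexes and maps from projective or to injective objects -/

section Acyclic

set_option linter.unusedSectionVars false

open Cplx ExactStructure

variable {C : Type u} [Category.{v} C] [Preadditive C] {ℰ : ExactStructure C}

namespace Cplx

/-- A map `P ⟶ K_n` is a cycle if its composite with the differential of `K`, if there is one,
vanishes. -/
def IsCycle (K : Cplx C) {P : C} : ∀ {n : ℕ}, (P ⟶ K.X n) → Prop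
  | 0, _ => True
  | n + 1, x => x ≫ K.d n = 0

variable [HasBinaryBiproducts C] {K L M : Cplx C} (f : Hom K L) (g : Hom L M)

/-- The inclusion of the shifted source into the mapping cone. -/
def coneInl (n : ℕ) : K.X n ⟶ (cone f).X (n + 1) :=
  (biprod.inl : K.X n ⟶ K.X n ⊞ L.X (n + 1))

/-- The projection from the mapping cone to the shifted source. -/
def coneFst (n : ℕ) : (cone f).X (n + 1) ⟶ K.X n :=
  (biprod.fst : K.X n ⊞ L.X (n + 1) ⟶ K.X n)

/-- The inclusion of the target into the mapping cone. -/
def coneInr : ∀ n, L.X n ⟶ (cone f).X n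
  | 0 => 𝟙 _
  | n + 1 => (biprod.inr : L.X (n + 1) ⟶ K.X n ⊞ L.X (n + 1))

/-- The projection, in each degree, from the mapping cone to the target. -/
def coneSnd : ∀ n, (cone f).X n ⟶ L.X n
  | 0 => 𝟙 _
  | n + 1 => (biprod.snd : K.X n ⊞ L.X (n + 1) ⟶ L.X (n + 1))

@[simp]
lemma coneInl_fst (n : ℕ) : coneInl f n ≫ coneFst f n = 𝟙 _ := biprod.inl_fst

@[simp]
lemma coneInl_fst_assoc (n : ℕ) {Z : C} (h : K.X n ⟶ Z) :
    coneInl f n ≫ coneFst f n ≫ h = h := by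
  rw [← Category.assoc, coneInl_fst, Category.id_comp]

@[simp]
lemma coneInl_snd (n : ℕ) : coneInl f n ≫ coneSnd f (n + 1) = 0 := biprod.inl_snd

@[simp]
lemma coneInl_snd_assoc (n : ℕ) {Z : C} (h : L.X (n + 1) ⟶ Z) :
    coneInl f n ≫ coneSnd f (n + 1) ≫ h = 0 := by
  rw [← Category.assoc, coneInl_snd, zero_comp]

@[simp]
lemma coneInr_fst (n : ℕ) : coneInr f (n + 1) ≫ coneFst f n = 0 := biprod.inr_fst

@[simp]
lemma coneInr_fst_assoc (n : ℕ) {Z : C} (h : K.X n ⟶ Z) :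
    coneInr f (n + 1) ≫ coneFst f n ≫ h = 0 := by
  rw [← Category.assoc, coneInr_fst, zero_comp]

@[simp]
lemma coneInr_snd (n : ℕ) : coneInr f n ≫ coneSnd f n = 𝟙 _ := by
  cases n with
  | zero => exact Category.comp_id _
  | succ n => exact biprod.inr_snd

@[simp]
lemma coneInr_snd_assoc (n : ℕ) {Z : C} (h : L.X n ⟶ Z) :
    coneInr f n ≫ coneSnd f n ≫ h = h := by
  rw [← Category.assoc, coneInr_snd, Category.id_comp]

lemma cone_total (n : ℕ) :
    coneFst f n ≫ coneInl f n + coneSnd f (n + 1) ≫ coneInr f (n + 1) = 𝟙 _ :=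
  biprod.total

@[simp]
lemma cone_d_snd (n : ℕ) :
    (cone f).d n ≫ coneSnd f n = coneFst f n ≫ f.f n + coneSnd f (n + 1) ≫ L.d n := by
  refine Eq.trans ?_ biprod.desc_eq
  cases n with
  | zero => exact Category.comp_id _
  | succ n => exact biprod.lift_snd _ _

@[simp]
lemma cone_d_snd_assoc (n : ℕ) {Z : C} (h : L.X n ⟶ Z) :
    (cone f).d n ≫ coneSnd f n ≫ h = (coneFst f n ≫ f.f n + coneSnd f (n + 1) ≫ L.d n) ≫ h := by
  rw [← Category.assoc, cone_d_snd]

@[simp]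
lemma cone_d_fst (n : ℕ) : (cone f).d (n + 1) ≫ coneFst f n = -(coneFst f (n + 1) ≫ K.d n) :=
  biprod.lift_fst _ _

@[simp]
lemma cone_d_fst_assoc (n : ℕ) {Z : C} (h : K.X n ⟶ Z) :
    (cone f).d (n + 1) ≫ coneFst f n ≫ h = (-(coneFst f (n + 1) ≫ K.d n)) ≫ h := by
  rw [← Category.assoc, cone_d_fst]

@[simp]
lemma coneInr_d (n : ℕ) : coneInr f (n + 1) ≫ (cone f).d n = L.d n ≫ coneInr f n := by
  cases n with
  | zero => exact (biprod.inr_desc _ _).trans (Category.comp_id _).symm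
  | succ n =>
    rw [← Category.comp_id (coneInr f (n + 2) ≫ (cone f).d (n + 1)), ← cone_total,
      Preadditive.comp_add]
    simp

@[simp]
lemma coneInr_d_assoc (n : ℕ) {Z : C} (h : (cone f).X n ⟶ Z) :
    coneInr f (n + 1) ≫ (cone f).d n ≫ h = (L.d n ≫ coneInr f n) ≫ h := by
  rw [← Category.assoc, coneInr_d]

@[simp]
lemma coneInl_d_zero : coneInl f 0 ≫ (cone f).d 0 = f.f 0 ≫ coneInr f 0 :=
  (biprod.inl_desc _ _).trans (Category.comp_id _).symm

@[simp]
lemma coneInl_d_zero_assoc {Z : C} (h : (cone f).X 0 ⟶ Z) :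
    coneInl f 0 ≫ (cone f).d 0 ≫ h = (f.f 0 ≫ coneInr f 0) ≫ h := by
  rw [← Category.assoc, coneInl_d_zero]

@[simp]
lemma coneInl_d_succ (n : ℕ) : coneInl f (n + 1) ≫ (cone f).d (n + 1) =
    f.f (n + 1) ≫ coneInr f (n + 1) - K.d n ≫ coneInl f n := by
  rw [← Category.comp_id (coneInl f (n + 1) ≫ (cone f).d (n + 1)), ← cone_total,
    Preadditive.comp_add]
  simp [neg_add_eq_sub]

@[simp]
lemma coneInl_d_succ_assoc (n : ℕ) {Z : C} (h : (cone f).X (n + 1) ⟶ Z) :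
    coneInl f (n + 1) ≫ (cone f).d (n + 1) ≫ h = (f.f (n + 1) ≫ coneInr f (n + 1) - K.d n ≫ coneInl f n) ≫ h := by
  rw [← Category.assoc, coneInl_d_succ]

lemma coneDesc_f_eq (w : ∀ n, f.f n ≫ g.f n = 0) (n : ℕ) :
    (coneDesc f g w).f n = coneSnd f n ≫ g.f n := by
  cases n with
  | zero => exact (Category.id_comp _).symm
  | succ n => rfl

end Cplx

namespace ExactStructure

/-- All maps from `P` lift along `p`. -/
def Lifts (P : C) {X Y : C} (p : X ⟶ Y) : Prop := ∀ f : P ⟶ Y, ∃ g : P ⟶ X, g ≫ p = f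

/-- All maps to `J` extend along `i`. -/
def Extends (J : C) {X Y : C} (i : X ⟶ Y) : Prop := ∀ f : X ⟶ J, ∃ g : Y ⟶ J, i ≫ g = f

lemma exists_lift_of_projective {P : C} (hP : ℰ.IsProjective P) {X : Cplx C} {n : ℕ}
    (h : ℰ.Factors X n) (x : P ⟶ X.X (n + 1)) (hx : x ≫ X.d n = 0) :
    ∃ y : P ⟶ X.X (n + 2), y ≫ X.d (n + 1) = x := by
  obtain ⟨Z, Z', a, m, ι, π, h₁, h₂, h₃, h₄, h₅⟩ := h
  have := h₂.mono
  obtain ⟨l, rfl⟩ := h₃.lift x (by rw [← cancel_mono m, Category.assoc, h₁, hx, zero_comp])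
  obtain ⟨y, rfl⟩ := hP π h₅ l
  exact ⟨y, by rw [← h₄, Category.assoc]⟩

lemma exists_extension_of_injective {J : C} (hJ : ℰ.IsInjective J) {X : Cplx C} {n : ℕ}
    (h : ℰ.Factors X n) (x : X.X (n + 1) ⟶ J) (hx : X.d (n + 1) ≫ x = 0) :
    ∃ y : X.X n ⟶ J, X.d n ≫ y = x := by
  obtain ⟨Z, Z', a, m, ι, π, h₁, h₂, h₃, h₄, h₅⟩ := h
  obtain ⟨K, k, w, hπ⟩ := h₅
  have := Conflation.epi ⟨w, hπ⟩
  obtain ⟨l, rfl⟩ := h₃.desc x (by rw [← cancel_epi π, reassoc_of% h₄, hx, comp_zero])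
  obtain ⟨y, rfl⟩ := hJ m h₂ l
  exact ⟨y, by rw [← h₁, Category.assoc]⟩

variable [HasBinaryBiproducts C] {K L M : Cplx C} {f : Hom K L} {g : Hom L M}
  (w : ∀ n, f.f n ≫ g.f n = 0) (hT : ∀ n, ℰ.Factors (cone (coneDesc f g w)) n)

section Projective

variable {P : C} (hP : ℰ.IsProjective P)

include hP hT

/-- If `K ⟶ L ⟶ M` has an acyclic total cone, a cycle `x` in `K` whose image in `L` bounds a chain
that vanishes in `M` is a boundary: `(x, -y, 0)` is a cycle of the total cone. -/
lemma exists_boundary_of_projective (n : ℕ) (x : P ⟶ K.X n) (y : P ⟶ L.X (n + 1))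
    (hx : K.IsCycle x) (hxy : x ≫ f.f n = y ≫ L.d n) (hy : y ≫ g.f (n + 1) = 0) :
    ∃ x' : P ⟶ K.X (n + 1), x' ≫ K.d n = x := by
  have h₁ : (x ≫ coneInl f n - y ≫ coneInr f (n + 1)) ≫ (cone f).d n = 0 := by
    cases n with
    | zero => simp [reassoc_of% hxy]
    | succ n =>
      have hx : x ≫ K.d n = 0 := hx
      simp [reassoc_of% hxy, reassoc_of% hx]
  obtain ⟨s, hs⟩ := exists_lift_of_projective hP (hT (n + 1))
    ((x ≫ coneInl f n - y ≫ coneInr f (n + 1)) ≫ coneInl (coneDesc f g w) (n + 1)) (by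
      rw [Category.assoc, coneInl_d_succ, Preadditive.comp_sub, reassoc_of% h₁, coneDesc_f_eq]
      simp [reassoc_of% hy])
  refine ⟨s ≫ coneFst (coneDesc f g w) (n + 2) ≫ coneFst f (n + 1), ?_⟩
  have h₂ := congrArg (· ≫ coneFst (coneDesc f g w) (n + 1) ≫ coneFst f n) hs
  simpa using h₂

/-- If `K ⟶ L ⟶ M` has an acyclic total cone, a cycle in `L` that vanishes in `M` is homologous,
through a chain that vanishes in `M`, to the image of a cycle in `K`. -/
lemma exists_cycle_of_projective (hg : ∀ n, Lifts P (g.f n)) (n : ℕ) (l : P ⟶ L.X n)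
    (hl : L.IsCycle l) (hlg : l ≫ g.f n = 0) :
    ∃ (x : P ⟶ K.X n) (y : P ⟶ L.X (n + 1)), K.IsCycle x ∧ y ≫ g.f (n + 1) = 0 ∧
      l = x ≫ f.f n + y ≫ L.d n := by
  obtain ⟨s, hs⟩ := exists_lift_of_projective hP (hT n)
    ((l ≫ coneInr f n) ≫ coneInl (coneDesc f g w) n) (by
      cases n with
      | zero =>
        rw [Category.assoc, coneInl_d_zero, coneDesc_f_eq]
        simp [reassoc_of% hlg]
      | succ n =>
        have hl : l ≫ L.d n = 0 := hl
        rw [Category.assoc, coneInl_d_succ, coneDesc_f_eq]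
        simp [reassoc_of% hlg, reassoc_of% hl])
  have h₁ := congrArg (· ≫ coneFst (coneDesc f g w) n) hs
  have h₂ := congrArg (· ≫ coneSnd (coneDesc f g w) (n + 1)) hs
  simp only [Category.assoc, cone_d_fst, cone_d_snd, coneInl_fst, coneInl_snd, Category.comp_id,
    comp_zero, coneDesc_f_eq, Preadditive.comp_neg, Preadditive.comp_add] at h₁ h₂
  generalize hs₁ : s ≫ coneFst (coneDesc f g w) (n + 1) = s₁
  generalize hs₂ : s ≫ coneSnd (coneDesc f g w) (n + 2) = s₂
  rw [reassoc_of% hs₁] at h₁ h₂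
  rw [reassoc_of% hs₂] at h₂
  obtain ⟨h, rfl⟩ := hg (n + 2) s₂
  refine ⟨-(s₁ ≫ coneFst f n), -(s₁ ≫ coneSnd f (n + 1) + h ≫ L.d (n + 1)), ?_, ?_, ?_⟩
  · cases n with
    | zero => trivial
    | succ n =>
      change (-(s₁ ≫ coneFst f (n + 1))) ≫ K.d n = 0
      have := congrArg (· ≫ coneFst f n) h₁
      simpa using this
  · rw [Preadditive.neg_comp, Preadditive.add_comp, Category.assoc, Category.assoc, ← g.comm]
    rw [Category.assoc] at h₂
    rw [h₂, neg_zero]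
  · have := congrArg (· ≫ coneSnd f n) h₁
    simp only [Preadditive.neg_comp, Category.assoc, cone_d_snd, Preadditive.comp_add,
      coneInr_snd, Category.comp_id] at this
    rw [← this]
    simp [L.d_comp_d]
    abel

end Projective

section Injective

variable {J : C} (hJ : ℰ.IsInjective J)

include hJ hT

/-- If `K ⟶ L ⟶ M` has an acyclic total cone, a cocycle `x` on `M` whose restriction to `L` is the
coboundary of a cochain that vanishes on `K` is a coboundary. -/
lemma exists_coboundary_of_injective (n : ℕ) (x : M.X (n + 1) ⟶ J) (y : L.X n ⟶ J)
    (hx : M.d (n + 1) ≫ x = 0) (hxy : g.f (n + 1) ≫ x = L.d n ≫ y) (hy : f.f n ≫ y = 0) :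
    ∃ x' : M.X n ⟶ J, M.d n ≫ x' = x := by
  obtain ⟨s, hs⟩ := exists_extension_of_injective hJ (hT n)
    (coneSnd (coneDesc f g w) (n + 1) ≫ x + coneFst (coneDesc f g w) n ≫ coneSnd f n ≫ y) (by
      simp [hx, coneDesc_f_eq, hxy, hy])
  refine ⟨coneInr (coneDesc f g w) n ≫ s, ?_⟩
  have h₂ := congrArg (coneInr (coneDesc f g w) (n + 1) ≫ ·) hs
  simpa using h₂

/-- If `K ⟶ L ⟶ M` has an acyclic total cone, a cocycle on `L_0` that vanishes on `K` is the
restriction of a cocycle on `M`. -/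
lemma exists_cocycle_zero_of_injective (l : L.X 0 ⟶ J) (hl : L.d 0 ≫ l = 0)
    (hlf : f.f 0 ≫ l = 0) : ∃ k : M.X 0 ⟶ J, M.d 0 ≫ k = 0 ∧ l = g.f 0 ≫ k := by
  obtain ⟨s, hs⟩ := exists_extension_of_injective hJ (hT 0)
    (coneFst (coneDesc f g w) 0 ≫ coneSnd f 0 ≫ l) (by
      simp [hl, hlf])
  have h₁ := congrArg (coneInl (coneDesc f g w) 0 ≫ ·) hs
  have h₂ := congrArg (coneInr (coneDesc f g w) 1 ≫ ·) hs
  have h₃ := congrArg (coneInr f 0 ≫ ·) h₁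
  simp only [coneInr_d_assoc, coneInr_fst_assoc, coneInl_d_zero_assoc, coneDesc_f_eq,
    coneInl_fst_assoc, coneInr_snd_assoc, Category.assoc] at h₂ h₃
  exact ⟨_, h₂, h₃.symm⟩

/-- If `K ⟶ L ⟶ M` has an acyclic total cone, a cocycle on `L` that vanishes on `K` is
cohomologous, through a cochain that vanishes on `K`, to the restriction of a cocycle on `M`. -/
lemma exists_cocycle_succ_of_injective (hf : ∀ n, Extends J (f.f n)) (n : ℕ)
    (l : L.X (n + 1) ⟶ J) (hl : L.d (n + 1) ≫ l = 0) (hlf : f.f (n + 1) ≫ l = 0) :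
    ∃ (k : M.X (n + 1) ⟶ J) (y : L.X n ⟶ J), M.d (n + 1) ≫ k = 0 ∧ f.f n ≫ y = 0 ∧
      l = g.f (n + 1) ≫ k + L.d n ≫ y := by
  obtain ⟨s, hs⟩ := exists_extension_of_injective hJ (hT (n + 1))
    (coneFst (coneDesc f g w) (n + 1) ≫ coneSnd f (n + 1) ≫ l) (by
      simp [hl, hlf])
  have h₁ := congrArg (coneInl (coneDesc f g w) (n + 1) ≫ ·) hs
  have h₂ := congrArg (coneInr (coneDesc f g w) (n + 2) ≫ ·) hs
  have h₃ := congrArg (coneInr f (n + 1) ≫ ·) h₁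
  simp only [coneInr_d_assoc, coneInr_fst_assoc, coneInl_d_succ_assoc, coneDesc_f_eq,
    coneInl_fst_assoc, coneInr_snd_assoc, Category.assoc, Preadditive.comp_sub,
    Preadditive.sub_comp] at h₂ h₃
  cases n with
  | zero =>
    have h₄ := congrArg (coneInl f 0 ≫ ·) h₁
    simp only [coneInl_d_zero_assoc, coneInl_d_succ_assoc, coneInl_fst_assoc, coneInl_snd_assoc,
      coneDesc_f_eq, Category.assoc, Preadditive.comp_sub, Preadditive.sub_comp,
      zero_sub, neg_eq_zero] at h₄
    refine ⟨_, -(coneInr f 0 ≫ coneInl (coneDesc f g w) 0 ≫ s), h₂, ?_, ?_⟩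
    · rw [Preadditive.comp_neg, h₄, neg_zero]
    · rw [Preadditive.comp_neg, ← sub_eq_add_neg, h₃]
  | succ n =>
    have h₄ := congrArg (coneInl f (n + 1) ≫ ·) h₁
    simp only [coneInl_d_succ_assoc, coneInl_fst_assoc, coneInl_snd_assoc,
      coneDesc_f_eq, Category.assoc, Preadditive.comp_sub, Preadditive.sub_comp,
      zero_sub, neg_eq_zero] at h₄
    obtain ⟨h, hh⟩ := hf n (coneInl f n ≫ coneInl (coneDesc f g w) (n + 1) ≫ s)
    rw [← hh, sub_eq_zero] at h₄
    refine ⟨_, L.d n ≫ h - coneInr f (n + 1) ≫ coneInl (coneDesc f g w) (n + 1) ≫ s, h₂, ?_, ?_⟩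
    · rw [Preadditive.comp_sub, h₄, ← Category.assoc, ← Category.assoc, f.comm, sub_self]
    · rw [Preadditive.comp_sub, ← Category.assoc (L.d (n + 1)) (L.d n), L.d_comp_d, zero_comp,
        zero_sub, ← sub_eq_add_neg, h₃]

end Injective

end ExactStructure

end Acyclic

/-! ### Excision for Hochschild homology and cohomology -/

section HomologyExcision

set_option linter.unusedSectionVars false

open Cplx ExactStructure

variable {C : Type u} [Category.{v} C] [Preadditive C] [MonoidalCategory C]

section Generic

variable [HasBinaryBiproducts C] {ℰ : ExactStructure C} {K L M : ChainComplex C ℕ} {f : K ⟶ L}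
  {g : L ⟶ M} (w : f ≫ g = 0)
  (hT : ∀ n, ℰ.Factors (cone (coneDesc (ofChainMap f) (ofChainMap g) fun n =>
    congrArg (fun t => HomologicalComplex.Hom.f t n) w)) n)

include w hT

lemma cofibreSequence_forgetComplex (hP : ℰ.IsProjective (𝟙_ C))
    (hg : ∀ n, Lifts (𝟙_ C) (g.f n)) :
    CofibreSequence (forgetComplex.map f) (forgetComplex.map g) where
  zero i x := by
    have h : f.f i ≫ g.f i = 0 := HomologicalComplex.congr_hom w i
    exact (Category.assoc _ _ _).trans ((congrArg _ h).trans comp_zero)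
  surjective i := hg i
  injective_homology {i j} x y hx hxy hy := by
    obtain ⟨y', hxy', hy'⟩ : ∃ y' : 𝟙_ C ⟶ L.X (j + 1), x ≫ f.f j = y' ≫ L.d (j + 1) j ∧
        y' ≫ g.f (j + 1) = 0 := by
      by_cases hij : (ComplexShape.down ℕ).Rel i j
      · obtain rfl : j + 1 = i := hij
        exact ⟨y, hxy, hy⟩
      · refine ⟨0, ?_, zero_comp⟩
        rw [zero_comp]
        exact hxy.trans (d_apply_eq_zero _ hij y)
    obtain ⟨x', hx'⟩ := exists_boundary_of_projective _ hT hP j x y'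
      (by cases j with
        | zero => trivial
        | succ j => exact hx j) hxy' hy'
    exact ⟨j + 1, x', hx'⟩
  surjective_homology {j} l hl hlg := by
    obtain ⟨x, y, hx, hy, e⟩ := exists_cycle_of_projective _ hT hP hg j l
      (by cases j with
        | zero => trivial
        | succ j => exact hl j) hlg
    refine ⟨x, j + 1, y, fun k => ?_, hy, e⟩
    by_cases hjk : (ComplexShape.down ℕ).Rel j k
    · obtain rfl : k + 1 = j := hjk
      exact hx
    · exact d_apply_eq_zero (forgetComplex.obj K) hjk x

lemma cofibreSequence_dualComplex (hJ : ℰ.IsInjective (𝟙_ C))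
    (hf : ∀ n, Extends (𝟙_ C) (f.f n)) (hg : Epi (g.f 0)) :
    CofibreSequence (dualComplex.map g.op) (dualComplex.map f.op) where
  zero i x := by
    have h : f.f i ≫ g.f i = 0 := HomologicalComplex.congr_hom w i
    exact (Category.assoc _ _ _).symm.trans ((congrArg (· ≫ _) h).trans zero_comp)
  surjective i := hf i
  injective_homology {i j} x y hx hxy hy := by
    cases j with
    | zero =>
      have hij : ¬ (ComplexShape.up ℕ).Rel i 0 := Nat.succ_ne_zero i
      have h : g.f 0 ≫ x = 0 := hxy.trans (d_apply_eq_zero _ hij y)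
      have : x = (0 : M.X 0 ⟶ 𝟙_ C) := (cancel_epi (g.f 0)).1 (h.trans comp_zero.symm)
      exact ⟨0, (0 : M.X 0 ⟶ 𝟙_ C), comp_zero.trans this.symm⟩
    | succ j =>
      obtain ⟨y', hxy', hy'⟩ : ∃ y' : L.X j ⟶ 𝟙_ C, g.f (j + 1) ≫ x = L.d (j + 1) j ≫ y' ∧
          f.f j ≫ y' = 0 := by
        by_cases hij : (ComplexShape.up ℕ).Rel i (j + 1)
        · obtain rfl : i = j := Nat.succ_injective hij
          exact ⟨y, hxy, hy⟩
        · refine ⟨0, ?_, comp_zero⟩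
          rw [comp_zero]
          exact hxy.trans (d_apply_eq_zero _ hij y)
      obtain ⟨x', hx'⟩ := exists_coboundary_of_injective _ hT hJ j x y' (hx (j + 2)) hxy' hy'
      exact ⟨j, x', hx'⟩
  surjective_homology {j} l hl hlf := by
    have key : ∀ {k : M.X j ⟶ 𝟙_ C}, M.d (j + 1) j ≫ k = 0 →
        ∀ m, (dualComplex.obj (Opposite.op M)).d j m k = 0 := by
      intro k hk m
      by_cases hjm : (ComplexShape.up ℕ).Rel j m
      · obtain rfl : j + 1 = m := hjm
        exact hk
      · exact d_apply_eq_zero (dualComplex.obj (Opposite.op M)) hjm k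
    cases j with
    | zero =>
      obtain ⟨k, hk, e⟩ := exists_cocycle_zero_of_injective _ hT hJ l (hl 1) hlf
      refine ⟨k, 0, 0, key hk, map_zero _, ?_⟩
      rw [map_zero, add_zero]
      exact e
    | succ j =>
      obtain ⟨k, y, hk, hy, e⟩ := exists_cocycle_succ_of_injective _ hT hJ hf j l (hl (j + 2)) hlf
      exact ⟨k, j, y, key hk, hy, e⟩

end Generic

section TensorPow

/-- The composite of two algebra homomorphisms. -/
def AlgHom.comp {A B D : Alg C} (f : AlgHom A B) (g : AlgHom B D) : AlgHom A D where
  hom := f.hom ≫ g.hom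
  map_mul := by rw [reassoc_of% f.map_mul, g.map_mul, tensorHom_comp_tensorHom_assoc]

variable {A B : Alg C} {f : AlgHom A B} {M : Bimodule A} {N : Bimodule B}

/-- A class of morphisms that contains the isomorphisms and is closed under composition contains
all tensor powers of a bimodule map `φ` over `f` if it contains `φ ⊗ V` and `V ⊗ f ⊗ V'` for all
objects `V` and `V'`. -/
lemma BimoduleHom.tensorPow_mem (W : MorphismProperty C)
    (hW : ∀ {X Y Z : C} (a : X ⟶ Y) (b : Y ⟶ Z), W a → W b → W (a ≫ b))
    (hW' : ∀ {X Y : C} (a : X ⟶ Y), IsIso a → W a) (φ : BimoduleHom f M N)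
    (hφ : ∀ V, W (φ.hom ▷ V)) (hf : ∀ V V', W ((V ◁ f.hom) ▷ V')) (n : ℕ) :
    W (φ.tensorPow n).hom := by
  have h : ∀ V, W ((φ.tensorPow n).hom ▷ V) := by
    induction n with
    | zero => exact hφ
    | succ n ih =>
      intro V
      change W (((φ.tensorPow n).hom ⊗ₘ f.hom) ▷ V)
      rw [MonoidalCategory.tensorHom_def, comp_whiskerRight, ← Iso.hom_inv_id_assoc (α_ _ _ _)
        ((φ.tensorPow n).hom ▷ A.X ▷ V), ← associator_inv_naturality_left]
      exact hW _ _ (hW _ _ (hW' _ inferInstance) (hW _ _ (ih _) (hW' _ inferInstance))) (hf _ _)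
  have e : (φ.tensorPow n).hom = (ρ_ _).inv ≫ (φ.tensorPow n).hom ▷ 𝟙_ C ≫ (ρ_ _).hom := by
    rw [rightUnitor_naturality, Iso.inv_hom_id_assoc]
  rw [e]
  exact hW _ _ (hW' _ inferInstance) (hW _ _ (h _) (hW' _ inferInstance))

end TensorPow

variable [MonoidalPreadditive C] [HasBinaryBiproducts C] [SymmetricCategory C]

lemma hochschildMap_comm {A B A' B' : Alg C} {f : AlgHom A B} {f' : AlgHom A' B'}
    {a : AlgHom A A'} {b : AlgHom B B'} (h : f.hom ≫ b.hom = a.hom ≫ f'.hom) :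
    hochschildMap f ≫ hochschildMap b = hochschildMap a ≫ hochschildMap f' := by
  ext n
  cases n with
  | zero => exact h
  | succ n =>
    let c : AlgHom A B' := f.comp b
    have h₁ := BimoduleHom.tensorPow_comp (adjoinUnitMap f) (adjoinUnitMap b) (adjoinUnitMap c) rfl
      (by change biprod.map _ _ ≫ biprod.map _ _ = biprod.map _ _
          ext <;> simp [c, AlgHom.comp]) (n + 1)
    have h₂ := BimoduleHom.tensorPow_comp (adjoinUnitMap a) (adjoinUnitMap f') (adjoinUnitMap c)
      h.symm
      (by change biprod.map _ _ ≫ biprod.map _ _ = biprod.map _ _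
          ext <;> simp [c, AlgHom.comp, h]) (n + 1)
    exact h₁.trans h₂.symm

section Alg

variable [HasZeroObject C] {ℰ : ExactStructure C} {I E Q : Alg C} {i : AlgHom I E} {p : AlgHom E Q}

lemma lifts_hochschildMap (hP : ℰ.IsProjective (𝟙_ C)) (h : ℰ.PureConflation i.hom p.hom) (n : ℕ) :
    Lifts (𝟙_ C) ((hochschildMap p).f n) := by
  cases n with
  | zero => exact hP _ h.conflation.isDeflation
  | succ n =>
    refine BimoduleHom.tensorPow_mem (fun _ _ a => Lifts (𝟙_ C) a) (fun a b ha hb x => ?_)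
      (fun a _ x => ⟨x ≫ inv a, by simp⟩) (adjoinUnitMap p)
      (fun V => hP _ (h.biprod_inl.whiskerRight V).conflation.isDeflation)
      (fun V V' => hP _ ((h.whiskerLeft V).whiskerRight V').conflation.isDeflation) (n + 1)
    obtain ⟨y, rfl⟩ := hb x
    obtain ⟨z, rfl⟩ := ha y
    exact ⟨z, (Category.assoc _ _ _).symm⟩

lemma extends_hochschildMap (hJ : ℰ.IsInjective (𝟙_ C)) (h : ℰ.PureConflation i.hom p.hom)
    (n : ℕ) : Extends (𝟙_ C) ((hochschildMap i).f n) := by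
  cases n with
  | zero => exact hJ _ h.conflation.isInflation
  | succ n =>
    refine BimoduleHom.tensorPow_mem (fun _ _ a => Extends (𝟙_ C) a) (fun a b ha hb x => ?_)
      (fun a _ x => ⟨inv a ≫ x, by simp⟩) (adjoinUnitMap i)
      (fun V => hJ _ (h.biprod_id_map.whiskerRight V).conflation.isInflation)
      (fun V V' => hJ _ ((h.whiskerLeft V).whiskerRight V').conflation.isInflation) (n + 1)
    obtain ⟨y, rfl⟩ := ha x
    obtain ⟨z, rfl⟩ := hb y
    exact ⟨z, Category.assoc _ _ _⟩

end Alg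

variable [HasZeroObject C] {ℰ : ExactStructure C}

lemma factors_cone_hochschildMap {S : AlgConflation ℰ} (hS : S.IsPure) (hI : ℰ.IsHUnital S.I)
    (n : ℕ) : ℰ.Factors (cone (coneDesc (ofChainMap (hochschildMap S.i))
      (ofChainMap (hochschildMap S.p)) fun n => congrArg (fun t => HomologicalComplex.Hom.f t n)
        (hochschildMap_comp_eq_zero S.zero))) n :=
  factors_of_exactBelow (fun N =>
    (pureQuasiIsoBelow_ofChain hS.pureConflation hI.pureExactBelow N).pureExactBelow_cone.exactBelow)
    n

lemma cofibreSequence_homology (hP : ℰ.IsProjective (𝟙_ C)) {S : AlgConflation ℰ} (hS : S.IsPure)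
    (hI : ℰ.IsHUnital S.I) :
    CofibreSequence (forgetComplex.map (hochschildMap S.i))
      (forgetComplex.map (hochschildMap S.p)) :=
  cofibreSequence_forgetComplex (hochschildMap_comp_eq_zero S.zero) (factors_cone_hochschildMap hS hI) hP
    (lifts_hochschildMap hP hS.pureConflation)

lemma cofibreSequence_cohomology (hJ : ℰ.IsInjective (𝟙_ C)) {S : AlgConflation ℰ} (hS : S.IsPure)
    (hI : ℰ.IsHUnital S.I) :
    CofibreSequence (dualComplex.map (hochschildMap S.p).op)
      (dualComplex.map (hochschildMap S.i).op) :=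
  cofibreSequence_dualComplex (hochschildMap_comp_eq_zero S.zero) (factors_cone_hochschildMap hS hI) hJ
    (extends_hochschildMap hJ hS.pureConflation) hS.pureConflation.conflation.epi

end HomologyExcision

end HochschildExcision

end

theorem theorem3p7 {C : Type u} [Category.{v} C] [Preadditive C] [HasZeroObject C]
    [HasBinaryBiproducts C]
    [MonoidalCategory C] [MonoidalPreadditive C] [SymmetricCategory C]
    (ℰ : ExactStructure C) :
    (∀ S : AlgConflation ℰ, S.IsPure → ℰ.IsHUnital S.I →
      ℰ.IsPureCofibreSequence (hochschildMap S.i) (hochschildMap S.p)) ∧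
    (ℰ.IsProjective (𝟙_ C) →
      ∃ δ : ∀ S : AlgConflation ℰ, S.IsPure → ℰ.IsHUnital S.I →
          ∀ n : ℕ, HHHomology S.Q (n + 1) ⟶ HHHomology S.I n,
        (∀ (S : AlgConflation ℰ) (hS : S.IsPure) (hI : ℰ.IsHUnital S.I),
          (∀ n : ℕ,
            IsConnectingMap (forgetComplex.map (hochschildMap S.i))
              (forgetComplex.map (hochschildMap S.p)) (n + 1) n (δ S hS hI n) ∧
            Function.Exact (HHHomologyMap S.i n) (HHHomologyMap S.p n) ∧
            Function.Exact (HHHomologyMap S.p (n + 1)) (δ S hS hI n) ∧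
            Function.Exact (δ S hS hI n) (HHHomologyMap S.i n)) ∧
          Function.Surjective (HHHomologyMap S.p 0)) ∧
        (∀ (S T : AlgConflation ℰ) (hS : S.IsPure) (hI : ℰ.IsHUnital S.I)
          (hT : T.IsPure) (hJ : ℰ.IsHUnital T.I) (φ : AlgConflationHom S T) (n : ℕ),
          δ S hS hI n ≫ HHHomologyMap φ.onI n =
            HHHomologyMap φ.onQ (n + 1) ≫ δ T hT hJ n)) ∧
    (ℰ.IsInjective (𝟙_ C) →
      ∃ δ : ∀ S : AlgConflation ℰ, S.IsPure → ℰ.IsHUnital S.I →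
          ∀ n : ℕ, HHCohomology S.I n ⟶ HHCohomology S.Q (n + 1),
        (∀ (S : AlgConflation ℰ) (hS : S.IsPure) (hI : ℰ.IsHUnital S.I),
          (∀ n : ℕ,
            IsConnectingMap (dualComplex.map (hochschildMap S.p).op)
              (dualComplex.map (hochschildMap S.i).op) n (n + 1) (δ S hS hI n) ∧
            Function.Exact (HHCohomologyMap S.p n) (HHCohomologyMap S.i n) ∧
            Function.Exact (HHCohomologyMap S.i n) (δ S hS hI n) ∧
            Function.Exact (δ S hS hI n) (HHCohomologyMap S.p (n + 1))) ∧
          Function.Injective (HHCohomologyMap S.p 0)) ∧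
        (∀ (S T : AlgConflation ℰ) (hS : S.IsPure) (hI : ℰ.IsHUnital S.I)
          (hT : T.IsPure) (hJ : ℰ.IsHUnital T.I) (φ : AlgConflationHom S T) (n : ℕ),
          δ T hT hJ n ≫ HHCohomologyMap φ.onQ (n + 1) =
            HHCohomologyMap φ.onI n ≫ δ S hS hI n)) := by
  refine ⟨fun S hS hI => isPureCofibreSequence_hochschildMap hS hI, fun hP => ?_, fun hJ => ?_⟩
  · refine ⟨fun S hS hI n => (cofibreSequence_homology hP hS hI).connecting (n + 1) n,
      fun S hS hI => ⟨fun n => ?_, ?_⟩, fun S T hS hI hT hJ φ n => ?_⟩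
    · have h := cofibreSequence_homology hP hS hI
      exact ⟨h.isConnectingMap (n + 1) n, h.exact_map n, h.exact_connecting (n + 1) n rfl,
        h.connecting_exact (n + 1) n rfl⟩
    · exact (cofibreSequence_homology hP hS hI).surjective_homologyMap 0 fun j => Nat.succ_ne_zero j
    · refine (cofibreSequence_homology hP hS hI).connecting_naturality
        (cofibreSequence_homology hP hT hJ) (forgetComplex.map (hochschildMap φ.onI))
        (forgetComplex.map (hochschildMap φ.onE)) (forgetComplex.map (hochschildMap φ.onQ))
        ?_ ?_ (n + 1) n
      · rw [← Functor.map_comp, ← Functor.map_comp, hochschildMap_comm φ.comm_i]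
      · rw [← Functor.map_comp, ← Functor.map_comp, hochschildMap_comm φ.comm_p]
  · refine ⟨fun S hS hI n => (cofibreSequence_cohomology hJ hS hI).connecting n (n + 1),
      fun S hS hI => ⟨fun n => ?_, ?_⟩, fun S T hS hI hT hJ' φ n => ?_⟩
    · have h := cofibreSequence_cohomology hJ hS hI
      exact ⟨h.isConnectingMap n (n + 1), h.exact_map n, h.exact_connecting n (n + 1) rfl,
        h.connecting_exact n (n + 1) rfl⟩
    · exact (cofibreSequence_cohomology hJ hS hI).injective_homologyMap 0
        fun j => Nat.succ_ne_zero j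
    · refine (cofibreSequence_cohomology hJ hT hJ').connecting_naturality
        (cofibreSequence_cohomology hJ hS hI) (dualComplex.map (hochschildMap φ.onQ).op)
        (dualComplex.map (hochschildMap φ.onE).op) (dualComplex.map (hochschildMap φ.onI).op)
        ?_ ?_ n (n + 1)
      · rw [← Functor.map_comp, ← Functor.map_comp, ← op_comp, ← op_comp,
          hochschildMap_comm φ.comm_p]
      · rw [← Functor.map_comp, ← Functor.map_comp, ← op_comp, ← op_comp,
          hochschildMap_comm φ.comm_i]
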